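/- Fix $p\ge 1$. For each sample size $n>p+1$ let $X_F=X_F^{(n)}$ be an $n\times p$ design matrix with linearly independent columns $x_1,\dots,x_p$ satisfying $x_i'1_n=0$ and $x_i'x_i/n=1$. Models are subsets $\gamma\subseteq\{1,\dots,p\}$ of size $q_\gamma$, $X_\gamma$ consists of the columns of $X_F$ with index in $\gamma$, and $F=\{1,\dots,p\}$. Let the true model be a non-empty $T$: $$y=\alpha_T 1_n+X_T\beta_T+\sigma_T\epsilon,$$ where $\alpha_T\in\mathbb R$, $\sigma_T>0$ and $\beta_T\in\mathbb R^{q_T}$ do not depend on $n$ and all entries of $\beta_T$ are non-zero. The error vector $\epsilon=\epsilon^{(n)}$ has a spherically symmetric density $f_n(\|\epsilon\|^2)$ on $\mathbb R^n$, with $E[\epsilon]=0$ and $\mathrm{Var}[\epsilon]=I_n$. Assume: A1. $\|\epsilon\|^2/n$ is bounded in probability from below and above: for every $c>0$ there is $M>0$ such that $\Pr(M^{-1}<\|\epsilon\|^2/n<M)>1-c$ for all $n>p+1$. A2. $\lim_{n\to\infty}X_F'X_F/n$ exists and is positive definite. Let $R_\gamma^2$ be the coefficient of determination of model $\gamma$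 (with intercept), and define the following Bayes factors of $\gamma\ne\emptyset$ against $F$. * $\widetilde{\mathrm{BF}}^G_{\gamma:F}(\nu)=\left\{\dfrac{\varphi(q_\gamma-\nu,1-R_\gamma^2)}{\varphi(p-\nu,1-R_F^2)}\right\}^{1/2}\left\{\dfrac{(1-R_\gamma^2)^{-n}n^{-q_\gamma}}{(1-R_F^2)^{-n}n^{-p}}\right\}^{1/2}$, where $\varphi(s,r)=rs^{s-1}\{(1/r-1)e\}^{-s}$. * $\mathrm{BF}^G_{\gamma:F}[\nu,k]=I(q_\gamma,R_\gamma^2)/I(p,R_F^2)$, where $$I(q,R^2)=\int_0^\infty g^{\nu/2-1}(1+g^{-1})^{-k/2}(1+g)^{(n-q-1)/2}\{g(1-R^2)+1\}^{-(n-1)/2}\,dg.$$ * $\mathrm{BF}_{\gamma:F}(\nu)=\lim_{h_\alpha,h_\eta,h_g\to\infty} m_\gamma(y|\nu;h)/m_F(y|\nu;h)$, where $m_\gamma(y|\nu;h)$ is the marginal density $$\int_{\mathbb R}\int_{\mathbb R^{q_\gamma}}\int_0^\infty \eta^{n/2}f_n\big(\eta\|y-\alpha 1_n-X_\gamma\beta\|^2\big)\,p(\alpha)\,p(\eta)\,p(\beta|\eta)\,d\eta\,d\beta\,d\alpha$$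 for the proper priors $p(\alpha)=\frac{1}{2h_\alpha}I_{(-h_\alpha,h_\alpha)}(\alpha)$, $p(\eta)=\frac{1}{2\log h_\eta}\eta^{-1}I_{(1/h_\eta,h_\eta)}(\eta)$ and $p(\beta|\eta)=\int_0^{h_g}\frac{\nu}{2}h_g^{-\nu/2}g^{\nu/2-1}\phi_{q_\gamma}\big(\beta\,|\,0,g\eta^{-1}(X_\gamma'X_\gamma)^{-1}\big)dg$, with $\phi_q(\cdot|\mu,\Sigma)$ the $q$-variate normal density. Given Bayes factors $\mathrm{BF}_{\gamma:F}$ and prior model probabilities $\pi_\gamma\ge 0$ (not depending on $n$) with $\sum_\gamma\pi_\gamma=1$, $\pi_\emptyset=0$ and $\pi_T>0$, put $\Pr(\mathcal M_T|y)=\pi_T\mathrm{BF}_{T:F}/\sum_{\gamma\ne\emptyset}\pi_\gamma\mathrm{BF}_{\gamma:F}$. The Bayes factors are called model-selection consistent if, for all such $\pi$, $\Pr(\mathcal M_T|y)\to 1$ in probability under the true model as $n\to\infty$. Then, with $\nu,k$ not depending on $n$ or on the model: 1. $\widetilde{\mathrm{BF}}^G_{\gamma:F}(\nu)$ is model-selection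 consistent for every $\nu<1$. 2. $\mathrm{BF}^G_{\gamma:F}[\nu,k]$ is model-selection consistent for all $k\ge 0$ and $-k<\nu<1$. 3. For every $0<\nu<1$, for every $n>p+1$ the limit defining $\mathrm{BF}_{\gamma:F}(\nu)$ exists and is finite almost surely for all $\gamma\neq\emptyset$, and $\mathrm{BF}_{\gamma:F}(\nu)$ is model-selection consistent. -/

import Mathlib

open MeasureTheory ProbabilityTheory Filter Topology
open scoped Matrix ENNReal

noncomputable section

namespace SSRegression

/-! A submodel of the linear model with `p` predictors is a subset `γ : Finset (Fin p)`;
the null model is `∅`, the full model is `Finset.univ`, and `q_γ` is `γ.card`. -/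

/-- Squared Euclidean norm of a vector. -/
def sqNorm {ι : Type*} [Fintype ι] (v : ι → ℝ) : ℝ := ∑ i, v i ^ 2

/-- The design matrix of the submodel `γ`: the columns of `X` with index in `γ`. -/
def subDesign {n p : ℕ} (X : Matrix (Fin n) (Fin p) ℝ) (γ : Finset (Fin p)) :
    Matrix (Fin n) γ ℝ := X.submatrix id Subtype.val

/-- The vector `y - ȳ 1`. -/
def centered {n : ℕ} (y : Fin n → ℝ) : Fin n → ℝ := fun i => y i - (∑ j, y j) / n

/-- The residual projection `Q_γ = I - X_γ (X_γ' X_γ)⁻¹ X_γ'`. -/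
def residualProj {n p : ℕ} (X : Matrix (Fin n) (Fin p) ℝ) (γ : Finset (Fin p)) :
    Matrix (Fin n) (Fin n) ℝ :=
  1 - subDesign X γ * ((subDesign X γ)ᵀ * subDesign X γ)⁻¹ * (subDesign X γ)ᵀ

/-- The coefficient of determination `R²_γ` of the submodel `γ` (with intercept). -/
def rSquared {n p : ℕ} (X : Matrix (Fin n) (Fin p) ℝ) (y : Fin n → ℝ) (γ : Finset (Fin p)) : ℝ :=
  1 - sqNorm (residualProj X γ *ᵥ centered y) / sqNorm (centered y)

/-! ### Bayes factors given by explicit formulas -/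

/-- `φ(s, r) = r s^(s-1) {(1/r - 1) e}^(-s)`. -/
def phi (s r : ℝ) : ℝ := r * s ^ (s - 1) * ((1 / r - 1) * Real.exp 1) ^ (-s)

/-- The BIC based Bayes factor of `γ` against the full model, for Gaussian errors. -/
def bfBIC {n p : ℕ} (X : Matrix (Fin n) (Fin p) ℝ) (y : Fin n → ℝ) (γ : Finset (Fin p)) : ℝ :=
  Real.sqrt
    (((1 - rSquared X y γ) ^ (-(n : ℤ)) * (n : ℝ) ^ (-(γ.card : ℤ))) /
      ((1 - rSquared X y Finset.univ) ^ (-(n : ℤ)) * (n : ℝ) ^ (-(p : ℤ))))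

/-- The approximate Bayes factor of `γ` against the full model, with hyper-parameter `ν`. -/
def bfApprox {n p : ℕ} (ν : ℝ) (X : Matrix (Fin n) (Fin p) ℝ) (y : Fin n → ℝ)
    (γ : Finset (Fin p)) : ℝ :=
  Real.sqrt (phi (γ.card - ν) (1 - rSquared X y γ) /
      phi (p - ν) (1 - rSquared X y Finset.univ)) * bfBIC X y γ

/-- The integral
`∫₀^∞ g^(ν/2-1) (1+g⁻¹)^(-k/2) (1+g)^((n-q-1)/2) {g(1-R²)+1}^(-(n-1)/2) dg`. -/
def gIntegral (n q : ℕ) (ν k R2 : ℝ) : ℝ :=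
  ∫ g in Set.Ioi (0 : ℝ),
    g ^ (ν / 2 - 1) * (1 + g⁻¹) ^ (-k / 2) * (1 + g) ^ (((n : ℝ) - q - 1) / 2) *
      (g * (1 - R2) + 1) ^ (-(((n : ℝ) - 1) / 2))

/-- The Gaussian Bayes factor of `γ` against the full model for the prior on `g` proportional to
`g^(ν/2-1) (1+g⁻¹)^(-k/2)`. -/
def bfGaussian {n p : ℕ} (ν k : ℝ) (X : Matrix (Fin n) (Fin p) ℝ) (y : Fin n → ℝ)
    (γ : Finset (Fin p)) : ℝ :=
  gIntegral n γ.card ν k (rSquared X y γ) / gIntegral n p ν k (rSquared X y Finset.univ)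

/-! ### The robust Bayes factor of the sub-harmonic prior

It is the limit of the ratio of the marginal densities under proper priors, as the parameters
`h = (h_α, h_η, h_g)` of these priors tend to infinity. -/

/-- Density of the multivariate normal distribution with mean `μ` and covariance matrix `S`. -/
def normalDensity {ι : Type*} [Fintype ι] [DecidableEq ι] (μ : ι → ℝ) (S : Matrix ι ι ℝ)
    (x : ι → ℝ) : ℝ :=
  (2 * Real.pi) ^ (-(Fintype.card ι : ℝ) / 2) * S.det ^ (-(1 : ℝ) / 2) *
    Real.exp (-((x - μ) ⬝ᵥ (S⁻¹ *ᵥ (x - μ))) / 2)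

/-- Prior density of the intercept: uniform on `(-h, h)`. -/
def priorAlpha (h α : ℝ) : ℝ := (Set.Ioo (-h) h).indicator (fun _ => 1 / (2 * h)) α

/-- Prior density of the precision `η = 1/σ²`: proportional to `η⁻¹` on `(1/h, h)`. -/
def priorEta (h η : ℝ) : ℝ :=
  (Set.Ioo (1 / h) h).indicator (fun t => t⁻¹ / (2 * Real.log h)) η

/-- Prior density of `g`: proportional to `g^(ν/2-1)` on `[0, h]`. -/
def priorG (ν h g : ℝ) : ℝ :=
  (Set.Icc 0 h).indicator (fun t => ν / 2 * h ^ (-ν / 2) * t ^ (ν / 2 - 1)) g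

/-- Prior density of `β_γ` given `η`: the mixture over `g` of the normal densities with mean `0`
and covariance matrix `g η⁻¹ (X_γ' X_γ)⁻¹`. -/
def priorBeta {n p : ℕ} (ν : ℝ) (X : Matrix (Fin n) (Fin p) ℝ) (γ : Finset (Fin p))
    (h η : ℝ) (β : γ → ℝ) : ℝ≥0∞ :=
  ∫⁻ g in Set.Ioi (0 : ℝ), ENNReal.ofReal (priorG ν h g *
    normalDensity 0 ((g * η⁻¹) • ((subDesign X γ)ᵀ * subDesign X γ)⁻¹) β)

/-- The marginal density `m_γ(y | ν; h)` of `y` under the submodel `γ`, when the error vector has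
the density `f(‖·‖²)`. -/
def marginal {n p : ℕ} (f : ℝ → ℝ) (ν : ℝ) (X : Matrix (Fin n) (Fin p) ℝ) (y : Fin n → ℝ)
    (γ : Finset (Fin p)) (h : ℝ × ℝ × ℝ) : ℝ≥0∞ :=
  ∫⁻ α : ℝ, ∫⁻ β : γ → ℝ, ∫⁻ η in Set.Ioi (0 : ℝ),
    ENNReal.ofReal
        (η ^ ((n : ℝ) / 2) * f (η * sqNorm (fun i => y i - α - (subDesign X γ *ᵥ β) i))) *
      (ENNReal.ofReal (priorAlpha h.1 α) * ENNReal.ofReal (priorEta h.2.1 η) *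
        priorBeta ν X γ h.2.2 η β)

/-- The Bayes factor of `γ` against the full model under the proper priors with parameter `h`. -/
def bfProper {n p : ℕ} (f : ℝ → ℝ) (ν : ℝ) (X : Matrix (Fin n) (Fin p) ℝ) (y : Fin n → ℝ)
    (γ : Finset (Fin p)) (h : ℝ × ℝ × ℝ) : ℝ≥0∞ :=
  marginal f ν X y γ h / marginal f ν X y Finset.univ h

/-- The robust Bayes factor `BF_{γ:F}(ν)`: the limit of `bfProper` as `h_α, h_η, h_g → ∞`. -/
def bfRobust {n p : ℕ} (f : ℝ → ℝ) (ν : ℝ) (X : Matrix (Fin n) (Fin p) ℝ) (y : Fin n → ℝ)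
    (γ : Finset (Fin p)) : ℝ :=
  (limUnder atTop (bfProper f ν X y γ)).toReal

/-! ### The sampling model -/

/-- The columns of `X` are centred, have squared norm `n`, and are linearly independent. -/
structure StandardizedDesign {n p : ℕ} (X : Matrix (Fin n) (Fin p) ℝ) : Prop where
  sum_eq_zero : ∀ j, ∑ i, X i j = 0
  sum_sq_eq : ∀ j, (∑ i, X i j ^ 2) / n = 1
  linearIndependent : LinearIndependent ℝ fun j : Fin p => fun i : Fin n => X i j

/-- The random vector `ε` has the spherically symmetric density `f(‖·‖²)`, mean zero and identity
covariance matrix. -/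
structure SphericalError {Ω : Type*} [MeasurableSpace Ω] {n : ℕ} (P : Measure Ω)
    (ε : Ω → Fin n → ℝ) (f : ℝ → ℝ) : Prop where
  measurable : Measurable ε
  measurable_density : Measurable f
  density_nonneg : ∀ t, 0 ≤ f t
  law : P.map ε = volume.withDensity fun x : Fin n → ℝ => ENNReal.ofReal (f (sqNorm x))
  mean : ∀ i, ∫ ω, ε ω i ∂P = 0
  cov : ∀ i j, cov[fun ω => ε ω i, fun ω => ε ω j; P] = if i = j then 1 else 0

/-- The response `y = α 1 + X_T β + σ ε`. -/
def response {n p : ℕ} (X : Matrix (Fin n) (Fin p) ℝ) (T : Finset (Fin p)) (α σ : ℝ)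
    (β : T → ℝ) (e : Fin n → ℝ) : Fin n → ℝ :=
  fun i => α + (subDesign X T *ᵥ β) i + σ * e i

/-! ### Model selection consistency -/

/-- Posterior probability of `T`, for prior model probabilities `w` and Bayes factors `BF γ` of
`γ` against the full model. -/
def posterior {p : ℕ} (w BF : Finset (Fin p) → ℝ) (T : Finset (Fin p)) : ℝ :=
  w T * BF T / ∑ γ, w γ * BF γ

/-- Model selection consistency at the true model `T`, with the null model excluded: for all prior
model probabilities (fixed as `n` grows) that give mass zero to the null model and positive mass to
`T`, the posterior probability of `T` converges to `1` in probability. -/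
def Consistent {p : ℕ} {Ω : ℕ → Type*} [∀ n, MeasurableSpace (Ω n)] (P : ∀ n, Measure (Ω n))
    (T : Finset (Fin p)) (BF : ∀ n, Ω n → Finset (Fin p) → ℝ) : Prop :=
  ∀ w : Finset (Fin p) → ℝ, (∀ γ, 0 ≤ w γ) → ∑ γ, w γ = 1 → w ∅ = 0 → 0 < w T →
    ∀ δ : ℝ, 0 < δ →
      Tendsto (fun n => P n {ω | δ ≤ |posterior w (BF n ω) T - 1|}) atTop (𝓝 0)

end SSRegression

end

/-!
Write `r γ = 1 - R²_γ`, the ratio of the residual to the total sum of squares.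

*Separation.* The centred response is `X β + σ (ε - ε̄ 1)`. By Chebyshev's inequality the projection
of the noise on the span of the predictors is bounded in probability, while `‖ε‖² / n` is bounded
from both sides and the Gram matrix is at least `l n` for some `l > 0`. Hence signal and noise are
nearly orthogonal (`StandardizedDesign.le_sqNorm_signal_add_noise`): a model that omits a predictor
of `T` has a residual sum of squares larger by a factor `1 + δ`, and one that contains `T` has the
same residual sum of squares up to a factor `1 + O(1/n)`. The predicate `Separated` collects these
facts and `eventually_separated` shows that they have high probability. It also records that
`R²_γ` is at least of order `n⁻⁵`; this uses the spherical symmetry of the error, through the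
anti-concentration bound `SphericalError.measure_abs_dotProduct_add_le`.

*Domination.* The approximate Bayes factor is a product of `r γ ^ (-n/2)`, `n ^ (-q_γ/2)` and a
factor `φ` that is at most polynomial in `n`. The Gaussian Bayes factor is a ratio of one-dimensional
integrals over `g`, in which `g` of order `n` dominates, so that they are of order
`r γ ^ (-(n-1)/2) n ^ (-(q_γ-ν)/2)` (`gIntegral_le_of_lt`, `le_gIntegral`). In both cases an omitted
predictor costs an exponential factor and a superfluous predictor a power of `n`, so the
true model dominates.

*Robustness.* For a spherical error density `f`, the substitutions `g = η t` and
`u = η ‖y - α 1 - X_γ β‖²` show that the marginal density of a model is the product of a moment of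
`f` that is common to all models and a factor that does not involve `f`
(`lintegral_marginalKernel_eq_mul`). The moment cancels in the Bayes factors, so they can be computed
with `f` Gaussian, where they are the Gaussian Bayes factors with `k = 0`
(`StandardizedDesign.tendsto_bfProper`).
-/

noncomputable section

namespace SSRegression

/-! ### Integration in polar coordinates and Gaussian integrals -/

lemma sqNorm_eq_norm_sq {ι : Type*} [Fintype ι] (v : ι → ℝ) :
    sqNorm v = ‖WithLp.toLp 2 v‖ ^ 2 := by
  rw [EuclideanSpace.norm_sq_eq]
  simp [sqNorm]

lemma sqNorm_nonneg {ι : Type*} [Fintype ι] (v : ι → ℝ) : 0 ≤ sqNorm v :=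
  Finset.sum_nonneg fun _ _ => sq_nonneg _

lemma sqNorm_eq_zero {ι : Type*} [Fintype ι] {v : ι → ℝ} : sqNorm v = 0 ↔ v = 0 := by
  rw [sqNorm_eq_norm_sq]
  simp

@[fun_prop]
lemma measurable_sqNorm {ι : Type*} [Fintype ι] : Measurable (sqNorm : (ι → ℝ) → ℝ) := by
  unfold sqNorm
  fun_prop

open Measure in
lemma lintegral_fun_norm_addHaar {E : Type*} [NormedAddCommGroup E] [NormedSpace ℝ E]
    [MeasurableSpace E] [BorelSpace E] [FiniteDimensional ℝ E] [Nontrivial E]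
    (μ : Measure E) [μ.IsAddHaarMeasure] {g : ℝ → ℝ≥0∞} (hg : Measurable g) :
    ∫⁻ x, g ‖x‖ ∂μ = μ.toSphere Set.univ *
      ∫⁻ r in Set.Ioi (0 : ℝ), ENNReal.ofReal (r ^ (Module.finrank ℝ E - 1)) * g r := by
  calc
    ∫⁻ x, g ‖x‖ ∂μ = ∫⁻ x : ({(0)}ᶜ : Set E), g ‖x.1‖ ∂(μ.comap (↑)) := by
      rw [lintegral_subtype_comap (measurableSet_singleton _).compl fun x => g ‖x‖,
        restrict_compl_singleton]
    _ = ∫⁻ x, g x.2.1 ∂μ.toSphere.prod (.volumeIoiPow (Module.finrank ℝ E - 1)) := by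
      rw [← (μ.measurePreserving_homeomorphUnitSphereProd).lintegral_comp_emb
        (Homeomorph.measurableEmbedding _)]
      simp
    _ = μ.toSphere Set.univ *
        ∫⁻ x : Set.Ioi (0 : ℝ), g x.1 ∂.volumeIoiPow (Module.finrank ℝ E - 1) := by
      rw [lintegral_prod _ (by fun_prop)]
      simp [mul_comm]
    _ = _ := by
      rw [Measure.volumeIoiPow, lintegral_withDensity_eq_lintegral_mul _ (by fun_prop)
        (by fun_prop)]
      congr 1
      rw [← lintegral_subtype_comap measurableSet_Ioi]
      rfl

/-- The surface area of the unit sphere of `ℝ^m`. -/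
def sphereArea (m : ℕ) : ℝ≥0∞ :=
  (volume : Measure (EuclideanSpace ℝ (Fin m))).toSphere Set.univ

lemma sphereArea_ne_zero {m : ℕ} (hm : 0 < m) : sphereArea m ≠ 0 := by
  have : Nonempty (Fin m) := ⟨⟨0, hm⟩⟩
  exact fun h => Measure.toSphere_ne_zero _ (Measure.measure_univ_eq_zero.1 h)

lemma lintegral_fun_sqNorm {m : ℕ} (hm : 0 < m) {g : ℝ → ℝ≥0∞} (hg : Measurable g) :
    ∫⁻ x : Fin m → ℝ, g (sqNorm x) =
      sphereArea m * ∫⁻ r in Set.Ioi (0 : ℝ), ENNReal.ofReal (r ^ (m - 1)) * g (r ^ 2) := by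
  have : Nonempty (Fin m) := ⟨⟨0, hm⟩⟩
  have h := lintegral_fun_norm_addHaar (volume : Measure (EuclideanSpace ℝ (Fin m)))
    (g := fun r => g (r ^ 2)) (by fun_prop)
  rw [finrank_euclideanSpace_fin] at h
  rw [sphereArea, ← h, ← (PiLp.volume_preserving_toLp (Fin m)).lintegral_comp (by fun_prop)]
  simp [sqNorm_eq_norm_sq]

/-- The substitution `u = a + r²`. -/
lemma lintegral_add_sq (a : ℝ) (g : ℝ → ℝ≥0∞) :
    ∫⁻ r in Set.Ioi (0 : ℝ), ENNReal.ofReal (2 * r) * g (a + r ^ 2) =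
      ∫⁻ u in Set.Ioi a, g u := by
  have himg : (fun r : ℝ => a + r ^ 2) '' Set.Ioi 0 = Set.Ioi a := by
    ext u
    simp only [Set.mem_image, Set.mem_Ioi]
    constructor
    · rintro ⟨r, hr, rfl⟩
      nlinarith
    · intro hu
      exact ⟨√(u - a), Real.sqrt_pos.2 (by linarith), by
        rw [Real.sq_sqrt (by linarith)]; ring⟩
  have hinj : Set.InjOn (fun r : ℝ => a + r ^ 2) (Set.Ioi 0) := by
    intro r hr s hs h
    simp only [Set.mem_Ioi] at hr hs
    have : r ^ 2 = s ^ 2 := by simpa using h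
    exact (pow_left_inj₀ hr.le hs.le two_ne_zero).1 this
  rw [← himg, lintegral_image_eq_lintegral_abs_deriv_mul measurableSet_Ioi
    (f' := fun r => 2 * r) (fun r _ => ?_) hinj]
  · refine setLIntegral_congr_fun measurableSet_Ioi fun r hr => ?_
    simp only [Set.mem_Ioi] at hr
    simp only [abs_of_pos (show 0 < 2 * r by linarith)]
  · have := ((hasDerivAt_pow 2 r).const_add a).hasDerivWithinAt (s := Set.Ioi 0)
    simpa using this

lemma lintegral_Ioi_comp_mul_left {c : ℝ} (hc : 0 < c) (g : ℝ → ℝ≥0∞) :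
    ∫⁻ t in Set.Ioi (0 : ℝ), g t =
      ENNReal.ofReal c * ∫⁻ s in Set.Ioi (0 : ℝ), g (c * s) := by
  have himg : (fun s : ℝ => c * s) '' Set.Ioi 0 = Set.Ioi 0 := by
    rw [Set.image_mul_left_Ioi hc, mul_zero]
  conv_lhs => rw [← himg]
  rw [lintegral_image_eq_lintegral_abs_deriv_mul measurableSet_Ioi
    (f' := fun _ => c) (fun r _ => ?_) (mul_right_injective₀ hc.ne').injOn,
    ← lintegral_const_mul' _ _ (by simp)]
  · simp [abs_of_pos hc]
  · simpa using ((hasDerivAt_id r).const_mul c).hasDerivWithinAt (s := Set.Ioi 0)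

lemma lintegral_gaussian_sqNorm {ι : Type*} [Fintype ι] {b : ℝ} (hb : 0 < b) :
    ∫⁻ v : ι → ℝ, ENNReal.ofReal (Real.exp (-b * sqNorm v)) =
      ENNReal.ofReal ((Real.pi / b) ^ ((Fintype.card ι : ℝ) / 2)) := by
  have h := GaussianFourier.integral_rexp_neg_mul_sq_norm (V := EuclideanSpace ℝ ι) hb
  rw [finrank_euclideanSpace] at h
  have hpos : (0 : ℝ) < (Real.pi / b) ^ ((Fintype.card ι : ℝ) / 2) := by positivity
  have hint : Integrable fun v : EuclideanSpace ℝ ι => Real.exp (-b * ‖v‖ ^ 2) := by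
    by_contra hcon
    rw [integral_undef hcon] at h
    exact hpos.ne h
  rw [← h, ofReal_integral_eq_lintegral_ofReal hint (ae_of_all _ fun _ => (Real.exp_pos _).le),
    ← (PiLp.volume_preserving_toLp ι).lintegral_comp (by fun_prop)]
  simp [sqNorm_eq_norm_sq]

open scoped MatrixOrder in
lemma exists_transpose_mul_self_of_posDef {ι : Type*} [Fintype ι] [DecidableEq ι]
    {S : Matrix ι ι ℝ} (hS : S.PosDef) : ∃ B : Matrix ι ι ℝ, S = Bᵀ * B := by
  obtain ⟨B, hB, -, h⟩ := CFC.exists_sqrt_of_isSelfAdjoint_of_quasispectrumRestricts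
    (a := S) hS.isHermitian (QuasispectrumRestricts.nnreal_of_nonneg hS.posSemidef.nonneg)
  have hB' : Bᵀ = B := by
    simpa [Matrix.star_eq_conjTranspose, Matrix.conjTranspose_eq_transpose_of_trivial]
      using hB.star_eq
  exact ⟨B, by rw [hB', ← h]⟩

/-- The integral of an unnormalised Gaussian density with precision matrix `c S`. -/
lemma lintegral_gaussian_quadraticForm {ι : Type*} [Fintype ι] [DecidableEq ι]
    {S : Matrix ι ι ℝ} (hS : S.PosDef) {c : ℝ} (hc : 0 < c) (m : ι → ℝ) :
    ∫⁻ v : ι → ℝ, ENNReal.ofReal (Real.exp (-c * ((v - m) ⬝ᵥ (S *ᵥ (v - m))))) =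
      ENNReal.ofReal ((Real.pi / c) ^ ((Fintype.card ι : ℝ) / 2) * S.det ^ (-(1 / 2) : ℝ)) := by
  rw [lintegral_sub_right_eq_self
    (fun v => ENNReal.ofReal (Real.exp (-c * (v ⬝ᵥ (S *ᵥ v))))) m]
  obtain ⟨B, rfl⟩ := exists_transpose_mul_self_of_posDef hS
  have hdet := hS.det_pos
  rw [Matrix.det_mul, Matrix.det_transpose] at hdet ⊢
  have hB : B.det ≠ 0 := fun h => by simp [h] at hdet
  have hq : ∀ v, v ⬝ᵥ ((Bᵀ * B) *ᵥ v) = sqNorm (Matrix.toLin' B v) := by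
    intro v
    rw [← Matrix.mulVec_mulVec, Matrix.dotProduct_mulVec, Matrix.vecMul_transpose,
      Matrix.toLin'_apply, sqNorm]
    simp [dotProduct, sq]
  simp_rw [hq]
  rw [← lintegral_map (f := fun w => ENNReal.ofReal (Real.exp (-c * sqNorm w)))
    (g := Matrix.toLin' B) (by fun_prop)
    (LinearMap.continuous_of_finiteDimensional _).measurable,
    Real.map_matrix_volume_pi_eq_smul_volume_pi hB, lintegral_smul_measure,
    lintegral_gaussian_sqNorm hc, smul_eq_mul, ← ENNReal.ofReal_mul (abs_nonneg _), mul_comm,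
    ← sq, ← sq_abs, ← Real.rpow_natCast, ← Real.rpow_mul (abs_nonneg _), abs_inv]
  norm_num [Real.rpow_neg_one]

/-! ### Least squares -/

section LeastSquares

variable {n p : ℕ} {X : Matrix (Fin n) (Fin p) ℝ}

lemma sqNorm_eq_dotProduct {ι : Type*} [Fintype ι] (v : ι → ℝ) : sqNorm v = v ⬝ᵥ v := by
  simp [sqNorm, dotProduct, sq]

lemma sqNorm_add {ι : Type*} [Fintype ι] (v w : ι → ℝ) :
    sqNorm (v + w) = sqNorm v + 2 * (v ⬝ᵥ w) + sqNorm w := by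
  simp only [sqNorm_eq_dotProduct, add_dotProduct, dotProduct_add, dotProduct_comm w v]
  ring

lemma sqNorm_smul {ι : Type*} [Fintype ι] (c : ℝ) (v : ι → ℝ) :
    sqNorm (c • v) = c ^ 2 * sqNorm v := by
  simp only [sqNorm_eq_dotProduct, smul_dotProduct, dotProduct_smul, smul_eq_mul]
  ring

lemma dotProduct_sq_le {ι : Type*} [Fintype ι] (v w : ι → ℝ) :
    (v ⬝ᵥ w) ^ 2 ≤ sqNorm v * sqNorm w :=
  Finset.sum_mul_sq_le_sq_mul_sq _ _ _

lemma sqNorm_mulVec {ι κ : Type*} [Fintype ι] [Fintype κ] (A : Matrix ι κ ℝ) (b : κ → ℝ) :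
    sqNorm (A *ᵥ b) = b ⬝ᵥ ((Aᵀ * A) *ᵥ b) := by
  rw [← Matrix.mulVec_mulVec, Matrix.dotProduct_mulVec, Matrix.vecMul_transpose,
    sqNorm_eq_dotProduct]

/-- The residual sum of squares of the regression of `v` on the columns of `X` in `γ`. -/
def rss (X : Matrix (Fin n) (Fin p) ℝ) (γ : Finset (Fin p)) (v : Fin n → ℝ) : ℝ :=
  sqNorm (residualProj X γ *ᵥ v)

/-- The least squares coefficients of the regression of `v` on the columns of `X` in `γ`. -/
def olsCoef (X : Matrix (Fin n) (Fin p) ℝ) (γ : Finset (Fin p)) (v : Fin n → ℝ) : γ → ℝ :=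
  ((subDesign X γ)ᵀ * subDesign X γ)⁻¹ *ᵥ ((subDesign X γ)ᵀ *ᵥ v)

lemma residualProj_mulVec (γ : Finset (Fin p)) (v : Fin n → ℝ) :
    residualProj X γ *ᵥ v = v - subDesign X γ *ᵥ olsCoef X γ v := by
  simp [residualProj, olsCoef, Matrix.sub_mulVec, Matrix.mulVec_mulVec, Matrix.mul_assoc]

lemma StandardizedDesign.posDef_gram (hX : StandardizedDesign X) (γ : Finset (Fin p)) :
    ((subDesign X γ)ᵀ * subDesign X γ).PosDef := by
  have h := Matrix.PosDef.conjTranspose_mul_self (subDesign X γ) (by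
    rw [Matrix.mulVec_injective_iff]
    exact hX.linearIndependent.comp (Subtype.val : γ → Fin p) Subtype.val_injective)
  rwa [Matrix.conjTranspose_eq_transpose_of_trivial] at h

/-- Pythagoras' theorem for the least squares fit. -/
lemma StandardizedDesign.sqNorm_sub_mulVec (hX : StandardizedDesign X) (γ : Finset (Fin p))
    (v : Fin n → ℝ) (b : γ → ℝ) :
    sqNorm (v - subDesign X γ *ᵥ b) = rss X γ v + (b - olsCoef X γ v) ⬝ᵥ
      (((subDesign X γ)ᵀ * subDesign X γ) *ᵥ (b - olsCoef X γ v)) := by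
  have hS := hX.posDef_gram γ
  have horth : (subDesign X γ)ᵀ *ᵥ (residualProj X γ *ᵥ v) = 0 := by
    rw [residualProj_mulVec, Matrix.mulVec_sub, Matrix.mulVec_mulVec, olsCoef,
      Matrix.mulVec_mulVec, Matrix.mul_nonsing_inv _ ((Matrix.isUnit_iff_isUnit_det _).1 hS.isUnit),
      Matrix.one_mulVec, sub_self]
  have hsplit : v - subDesign X γ *ᵥ b =
      residualProj X γ *ᵥ v + subDesign X γ *ᵥ (olsCoef X γ v - b) := by
    rw [residualProj_mulVec, Matrix.mulVec_sub]
    abel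
  have hneg : olsCoef X γ v - b = -(b - olsCoef X γ v) := by abel
  rw [hsplit, sqNorm_add, Matrix.dotProduct_mulVec, ← Matrix.mulVec_transpose, horth,
    ← sqNorm_mulVec, rss, hneg, Matrix.mulVec_neg]
  simp [sqNorm]

lemma StandardizedDesign.rss_le (hX : StandardizedDesign X) (γ : Finset (Fin p))
    (v : Fin n → ℝ) (b : γ → ℝ) : rss X γ v ≤ sqNorm (v - subDesign X γ *ᵥ b) := by
  rw [hX.sqNorm_sub_mulVec]
  have := (hX.posDef_gram γ).posSemidef.dotProduct_mulVec_nonneg (b - olsCoef X γ v)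
  simpa using this

lemma rss_nonneg (γ : Finset (Fin p)) (v : Fin n → ℝ) : 0 ≤ rss X γ v := sqNorm_nonneg _

lemma StandardizedDesign.rss_le_sqNorm (hX : StandardizedDesign X) (γ : Finset (Fin p))
    (v : Fin n → ℝ) : rss X γ v ≤ sqNorm v := by
  simpa using hX.rss_le γ v 0

/-- The coefficient vector over all predictors that extends `b` by zero. -/
def extendCoef {γ : Finset (Fin p)} (b : γ → ℝ) : Fin p → ℝ :=
  fun j => if h : j ∈ γ then b ⟨j, h⟩ else 0

lemma subDesign_mulVec {γ : Finset (Fin p)} (b : γ → ℝ) :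
    subDesign X γ *ᵥ b = X *ᵥ extendCoef b := by
  ext i
  simp only [Matrix.mulVec, dotProduct, subDesign, Matrix.submatrix_apply, id, extendCoef]
  rw [← Finset.sum_subset (Finset.subset_univ γ) (by intro j _ hj; simp [hj]),
    ← Finset.sum_coe_sort γ]
  simp

lemma extendCoef_of_mem {γ : Finset (Fin p)} (b : γ → ℝ) (j : γ) : extendCoef b j = b j := by
  simp [extendCoef]

lemma extendCoef_of_notMem {γ : Finset (Fin p)} (b : γ → ℝ) {j : Fin p} (hj : j ∉ γ) :
    extendCoef b j = 0 := by
  simp [extendCoef, hj]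

lemma exists_extendCoef_eq {γ : Finset (Fin p)} {d : Fin p → ℝ} (hd : ∀ j, j ∉ γ → d j = 0) :
    ∃ b : γ → ℝ, extendCoef b = d :=
  ⟨fun j => d j, by
    ext j
    by_cases hj : j ∈ γ
    · simp [extendCoef, hj]
    · simp [extendCoef, hj, hd j hj]⟩

/-- The residual sum of squares is attained, by the least squares coefficients. -/
lemma exists_rss_eq (γ : Finset (Fin p)) (v : Fin n → ℝ) :
    ∃ d : Fin p → ℝ, (∀ j, j ∉ γ → d j = 0) ∧ rss X γ v = sqNorm (v - X *ᵥ d) :=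
  ⟨extendCoef (olsCoef X γ v), fun _ hj => extendCoef_of_notMem _ hj, by
    rw [rss, residualProj_mulVec, subDesign_mulVec]⟩

lemma StandardizedDesign.rss_le_of_support (hX : StandardizedDesign X) {γ : Finset (Fin p)}
    (v : Fin n → ℝ) {d : Fin p → ℝ} (hd : ∀ j, j ∉ γ → d j = 0) :
    rss X γ v ≤ sqNorm (v - X *ᵥ d) := by
  obtain ⟨b, rfl⟩ := exists_extendCoef_eq hd
  rw [← subDesign_mulVec]
  exact hX.rss_le γ v b

lemma StandardizedDesign.rss_anti (hX : StandardizedDesign X) {γ γ' : Finset (Fin p)}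
    (h : γ ⊆ γ') (v : Fin n → ℝ) : rss X γ' v ≤ rss X γ v := by
  obtain ⟨d, hd, he⟩ := exists_rss_eq (X := X) γ v
  rw [he]
  exact hX.rss_le_of_support v fun j hj => hd j fun hj' => hj (h hj')

lemma one_sub_rSquared (y : Fin n → ℝ) (γ : Finset (Fin p)) :
    1 - rSquared X y γ = rss X γ (centered y) / sqNorm (centered y) := by
  simp [rSquared, rss]

lemma sum_centered (hn : 0 < n) (y : Fin n → ℝ) : ∑ i, centered y i = 0 := by
  have : (n : ℝ) ≠ 0 := by positivity
  simp only [centered, Finset.sum_sub_distrib, Finset.sum_const, Finset.card_univ,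
    Fintype.card_fin, nsmul_eq_mul]
  field_simp
  ring

lemma StandardizedDesign.sum_mulVec (hX : StandardizedDesign X) (d : Fin p → ℝ) :
    ∑ i, (X *ᵥ d) i = 0 := by
  simp only [Matrix.mulVec, dotProduct]
  rw [Finset.sum_comm]
  simp [← Finset.sum_mul, hX.sum_eq_zero]

/-- The intercept and the centred part contribute orthogonally to the residual. -/
lemma StandardizedDesign.sqNorm_sub_const_sub (hX : StandardizedDesign X) (hn : 0 < n)
    (y : Fin n → ℝ) (a : ℝ) (γ : Finset (Fin p)) (b : γ → ℝ) :
    sqNorm (fun i => y i - a - (subDesign X γ *ᵥ b) i) =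
      n * (a - (∑ j, y j) / n) ^ 2 + sqNorm (centered y - subDesign X γ *ᵥ b) := by
  have hn' : (n : ℝ) ≠ 0 := by positivity
  set w := centered y - subDesign X γ *ᵥ b with hw
  have hsum : ∑ i, w i = 0 := by
    have := hX.sum_mulVec (extendCoef b)
    rw [← subDesign_mulVec] at this
    simp [hw, Finset.sum_sub_distrib, sum_centered hn, this]
  have hi : ∀ i, y i - a - (subDesign X γ *ᵥ b) i = w i - (a - (∑ j, y j) / n) := by
    intro i
    simp only [hw, Pi.sub_apply, centered]
    ring
  simp only [sqNorm, hi]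
  generalize a - (∑ j, y j) / n = c
  have : ∀ i, (w i - c) ^ 2 = w i ^ 2 - 2 * c * w i + c ^ 2 := fun i => by ring
  simp only [this, Finset.sum_add_distrib, Finset.sum_sub_distrib, ← Finset.mul_sum, hsum]
  simp
  ring

end LeastSquares

/-! ### The one-dimensional integral over `g` -/

section GIntegral

/-- The unnormalised beta prime density `g^(a-1) (1+g)^(-(a+b))`. -/
def betaPrimeKernel (a b g : ℝ) : ℝ := g ^ (a - 1) * (1 + g) ^ (-(a + b))

lemma betaPrimeKernel_pos {a b g : ℝ} (hg : 0 < g) : 0 < betaPrimeKernel a b g := by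
  unfold betaPrimeKernel
  positivity

@[fun_prop]
lemma measurable_betaPrimeKernel {a b : ℝ} : Measurable (betaPrimeKernel a b) := by
  unfold betaPrimeKernel
  fun_prop

lemma integrableOn_betaPrimeKernel {a b : ℝ} (ha : 0 < a) (hb : 0 < b) :
    IntegrableOn (betaPrimeKernel a b) (Set.Ioi 0) := by
  rw [← Set.Ioc_union_Ioi_eq_Ioi zero_le_one]
  refine IntegrableOn.union ?_ ?_
  · have h : IntegrableOn (fun g : ℝ => g ^ (a - 1)) (Set.Ioc 0 1) :=
      (intervalIntegrable_iff_integrableOn_Ioc_of_le zero_le_one).1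
        (intervalIntegral.intervalIntegrable_rpow' (by linarith))
    refine Integrable.mono' h (by fun_prop) ?_
    refine (ae_restrict_iff' measurableSet_Ioc).2 (ae_of_all _ fun g hg => ?_)
    rw [Real.norm_of_nonneg (betaPrimeKernel_pos hg.1).le, betaPrimeKernel]
    refine mul_le_of_le_one_right (Real.rpow_nonneg hg.1.le _) ?_
    exact Real.rpow_le_one_of_one_le_of_nonpos (by linarith [hg.1]) (by linarith)
  · have h : IntegrableOn (fun g : ℝ => g ^ (-b - 1)) (Set.Ioi 1) :=
      integrableOn_Ioi_rpow_of_lt (by linarith) zero_lt_one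
    refine Integrable.mono' h (by fun_prop) ?_
    refine (ae_restrict_iff' measurableSet_Ioi).2 (ae_of_all _ fun g hg => ?_)
    have hg0 : 0 < g := lt_trans zero_lt_one hg
    rw [Real.norm_of_nonneg (betaPrimeKernel_pos hg0).le, betaPrimeKernel,
      show -b - 1 = (a - 1) + (-(a + b)) by ring, Real.rpow_add hg0]
    gcongr ?_ * ?_
    exact Real.rpow_le_rpow_of_nonpos hg0 (by linarith) (by linarith)

/-- The integral `I(q, R²)` is the integral of a beta prime kernel against a power of
`(1+g)/(1+g(1-R²))`. -/
lemma gIntegral_eq (n q : ℕ) (ν k R2 : ℝ) (hR : R2 ≤ 1) :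
    gIntegral n q ν k R2 = ∫ g in Set.Ioi (0 : ℝ),
      betaPrimeKernel ((ν + k) / 2) ((q - ν) / 2) g *
        ((1 + g) / (g * (1 - R2) + 1)) ^ (((n : ℝ) - 1) / 2) := by
  refine setIntegral_congr_fun measurableSet_Ioi fun g (hg : 0 < g) => ?_
  have h1 : 0 < 1 + g := by linarith
  have h2 : 0 < g * (1 - R2) + 1 := by nlinarith
  have h3 : 1 + g⁻¹ = (1 + g) * g⁻¹ := by field_simp; ring
  simp only [betaPrimeKernel]
  rw [h3, Real.mul_rpow h1.le (inv_nonneg.2 hg.le), Real.inv_rpow hg.le, ← Real.rpow_neg hg.le,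
    Real.div_rpow h1.le h2.le, div_eq_mul_inv (_ ^ _) (_ ^ _), ← Real.rpow_neg h2.le,
    show (ν + k) / 2 - 1 = (ν / 2 - 1) + (-(-k / 2)) by ring, Real.rpow_add hg]
  have e : (1 + g) ^ (-k / 2) * (1 + g) ^ (((n : ℝ) - q - 1) / 2) =
      (1 + g) ^ (-((ν + k) / 2 + (q - ν) / 2)) * (1 + g) ^ (((n : ℝ) - 1) / 2) := by
    rw [← Real.rpow_add h1, ← Real.rpow_add h1]
    congr 1
    ring
  linear_combination (g ^ (ν / 2 - 1) * g ^ (-(-k / 2)) *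
    (g * (1 - R2) + 1) ^ (-(((n : ℝ) - 1) / 2))) * e

lemma one_add_div_rpow_le {r N g : ℝ} (hr : 0 < r) (hN : 0 ≤ N) (hg : 0 < g) :
    ((1 + g) / (g * r + 1)) ^ N ≤ r ^ (-N) * Real.exp (-(N * (1 - r) / (1 + g))) := by
  have h2 : 0 < g * r + 1 := by positivity
  have key : (1 + g) / (g * r + 1) ≤ r⁻¹ * Real.exp (-((1 - r) / (1 + g))) := by
    have h1 : 1 - (1 - r) / (1 + g) ≤ Real.exp (-((1 - r) / (1 + g))) :=
      Real.one_sub_le_exp_neg _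
    refine le_trans ?_ (mul_le_mul_of_nonneg_left h1 (inv_nonneg.2 hr.le))
    rw [div_le_iff₀ h2]
    have : r⁻¹ * (1 - (1 - r) / (1 + g)) * (g * r + 1) - (1 + g) =
        (1 - r) ^ 2 * g / (r * (1 + g)) := by
      field_simp
      ring
    have h3 : 0 ≤ (1 - r) ^ 2 * g / (r * (1 + g)) := by positivity
    linarith
  calc ((1 + g) / (g * r + 1)) ^ N ≤ (r⁻¹ * Real.exp (-((1 - r) / (1 + g)))) ^ N :=
        Real.rpow_le_rpow (by positivity) key hN
    _ = _ := by
        rw [Real.mul_rpow (by positivity) (by positivity), Real.inv_rpow hr.le,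
          ← Real.rpow_neg hr.le, ← Real.exp_mul]
        congr 2
        ring

lemma one_add_div_rpow_le' {r N g : ℝ} (hr : 0 < r) (hr1 : r ≤ 1) (hN : 0 ≤ N) (hg : 0 < g) :
    ((1 + g) / (g * r + 1)) ^ N ≤ r ^ (-N) := by
  refine (one_add_div_rpow_le hr hN hg).trans (mul_le_of_le_one_right (by positivity) ?_)
  rw [Real.exp_le_one_iff, neg_nonpos]
  have : 0 ≤ 1 - r := by linarith
  positivity

lemma integrableOn_betaPrimeKernel_mul {a b r N : ℝ} (ha : 0 < a) (hb : 0 < b) (hr : 0 < r)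
    (hr1 : r ≤ 1) (hN : 0 ≤ N) :
    IntegrableOn (fun g => betaPrimeKernel a b g * ((1 + g) / (g * r + 1)) ^ N) (Set.Ioi 0) := by
  refine Integrable.mono' ((integrableOn_betaPrimeKernel ha hb).mul_const (r ^ (-N)))
    (by fun_prop) ?_
  refine (ae_restrict_iff' measurableSet_Ioi).2 (ae_of_all _ fun g hg => ?_)
  have hg0 : 0 < g := hg
  have := (betaPrimeKernel_pos (a := a) (b := b) hg0)
  rw [Real.norm_of_nonneg (by positivity)]
  exact mul_le_mul_of_nonneg_left (one_add_div_rpow_le' hr hr1 hN hg0) this.le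

/-- The integral of the beta prime kernel. -/
def betaPrimeMass (a b : ℝ) : ℝ := ∫ g in Set.Ioi (0 : ℝ), betaPrimeKernel a b g

lemma betaPrimeMass_nonneg (a b : ℝ) : 0 ≤ betaPrimeMass a b :=
  setIntegral_nonneg measurableSet_Ioi fun _ hg => (betaPrimeKernel_pos hg).le

lemma gIntegral_le {n q : ℕ} {ν k R2 : ℝ} (hn : 1 ≤ n) (hk : 0 < ν + k) (hq : ν < q)
    (hR0 : 0 ≤ R2) (hR1 : R2 < 1) :
    gIntegral n q ν k R2 ≤
      (1 - R2) ^ (-(((n : ℝ) - 1) / 2)) * betaPrimeMass ((ν + k) / 2) ((q - ν) / 2) := by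
  have hn' : (0 : ℝ) ≤ ((n : ℝ) - 1) / 2 := by
    have : (1 : ℝ) ≤ n := by exact_mod_cast hn
    linarith
  rw [gIntegral_eq _ _ _ _ _ hR1.le, mul_comm, betaPrimeMass, ← integral_mul_const]
  refine setIntegral_mono_on
    (integrableOn_betaPrimeKernel_mul (by linarith) (by linarith) (by linarith) (by linarith) hn')
    ((integrableOn_betaPrimeKernel (by linarith) (by linarith)).mul_const _) measurableSet_Ioi
    fun g hg => ?_
  exact mul_le_mul_of_nonneg_left (one_add_div_rpow_le' (by linarith) (by linarith) hn' hg)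
    (betaPrimeKernel_pos hg).le

/-- A bound with the polynomial decay in `n` that comes from the concentration of the integrand at
`g` of order `n`. Any exponent `m < (q - ν) / 2` is allowed. -/
lemma gIntegral_le_of_lt {n q : ℕ} {ν k R2 c m : ℝ} (hn : 2 ≤ n) (hk : 0 < ν + k) (hm : 0 < m)
    (hmq : m < (q - ν) / 2) (hc : 0 < c) (hR0 : c ≤ R2) (hR1 : R2 < 1) :
    gIntegral n q ν k R2 ≤ (1 - R2) ^ (-(((n : ℝ) - 1) / 2)) * (((n : ℝ) - 1) / 2) ^ (-m) *
      (m ^ m * c ^ (-m) * betaPrimeMass ((ν + k) / 2) ((q - ν) / 2 - m)) := by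
  set N : ℝ := ((n : ℝ) - 1) / 2 with hN
  have hN0 : 0 < N := by
    have : (2 : ℝ) ≤ n := by exact_mod_cast hn
    rw [hN]
    linarith
  have hr : 0 < 1 - R2 := by linarith
  rw [gIntegral_eq _ _ _ _ _ hR1.le, ← hN]
  calc _ ≤ ∫ g in Set.Ioi (0 : ℝ), betaPrimeKernel ((ν + k) / 2) ((q - ν) / 2 - m) g *
        ((1 - R2) ^ (-N) * N ^ (-m) * (m ^ m * c ^ (-m))) := ?_
    _ = _ := by
      rw [integral_mul_const, ← betaPrimeMass]
      ring
  refine setIntegral_mono_on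
    (integrableOn_betaPrimeKernel_mul (by linarith) (by linarith) hr (by linarith) hN0.le)
    ((integrableOn_betaPrimeKernel (by linarith) (by linarith)).mul_const _) measurableSet_Ioi
    fun g hg => ?_
  have hg0 : 0 < g := hg
  have hg1 : 0 < 1 + g := by linarith
  -- `x^m ≤ m^m exp x` for `x = N c / (1 + g)`
  have hexp : Real.exp (-(N * R2 / (1 + g))) ≤ m ^ m * (N * c / (1 + g)) ^ (-m) := by
    set x := N * c / (1 + g) with hx
    have hx0 : 0 < x := by positivity
    have hle : Real.exp (-(N * R2 / (1 + g))) ≤ Real.exp (-x) := by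
      rw [Real.exp_le_exp, neg_le_neg_iff, hx]
      gcongr
    refine hle.trans ?_
    have h1 : x / m ≤ Real.exp (x / m) := by linarith [Real.add_one_le_exp (x / m)]
    have h2 : (x / m) ^ m ≤ Real.exp x := by
      calc (x / m) ^ m ≤ Real.exp (x / m) ^ m := Real.rpow_le_rpow (by positivity) h1 hm.le
        _ = Real.exp x := by
          rw [← Real.exp_mul]
          congr 1
          field_simp
    rw [Real.div_rpow hx0.le hm.le] at h2
    rw [Real.exp_neg, Real.rpow_neg hx0.le, ← div_eq_mul_inv, inv_le_comm₀ (by positivity)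
      (by positivity), inv_div]
    exact h2
  have hb : ((1 + g) / (g * (1 - R2) + 1)) ^ N ≤
      (1 - R2) ^ (-N) * (m ^ m * (N * c / (1 + g)) ^ (-m)) := by
    refine (one_add_div_rpow_le hr hN0.le hg0).trans ?_
    rw [sub_sub_cancel]
    gcongr
  refine (mul_le_mul_of_nonneg_left hb (betaPrimeKernel_pos hg0).le).trans (le_of_eq ?_)
  simp only [betaPrimeKernel]
  rw [Real.div_rpow (by positivity) hg1.le, Real.mul_rpow hN0.le hc.le,
    div_eq_mul_inv (_ * _) (_ ^ _), ← Real.rpow_neg hg1.le, neg_neg,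
    show -((ν + k) / 2 + ((q - ν) / 2 - m)) = -((ν + k) / 2 + (q - ν) / 2) + m by ring,
    Real.rpow_add hg1]
  ring

/-- The matching lower bound, from the contribution of `g` between `(n-1)/2` and `n-1`. -/
lemma le_gIntegral {n q : ℕ} {ν k R2 : ℝ} (hn : 3 ≤ n) (hk : 0 < ν + k) (hq : ν < q)
    (hR0 : 0 ≤ R2) (hR1 : R2 < 1) :
    (1 - R2) ^ (-(((n : ℝ) - 1) / 2)) * (((n : ℝ) - 1) / 2) ^ (-((q - ν) / 2)) *
      (Real.exp (-(1 - R2)⁻¹) * (2⁻¹ * (3 : ℝ) ^ (-((q - ν) / 2)) * (2⁻¹) ^ ((ν + k) / 2))) ≤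
      gIntegral n q ν k R2 := by
  set N : ℝ := ((n : ℝ) - 1) / 2 with hN
  have hN1 : 1 ≤ N := by
    have : (3 : ℝ) ≤ n := by exact_mod_cast hn
    rw [hN]
    linarith
  have hN0 : 0 < N := by linarith
  set r := 1 - R2 with hr
  have hr0 : 0 < r := by linarith
  set a := (ν + k) / 2 with ha
  set b := ((q : ℝ) - ν) / 2 with hb
  have ha0 : 0 < a := by linarith
  have hb0 : 0 < b := by linarith
  rw [gIntegral_eq _ _ _ _ _ hR1.le, ← hN, ← hr, ← ha, ← hb]
  have hint := integrableOn_betaPrimeKernel_mul (N := N) ha0 hb0 hr0 (by linarith) hN0.le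
  have hsub : Set.Ioc N (2 * N) ⊆ Set.Ioi 0 := fun g hg => hN0.trans hg.1
  refine le_trans ?_ (setIntegral_mono_set hint
    ((ae_restrict_iff' measurableSet_Ioi).2 (ae_of_all _ fun g (hg : 0 < g) => by
      have := betaPrimeKernel_pos (a := a) (b := b) hg
      simp only [Pi.zero_apply]
      positivity)) (LE.le.eventuallyLE hsub))
  calc _ = ∫ _ in Set.Ioc N (2 * N), ((2 * N)⁻¹ * (3 * N) ^ (-b) * (2⁻¹) ^ a) *
        (r ^ (-N) * Real.exp (-r⁻¹)) := by
        rw [setIntegral_const, measureReal_def, Real.volume_Ioc,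
          ENNReal.toReal_ofReal (by linarith), Real.mul_rpow (by norm_num) hN0.le, smul_eq_mul]
        field_simp
        ring
    _ ≤ _ := ?_
  refine setIntegral_mono_on (integrableOn_const (by simp)) (hint.mono_set hsub)
    measurableSet_Ioc fun g hg => ?_
  have hg0 : 0 < g := hN0.trans hg.1
  have hg1 : 0 < 1 + g := by linarith
  refine mul_le_mul ?_ ?_ (by positivity) (betaPrimeKernel_pos hg0).le
  · have hk : betaPrimeKernel a b g = g⁻¹ * (1 + g) ^ (-b) * (g / (1 + g)) ^ a := by
      rw [betaPrimeKernel, Real.div_rpow hg0.le hg1.le, neg_add, Real.rpow_add hg1,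
        Real.rpow_sub hg0, Real.rpow_one, Real.rpow_neg hg1.le a]
      ring
    rw [hk]
    gcongr ?_ * ?_ * ?_
    · exact inv_anti₀ hg0 hg.2
    · exact Real.rpow_le_rpow_of_nonpos hg1 (by linarith [hg.2]) (by linarith)
    · refine Real.rpow_le_rpow (by norm_num) ?_ ha0.le
      rw [le_div_iff₀ hg1]
      linarith [hg.1]
  · have h2 : 0 < g * r + 1 := by positivity
    have key : r⁻¹ * Real.exp (-(g * r)⁻¹) ≤ (1 + g) / (g * r + 1) := by
      have h3 := Real.add_one_le_exp (g * r)⁻¹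
      have h4 : Real.exp (-(g * r)⁻¹) ≤ ((g * r)⁻¹ + 1)⁻¹ := by
        rw [Real.exp_neg]
        exact inv_anti₀ (by positivity) h3
      refine (mul_le_mul_of_nonneg_left h4 (inv_nonneg.2 hr0.le)).trans ?_
      rw [show r⁻¹ * ((g * r)⁻¹ + 1)⁻¹ = g / (g * r + 1) by field_simp; ring]
      gcongr
      linarith
    calc r ^ (-N) * Real.exp (-r⁻¹) ≤ r ^ (-N) * Real.exp (-(g * r)⁻¹ * N) := by
          gcongr
          rw [neg_mul, neg_le_neg_iff, mul_inv, mul_assoc, mul_comm r⁻¹, ← mul_assoc]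
          refine mul_le_of_le_one_left (by positivity) ?_
          rw [inv_mul_le_iff₀ hg0]
          linarith [hg.1]
      _ = (r⁻¹ * Real.exp (-(g * r)⁻¹)) ^ N := by
          rw [Real.mul_rpow (by positivity) (by positivity), Real.inv_rpow hr0.le,
            ← Real.rpow_neg hr0.le, ← Real.exp_mul]
      _ ≤ _ := Real.rpow_le_rpow (by positivity) key hN0.le

lemma gIntegral_pos {n q : ℕ} {ν k R2 : ℝ} (hn : 3 ≤ n) (hk : 0 < ν + k) (hq : ν < q)
    (hR0 : 0 ≤ R2) (hR1 : R2 < 1) : 0 < gIntegral n q ν k R2 := by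
  refine lt_of_lt_of_le ?_ (le_gIntegral hn hk hq hR0 hR1)
  have h3 : (3 : ℝ) ≤ n := by exact_mod_cast hn
  have h1 : 0 < ((n : ℝ) - 1) / 2 := by linarith
  have h2 : 0 < 1 - R2 := by linarith
  positivity

end GIntegral

/-! ### The marginal densities -/

section Marginal

variable {n p : ℕ} {X : Matrix (Fin n) (Fin p) ℝ}

/-- The moment `∫₀^∞ u^(s-1) f(u) du`. -/
def radialMoment (f : ℝ → ℝ) (s : ℝ) : ℝ≥0∞ :=
  ∫⁻ u in Set.Ioi (0 : ℝ), ENNReal.ofReal (u ^ (s - 1) * f u)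

/-- The centred normal density with covariance matrix `t S⁻¹`, for `t > 0`. -/
def scaledNormal {ι : Type*} [Fintype ι] [DecidableEq ι] (S : Matrix ι ι ℝ) (t : ℝ)
    (b : ι → ℝ) : ℝ :=
  (2 * Real.pi * t) ^ (-((Fintype.card ι : ℝ) / 2)) * S.det ^ (1 / 2 : ℝ) *
    Real.exp (-(b ⬝ᵥ (S *ᵥ b)) / (2 * t))

lemma normalDensity_smul_inv {ι : Type*} [Fintype ι] [DecidableEq ι] {S : Matrix ι ι ℝ}
    (hS : S.PosDef) {t : ℝ} (ht : 0 < t) (b : ι → ℝ) :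
    normalDensity 0 (t • S⁻¹) b = scaledNormal S t b := by
  have hdet := hS.det_pos
  have hu : IsUnit S.det := (Matrix.isUnit_iff_isUnit_det _).1 hS.isUnit
  have hinv : (t • S⁻¹)⁻¹ = t⁻¹ • S := by
    have := Matrix.inv_smul' (A := S⁻¹) (Units.mk0 t ht.ne')
      (by rw [Matrix.det_nonsing_inv]; exact hu.ringInverse)
    rw [Units.smul_def, Units.smul_def, Matrix.nonsing_inv_nonsing_inv _ hu] at this
    simpa using this
  rw [normalDensity, scaledNormal, hinv, Matrix.det_smul, Matrix.det_nonsing_inv,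
    Ring.inverse_eq_inv', sub_zero, Matrix.smul_mulVec, dotProduct_smul, smul_eq_mul,
    Real.mul_rpow (x := t ^ _) (by positivity) (by positivity), ← Real.rpow_natCast,
    ← Real.rpow_mul ht.le,
    Real.mul_rpow (x := 2 * Real.pi) (by positivity) ht.le, Real.inv_rpow hdet.le,
    ← Real.rpow_neg hdet.le]
  rw [show -(Fintype.card ι : ℝ) / 2 = -((Fintype.card ι : ℝ) / 2) by ring,
    show (Fintype.card ι : ℝ) * (-1 / 2) = -((Fintype.card ι : ℝ) / 2) by ring,
    show -(-(1 : ℝ) / 2) = 1 / 2 by ring,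
    show -(t⁻¹ * b ⬝ᵥ S *ᵥ b) / 2 = -(b ⬝ᵥ S *ᵥ b) / (2 * t) by field_simp]
  ring

lemma scaledNormal_nonneg {ι : Type*} [Fintype ι] [DecidableEq ι] {S : Matrix ι ι ℝ}
    (hS : S.PosDef) {t : ℝ} (ht : 0 < t) (b : ι → ℝ) : 0 ≤ scaledNormal S t b := by
  have hdet := hS.det_pos
  unfold scaledNormal
  positivity

/-- The squared norm of the residual of `y` for intercept `x.1` and coefficients `x.2`. -/
def residualSq (X : Matrix (Fin n) (Fin p) ℝ) (y : Fin n → ℝ) (γ : Finset (Fin p))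
    (x : ℝ × (γ → ℝ)) : ℝ :=
  sqNorm (fun i => y i - x.1 - (subDesign X γ *ᵥ x.2) i)

/-- The integrand of the marginal density, as a function of `((α, β), (η, g))`, without the
normalising constants and the truncations of the priors. -/
def marginalKernel (f : ℝ → ℝ) (ν : ℝ) (X : Matrix (Fin n) (Fin p) ℝ) (y : Fin n → ℝ)
    (γ : Finset (Fin p)) (x : (ℝ × (γ → ℝ)) × (ℝ × ℝ)) : ℝ≥0∞ :=
  ENNReal.ofReal (x.2.1 ^ ((n : ℝ) / 2 - 1) * f (x.2.1 * residualSq X y γ x.1)) *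
    ENNReal.ofReal (x.2.2 ^ (ν / 2 - 1) *
      scaledNormal ((subDesign X γ)ᵀ * subDesign X γ) (x.2.2 / x.2.1) x.1.2)

/-- Lebesgue measure on the space of parameters `((α, β), (η, g))` with `η, g > 0`. -/
def paramMeasure (γ : Finset (Fin p)) : Measure ((ℝ × (γ → ℝ)) × (ℝ × ℝ)) :=
  volume.prod ((volume.restrict (Set.Ioi 0)).prod (volume.restrict (Set.Ioi 0)))

/-- The set of parameters to which the proper priors with parameter `h` are truncated. -/
def truncation (γ : Finset (Fin p)) (h : ℝ × ℝ × ℝ) : Set ((ℝ × (γ → ℝ)) × (ℝ × ℝ)) :=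
  {x | (-h.1 < x.1.1 ∧ x.1.1 < h.1) ∧ (0 < x.2.1 ∧ 1 / h.2.1 < x.2.1 ∧ x.2.1 < h.2.1) ∧
    x.2.2 ≤ h.2.2}

@[fun_prop]
lemma measurable_residualSq (y : Fin n → ℝ) (γ : Finset (Fin p)) :
    Measurable (residualSq X y γ) := by
  unfold residualSq
  simp only [Matrix.mulVec, dotProduct]
  fun_prop

@[fun_prop]
lemma measurable_marginalKernel {f : ℝ → ℝ} (hf : Measurable f) (ν : ℝ) (y : Fin n → ℝ)
    (γ : Finset (Fin p)) : Measurable (marginalKernel f ν X y γ) := by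
  unfold marginalKernel scaledNormal
  simp only [Matrix.mulVec, dotProduct]
  fun_prop

lemma measurableSet_truncation (γ : Finset (Fin p)) (h : ℝ × ℝ × ℝ) :
    MeasurableSet (truncation γ h) := by
  unfold truncation
  measurability

lemma lintegral_paramMeasure (γ : Finset (Fin p)) {k : (ℝ × (γ → ℝ)) × (ℝ × ℝ) → ℝ≥0∞}
    (hk : Measurable k) :
    ∫⁻ x, k x ∂paramMeasure γ =
      ∫⁻ x, ∫⁻ η in Set.Ioi (0 : ℝ), ∫⁻ g in Set.Ioi (0 : ℝ), k (x, (η, g)) := by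
  rw [paramMeasure, lintegral_prod _ hk.aemeasurable]
  refine lintegral_congr fun x => ?_
  rw [lintegral_prod _ (by fun_prop)]

lemma lintegral_paramMeasure_symm (γ : Finset (Fin p)) {k : (ℝ × (γ → ℝ)) × (ℝ × ℝ) → ℝ≥0∞}
    (hk : Measurable k) :
    ∫⁻ x, k x ∂paramMeasure γ =
      ∫⁻ g in Set.Ioi (0 : ℝ), ∫⁻ η in Set.Ioi (0 : ℝ), ∫⁻ x, k (x, (η, g)) := by
  rw [paramMeasure, lintegral_prod_symm' _ hk, lintegral_prod_symm']
  exact hk.lintegral_prod_left'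

/-- The marginal density is an integral over the truncated parameter space, up to a constant that
does not depend on the model. -/
lemma StandardizedDesign.marginal_eq (hX : StandardizedDesign X) {f : ℝ → ℝ} (hf : Measurable f)
    {ν : ℝ} (hν : 0 < ν) (y : Fin n → ℝ) (γ : Finset (Fin p)) {h : ℝ × ℝ × ℝ}
    (h1 : 0 < h.1) (h2 : 1 < h.2.1) (h3 : 0 < h.2.2) :
    marginal f ν X y γ h =
      ENNReal.ofReal (1 / (2 * h.1) * (1 / (2 * Real.log h.2.1)) * (ν / 2 * h.2.2 ^ (-ν / 2))) *
        ∫⁻ x in truncation γ h, marginalKernel f ν X y γ x ∂paramMeasure γ := by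
  have hS := hX.posDef_gram γ
  have hlog : 0 < Real.log h.2.1 := Real.log_pos h2
  have hmeas : Measurable ((truncation γ h).indicator (marginalKernel f ν X y γ)) :=
    (measurable_marginalKernel hf ν y γ).indicator (measurableSet_truncation γ h)
  rw [← lintegral_indicator (measurableSet_truncation γ h),
    ← lintegral_const_mul' _ _ ENNReal.ofReal_ne_top,
    lintegral_paramMeasure γ (by fun_prop), Measure.volume_eq_prod, lintegral_prod _ ?meas]
  case meas =>
    have h0 : Measurable fun q : ((ℝ × (γ → ℝ)) × ℝ) × ℝ =>
        ENNReal.ofReal (1 / (2 * h.1) * (1 / (2 * Real.log h.2.1)) *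
          (ν / 2 * h.2.2 ^ (-ν / 2))) *
        (truncation γ h).indicator (marginalKernel f ν X y γ) (q.1.1, (q.1.2, q.2)) := by
      fun_prop
    have h1' := h0.lintegral_prod_right' (ν := volume.restrict (Set.Ioi (0 : ℝ)))
    exact (h1'.lintegral_prod_right' (ν := volume.restrict (Set.Ioi (0 : ℝ)))).aemeasurable
  refine lintegral_congr fun α => lintegral_congr fun β =>
    setLIntegral_congr_fun measurableSet_Ioi fun η (hη : 0 < η) => ?_
  simp only [priorBeta]
  rw [← lintegral_const_mul' _ _ (by finiteness), ← lintegral_const_mul' _ _ (by finiteness)]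
  refine setLIntegral_congr_fun measurableSet_Ioi fun g (hg : 0 < g) => ?_
  have hND := scaledNormal_nonneg hS (div_pos hg hη) β
  simp only [← div_eq_mul_inv, normalDensity_smul_inv hS (div_pos hg hη)]
  by_cases hα : -h.1 < α ∧ α < h.1
  swap
  · have : ((α, β), (η, g)) ∉ truncation γ h := fun hc => hα hc.1
    rw [Set.indicator_of_notMem this, priorAlpha, Set.indicator_of_notMem (by exact hα)]
    simp
  by_cases hη' : 1 / h.2.1 < η ∧ η < h.2.1
  swap
  · have : ((α, β), (η, g)) ∉ truncation γ h := fun hc => hη' hc.2.1.2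
    rw [Set.indicator_of_notMem this, priorEta, Set.indicator_of_notMem (by exact hη')]
    simp
  by_cases hg' : g ≤ h.2.2
  swap
  · have : ((α, β), (η, g)) ∉ truncation γ h := fun hc => hg' hc.2.2
    rw [Set.indicator_of_notMem this, priorG, Set.indicator_of_notMem (fun hc => hg' hc.2)]
    simp
  have : ((α, β), (η, g)) ∈ truncation γ h := ⟨hα, ⟨hη, hη'⟩, hg'⟩
  rw [Set.indicator_of_mem this, priorG, Set.indicator_of_mem (show g ∈ Set.Icc 0 h.2.2 from
    ⟨hg.le, hg'⟩), priorEta, Set.indicator_of_mem (by exact hη'), priorAlpha,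
    Set.indicator_of_mem (by exact hα), marginalKernel]
  simp only [residualSq]
  rw [← ENNReal.ofReal_mul (by positivity), ← ENNReal.ofReal_mul (by positivity),
    ← ENNReal.ofReal_mul' (by positivity), ← ENNReal.ofReal_mul' (by positivity),
    ← ENNReal.ofReal_mul (by positivity), Real.rpow_sub hη, Real.rpow_one]
  congr 1
  ring

lemma tendsto_setLIntegral_truncation (f : ℝ → ℝ) (ν : ℝ) (y : Fin n → ℝ)
    (γ : Finset (Fin p)) :
    Tendsto (fun h => ∫⁻ x in truncation γ h, marginalKernel f ν X y γ x ∂paramMeasure γ) atTop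
      (𝓝 (∫⁻ x, marginalKernel f ν X y γ x ∂paramMeasure γ)) := by
  have hmono : Monotone (truncation (p := p) γ) := by
    rintro ⟨a, b, c⟩ ⟨a', b', c'⟩ ⟨h1, h2, h3⟩ x ⟨⟨hx1, hx2⟩, ⟨hx3, hx4, hx5⟩, hx6⟩
    simp only at h1 h2 h3 hx1 hx2 hx3 hx4 hx5 hx6
    have hb : 0 < b := hx3.trans hx5
    exact ⟨⟨by simp only; linarith, by simp only; linarith⟩,
      ⟨hx3, (one_div_le_one_div_of_le hb h2).trans_lt hx4, hx5.trans_le h2⟩, hx6.trans h3⟩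
  have h := tendsto_measure_iUnion_atTop
    (μ := (paramMeasure γ).withDensity (marginalKernel f ν X y γ)) hmono
  have hUnion : (⋃ h, truncation γ h) = {x : (ℝ × (γ → ℝ)) × (ℝ × ℝ) | 0 < x.2.1} := by
    ext x
    simp only [Set.mem_iUnion, Set.mem_ofPred_eq]
    refine ⟨fun ⟨h, hx⟩ => hx.2.1.1, fun hx => ⟨(|x.1.1| + 1, x.2.1 + 1 + 2 / x.2.1, x.2.2), ?_⟩⟩
    have h1 := neg_abs_le x.1.1
    have h2 := le_abs_self x.1.1
    have h3 : 0 < 2 / x.2.1 := by positivity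
    refine ⟨⟨by simp only; linarith, by simp only; linarith⟩, ⟨hx, ?_, by simp only; linarith⟩,
      le_rfl⟩
    rw [one_div_lt (by simp only; positivity) hx]
    have h4 : 2 / x.2.1 = 1 / x.2.1 + 1 / x.2.1 := by ring
    have h5 : 0 < 1 / x.2.1 := by positivity
    simp only
    linarith
  have hae : ∀ᵐ x ∂paramMeasure γ, x ∈ ⋃ h, truncation γ h := by
    rw [hUnion]
    have h0 : ∀ᵐ t ∂(volume.restrict (Set.Ioi (0 : ℝ))), 0 < t :=
      (ae_restrict_iff' measurableSet_Ioi).2 (ae_of_all _ fun _ h => h)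
    exact Measure.quasiMeasurePreserving_snd.ae (Measure.quasiMeasurePreserving_fst.ae h0)
  rw [withDensity_apply _ (by rw [hUnion]; measurability),
    Measure.restrict_eq_self_of_ae_mem hae] at h
  refine h.congr fun h' => ?_
  exact withDensity_apply _ (measurableSet_truncation γ h')

/-- The part of the marginal density that does not depend on the error density. -/
def marginalFactor (ν : ℝ) (X : Matrix (Fin n) (Fin p) ℝ) (y : Fin n → ℝ)
    (γ : Finset (Fin p)) : ℝ≥0∞ :=
  ∫⁻ x : ℝ × (γ → ℝ), ENNReal.ofReal (residualSq X y γ x ^ (-(((n : ℝ) + ν) / 2))) *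
    ∫⁻ t in Set.Ioi (0 : ℝ), ENNReal.ofReal (t ^ (ν / 2 - 1) *
      scaledNormal ((subDesign X γ)ᵀ * subDesign X γ) t x.2)

/-- The error density enters the marginal density only through a radial moment: substitute
`g = η t`, and then `u = η ‖y - α 1 - X_γ β‖²`. -/
lemma lintegral_marginalKernel_eq_mul {f : ℝ → ℝ} (hf : Measurable f) {ν : ℝ}
    {y : Fin n → ℝ} {γ : Finset (Fin p)} (hres : ∀ x, 0 < residualSq X y γ x)
    (hM : radialMoment f (((n : ℝ) + ν) / 2) ≠ ∞) :
    ∫⁻ x, marginalKernel f ν X y γ x ∂paramMeasure γ =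
      radialMoment f (((n : ℝ) + ν) / 2) * marginalFactor ν X y γ := by
  rw [lintegral_paramMeasure γ (by fun_prop), marginalFactor, ← lintegral_const_mul' _ _ hM]
  refine lintegral_congr fun x => ?_
  set A := residualSq X y γ x with hA
  have hA0 : 0 < A := hres x
  set S := (subDesign X γ)ᵀ * subDesign X γ with hS
  set W := ∫⁻ t in Set.Ioi (0 : ℝ), ENNReal.ofReal (t ^ (ν / 2 - 1) * scaledNormal S t x.2)
    with hW
  have hinner : ∀ η ∈ Set.Ioi (0 : ℝ),
      ∫⁻ g in Set.Ioi (0 : ℝ), marginalKernel f ν X y γ (x, (η, g)) =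
        ENNReal.ofReal (η ^ (((n : ℝ) + ν) / 2 - 1) * f (η * A)) * W := by
    intro η (hη : 0 < η)
    simp only [marginalKernel, ← hA, ← hS]
    rw [lintegral_const_mul' _ _ ENNReal.ofReal_ne_top, lintegral_Ioi_comp_mul_left hη]
    have : ∫⁻ s in Set.Ioi (0 : ℝ), ENNReal.ofReal ((η * s) ^ (ν / 2 - 1) *
        scaledNormal S (η * s / η) x.2) = ENNReal.ofReal (η ^ (ν / 2 - 1)) * W := by
      rw [hW, ← lintegral_const_mul' _ _ ENNReal.ofReal_ne_top]
      refine setLIntegral_congr_fun measurableSet_Ioi fun s (hs : 0 < s) => ?_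
      rw [← ENNReal.ofReal_mul (by positivity), Real.mul_rpow hη.le hs.le,
        mul_div_cancel_left₀ _ hη.ne', mul_assoc]
    rw [this, ← mul_assoc, ← mul_assoc, ← ENNReal.ofReal_mul' hη.le,
      ← ENNReal.ofReal_mul' (by positivity)]
    congr 2
    rw [show ((n : ℝ) + ν) / 2 - 1 = ((n : ℝ) / 2 - 1) + 1 + (ν / 2 - 1) by ring,
      Real.rpow_add hη, Real.rpow_add hη, Real.rpow_one]
    ring
  rw [setLIntegral_congr_fun measurableSet_Ioi hinner, lintegral_mul_const _ (by fun_prop),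
    ← mul_assoc]
  congr 1
  rw [lintegral_Ioi_comp_mul_left (inv_pos.2 hA0), radialMoment,
    ← lintegral_const_mul' _ _ ENNReal.ofReal_ne_top,
    ← lintegral_mul_const' _ _ ENNReal.ofReal_ne_top]
  refine setLIntegral_congr_fun measurableSet_Ioi fun u (hu : 0 < u) => ?_
  rw [← ENNReal.ofReal_mul (by positivity), ← ENNReal.ofReal_mul' (by positivity),
    Real.mul_rpow (by positivity) hu.le, Real.inv_rpow hA0.le, ← Real.rpow_neg hA0.le,
    mul_comm A⁻¹ u, mul_assoc u, inv_mul_cancel₀ hA0.ne', mul_one,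
    show -(((n : ℝ) + ν) / 2) = -1 + -(((n : ℝ) + ν) / 2 - 1) by ring, Real.rpow_add hA0,
    Real.rpow_neg_one]
  congr 1
  ring

end Marginal

/-! ### Reduction to Gaussian errors -/

section Robust

variable {n p : ℕ} {X : Matrix (Fin n) (Fin p) ℝ}

lemma lintegral_gaussian_sub {b : ℝ} (hb : 0 < b) (m : ℝ) :
    ∫⁻ x : ℝ, ENNReal.ofReal (Real.exp (-b * (x - m) ^ 2)) =
      ENNReal.ofReal ((Real.pi / b) ^ (1 / 2 : ℝ)) := by
  rw [lintegral_sub_right_eq_self (fun x => ENNReal.ofReal (Real.exp (-b * x ^ 2))) m,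
    ← ofReal_integral_eq_lintegral_ofReal (integrable_exp_neg_mul_sq hb)
      (ae_of_all _ fun _ => (Real.exp_pos _).le), integral_gaussian, Real.sqrt_eq_rpow]

lemma lintegral_rpow_mul_exp {a r : ℝ} (ha : 0 < a) (hr : 0 < r) :
    ∫⁻ t in Set.Ioi (0 : ℝ), ENNReal.ofReal (t ^ (a - 1) * Real.exp (-(r * t))) =
      ENNReal.ofReal ((1 / r) ^ a * Real.Gamma a) := by
  have h := Real.integral_rpow_mul_exp_neg_mul_Ioi ha hr
  have hpos : 0 < (1 / r) ^ a * Real.Gamma a := by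
    have := Real.Gamma_pos_of_pos ha
    positivity
  have hint : IntegrableOn (fun t : ℝ => t ^ (a - 1) * Real.exp (-(r * t))) (Set.Ioi 0) := by
    by_contra hcon
    rw [integral_undef hcon] at h
    exact hpos.ne h
  rw [← h, ofReal_integral_eq_lintegral_ofReal hint]
  exact (ae_restrict_iff' measurableSet_Ioi).2 (ae_of_all _ fun t (ht : 0 < t) => by
    simp only [Pi.zero_apply]
    positivity)

lemma radialMoment_gaussian {s : ℝ} (hs : 0 < s) :
    radialMoment (fun u => Real.exp (-(1 / 2 * u))) s =
      ENNReal.ofReal ((1 / (1 / 2)) ^ s * Real.Gamma s) :=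
  lintegral_rpow_mul_exp hs (by norm_num)

/-- Integrating the Gaussian likelihood over the intercept and the coefficients, by completing the
square. -/
lemma StandardizedDesign.lintegral_gaussian_kernel (hX : StandardizedDesign X) (hn : 0 < n)
    (y : Fin n → ℝ) (γ : Finset (Fin p)) {η g : ℝ} (hη : 0 < η) (hg : 0 < g) :
    ∫⁻ x : ℝ × (γ → ℝ), ENNReal.ofReal (Real.exp (-(1 / 2 * (η * residualSq X y γ x))) *
        scaledNormal ((subDesign X γ)ᵀ * subDesign X γ) (g / η) x.2) =
      ENNReal.ofReal ((2 * Real.pi / (n * η)) ^ (1 / 2 : ℝ) * (1 + g) ^ (-((γ.card : ℝ) / 2)) *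
        Real.exp (-((sqNorm (centered y) + g * rss X γ (centered y)) / (2 * (1 + g)) * η))) := by
  have hS := hX.posDef_gram γ
  set S := (subDesign X γ)ᵀ * subDesign X γ with hSdef
  set z := centered y with hz
  set bh := olsCoef X γ z with hbh
  have hdet := hS.det_pos
  have hn' : (0 : ℝ) < n := by exact_mod_cast hn
  have hg1 : 0 < 1 + g := by linarith
  set q : ℝ := (γ.card : ℝ) with hq
  set c := η * (1 + g) / (2 * g) with hc
  have hc0 : 0 < c := by positivity
  set m := (g / (1 + g)) • bh with hm
  set E := (sqNorm z + g * rss X γ z) / (2 * (1 + g)) * η with hE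
  -- the exponent after completing the square in the coefficients
  have hexp : ∀ x : ℝ × (γ → ℝ), -(1 / 2 * (η * residualSq X y γ x)) +
      -(x.2 ⬝ᵥ (S *ᵥ x.2)) / (2 * (g / η)) =
      -E + -(n * η / 2) * (x.1 - (∑ j, y j) / n) ^ 2 +
        -c * ((x.2 - m) ⬝ᵥ (S *ᵥ (x.2 - m))) := by
    intro x
    have h0 := hX.sqNorm_sub_mulVec γ z 0
    have h1 := hX.sqNorm_sub_mulVec γ z x.2
    rw [← hbh, ← hSdef] at h0 h1
    have hsymm : bh ⬝ᵥ (S *ᵥ x.2) = x.2 ⬝ᵥ (S *ᵥ bh) := by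
      rw [Matrix.dotProduct_mulVec, ← Matrix.mulVec_transpose, dotProduct_comm]
      congr 2
      rw [hSdef, Matrix.transpose_mul, Matrix.transpose_transpose]
    rw [residualSq, hX.sqNorm_sub_const_sub hn, ← hz, h1, hE, hm]
    simp only [Matrix.mulVec_zero, sub_zero, zero_sub, Matrix.mulVec_neg, neg_dotProduct,
      dotProduct_neg, neg_neg] at h0
    simp only [Matrix.mulVec_sub, sub_dotProduct, dotProduct_sub, Matrix.mulVec_smul,
      smul_dotProduct, dotProduct_smul, smul_eq_mul, hsymm]
    rw [h0, hc]
    field_simp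
    ring
  have hsplit : ∀ x : ℝ × (γ → ℝ),
      ENNReal.ofReal (Real.exp (-(1 / 2 * (η * residualSq X y γ x))) *
        scaledNormal S (g / η) x.2) =
      ENNReal.ofReal (Real.exp (-E) * ((2 * Real.pi * (g / η)) ^ (-(q / 2)) *
        S.det ^ (1 / 2 : ℝ))) *
      (ENNReal.ofReal (Real.exp (-(n * η / 2) * (x.1 - (∑ j, y j) / n) ^ 2)) *
        ENNReal.ofReal (Real.exp (-c * ((x.2 - m) ⬝ᵥ (S *ᵥ (x.2 - m)))))) := by
    intro x
    rw [← ENNReal.ofReal_mul (by positivity), ← ENNReal.ofReal_mul (by positivity), scaledNormal,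
      Fintype.card_coe, ← hq]
    congr 1
    have := congrArg Real.exp (hexp x)
    rw [Real.exp_add, Real.exp_add, Real.exp_add] at this
    linear_combination ((2 * Real.pi * (g / η)) ^ (-(q / 2)) * S.det ^ (1 / 2 : ℝ)) * this
  simp_rw [hsplit]
  rw [lintegral_const_mul' _ _ ENNReal.ofReal_ne_top, Measure.volume_eq_prod,
    lintegral_prod_mul
      (f := fun a : ℝ => ENNReal.ofReal (Real.exp (-(n * η / 2) * (a - (∑ j, y j) / n) ^ 2)))
      (g := fun b : γ → ℝ => ENNReal.ofReal (Real.exp (-c * ((b - m) ⬝ᵥ (S *ᵥ (b - m))))))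
      (by fun_prop) (by simp only [Matrix.mulVec, dotProduct]; fun_prop),
    lintegral_gaussian_sub (by positivity), lintegral_gaussian_quadraticForm hS hc0,
    ← ENNReal.ofReal_mul (by positivity), ← ENNReal.ofReal_mul (by positivity), Fintype.card_coe,
    ← hq]
  congr 1
  have h1 : Real.pi / c = (2 * Real.pi * (g / η)) * (1 + g)⁻¹ := by
    rw [hc]
    field_simp
  have h2 : Real.pi / (n * η / 2) = 2 * Real.pi / (n * η) := by field_simp
  rw [h1, h2, Real.mul_rpow (x := 2 * Real.pi * (g / η)) (by positivity) (by positivity),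
    Real.inv_rpow hg1.le, ← Real.rpow_neg hg1.le]
  have h3 : (2 * Real.pi * (g / η)) ^ (-(q / 2)) * (2 * Real.pi * (g / η)) ^ (q / 2) = 1 := by
    rw [← Real.rpow_add (by positivity)]
    simp
  have h4 : S.det ^ (1 / 2 : ℝ) * S.det ^ (-(1 / 2) : ℝ) = 1 := by
    rw [← Real.rpow_add hdet]
    simp
  linear_combination (Real.exp (-E) * (2 * Real.pi / (n * η)) ^ (1 / 2 : ℝ) *
    (1 + g) ^ (-(q / 2))) * (S.det ^ (1 / 2 : ℝ) * S.det ^ (-(1 / 2) : ℝ)) * h3 +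
    (Real.exp (-E) * (2 * Real.pi / (n * η)) ^ (1 / 2 : ℝ) * (1 + g) ^ (-(q / 2))) * h4

/-- The constant by which the Gaussian marginal density exceeds the integral over `g`. -/
def gaussianConst (y : Fin n → ℝ) : ℝ :=
  (2 * Real.pi / n) ^ (1 / 2 : ℝ) * Real.Gamma (((n : ℝ) - 1) / 2) *
    (2 / sqNorm (centered y)) ^ (((n : ℝ) - 1) / 2)

/-- The marginal density under Gaussian errors is the integral over `g`, up to a constant that does
not depend on the model. -/
lemma StandardizedDesign.lintegral_marginalKernel_gaussian (hX : StandardizedDesign X)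
    (hn : 2 ≤ n) {ν : ℝ} (hν : 0 < ν) (y : Fin n → ℝ) {γ : Finset (Fin p)} (hγ : ν < γ.card)
    (hrss : 0 < rss X γ (centered y)) :
    ∫⁻ x, marginalKernel (fun u => Real.exp (-(1 / 2 * u))) ν X y γ x ∂paramMeasure γ =
      ENNReal.ofReal (gaussianConst y * gIntegral n γ.card ν 0 (rSquared X y γ)) := by
  have hn1 : (2 : ℝ) ≤ n := by exact_mod_cast hn
  have hn0 : (0 : ℝ) < n := by linarith
  set N : ℝ := ((n : ℝ) - 1) / 2 with hN
  have hN0 : 0 < N := by rw [hN]; linarith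
  have hTSS : 0 < sqNorm (centered y) := hrss.trans_le (hX.rss_le_sqNorm γ _)
  set R := rss X γ (centered y) with hR
  set TSS := sqNorm (centered y) with hTSSdef
  have hr : 1 - rSquared X y γ = R / TSS := one_sub_rSquared y γ
  have hr0 : 0 < R / TSS := by positivity
  have hr1 : R / TSS ≤ 1 := (div_le_one hTSS).2 (hX.rss_le_sqNorm γ _)
  have hC : 0 ≤ gaussianConst y := by
    have := Real.Gamma_pos_of_pos hN0
    unfold gaussianConst
    positivity
  have hint : IntegrableOn (fun g => betaPrimeKernel ((ν + 0) / 2) ((γ.card - ν) / 2) g *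
      ((1 + g) / (g * (1 - rSquared X y γ) + 1)) ^ N) (Set.Ioi 0) := by
    rw [hr]
    exact integrableOn_betaPrimeKernel_mul (by linarith) (by linarith) hr0 hr1 hN0.le
  rw [lintegral_paramMeasure_symm γ (by fun_prop), gIntegral_eq _ _ _ _ _ (by linarith), ← hN,
    ENNReal.ofReal_mul hC, ofReal_integral_eq_lintegral_ofReal hint
      ((ae_restrict_iff' measurableSet_Ioi).2 (ae_of_all _ fun g (hg : 0 < g) => by
        have := betaPrimeKernel_pos (a := (ν + 0) / 2) (b := (γ.card - ν) / 2) hg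
        rw [hr]
        simp only [Pi.zero_apply]
        positivity)),
    ← lintegral_const_mul' _ _ ENNReal.ofReal_ne_top]
  refine setLIntegral_congr_fun measurableSet_Ioi fun g (hg : 0 < g) => ?_
  have hg1 : 0 < 1 + g := by linarith
  set E := (TSS + g * R) / (2 * (1 + g)) with hE
  have hE0 : 0 < E := by positivity
  have hη : ∀ η ∈ Set.Ioi (0 : ℝ), ∫⁻ x : ℝ × (γ → ℝ),
      marginalKernel (fun u => Real.exp (-(1 / 2 * u))) ν X y γ (x, (η, g)) =
      ENNReal.ofReal (g ^ (ν / 2 - 1) * ((2 * Real.pi / n) ^ (1 / 2 : ℝ) *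
        (1 + g) ^ (-((γ.card : ℝ) / 2)))) *
        ENNReal.ofReal (η ^ (N - 1) * Real.exp (-(E * η))) := by
    intro η (hη : 0 < η)
    have hpoint : ∀ x : ℝ × (γ → ℝ),
        marginalKernel (fun u => Real.exp (-(1 / 2 * u))) ν X y γ (x, (η, g)) =
        ENNReal.ofReal (η ^ ((n : ℝ) / 2 - 1) * g ^ (ν / 2 - 1)) *
          ENNReal.ofReal (Real.exp (-(1 / 2 * (η * residualSq X y γ x))) *
            scaledNormal ((subDesign X γ)ᵀ * subDesign X γ) (g / η) x.2) := by
      intro x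
      rw [marginalKernel, ← ENNReal.ofReal_mul (by positivity),
        ← ENNReal.ofReal_mul (by positivity)]
      congr 1
      simp only
      ring
    simp_rw [hpoint]
    rw [lintegral_const_mul' _ _ ENNReal.ofReal_ne_top,
      hX.lintegral_gaussian_kernel (by omega) y γ hη hg, ← ENNReal.ofReal_mul (by positivity),
      ← ENNReal.ofReal_mul (by positivity)]
    congr 1
    rw [← hE, ← div_div, div_eq_mul_inv (2 * Real.pi / n) η,
      Real.mul_rpow (by positivity) (by positivity), Real.inv_rpow hη.le, ← Real.rpow_neg hη.le,
      show N - 1 = ((n : ℝ) / 2 - 1) + -(1 / 2) by rw [hN]; ring, Real.rpow_add hη]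
    ring
  rw [setLIntegral_congr_fun measurableSet_Ioi hη, lintegral_const_mul' _ _ ENNReal.ofReal_ne_top,
    lintegral_rpow_mul_exp hN0 hE0, ← ENNReal.ofReal_mul (by positivity),
    ← ENNReal.ofReal_mul hC]
  congr 1
  have h1 : 1 / E = 2 / TSS * ((1 + g) / (g * (1 - rSquared X y γ) + 1)) := by
    rw [hr, hE]
    field_simp
    ring
  rw [h1, Real.mul_rpow (by positivity) (by rw [hr]; positivity), gaussianConst, betaPrimeKernel,
    ← hN, ← hTSSdef,
    show -((ν + 0) / 2 + ((γ.card : ℝ) - ν) / 2) = -((γ.card : ℝ) / 2) by ring, add_zero]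
  ring

lemma StandardizedDesign.residualSq_pos (hX : StandardizedDesign X) (hn : 0 < n)
    {y : Fin n → ℝ} {γ : Finset (Fin p)} (hrss : 0 < rss X γ (centered y)) (x : ℝ × (γ → ℝ)) :
    0 < residualSq X y γ x := by
  rw [residualSq, hX.sqNorm_sub_const_sub hn]
  have h1 := hX.rss_le γ (centered y) x.2
  have h2 : 0 ≤ (n : ℝ) * (x.1 - (∑ j, y j) / n) ^ 2 := by positivity
  linarith

/-- The marginal factor is a model-free constant times the integral over `g`. -/
lemma StandardizedDesign.marginalFactor_eq (hX : StandardizedDesign X) (hn : 2 ≤ n) {ν : ℝ}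
    (hν : 0 < ν) (y : Fin n → ℝ) {γ : Finset (Fin p)} (hγ : ν < γ.card)
    (hrss : 0 < rss X γ (centered y)) :
    ENNReal.ofReal ((1 / (1 / 2)) ^ (((n : ℝ) + ν) / 2) * Real.Gamma (((n : ℝ) + ν) / 2)) *
      marginalFactor ν X y γ =
      ENNReal.ofReal (gaussianConst y * gIntegral n γ.card ν 0 (rSquared X y γ)) := by
  have hs : 0 < ((n : ℝ) + ν) / 2 := by positivity
  rw [← hX.lintegral_marginalKernel_gaussian hn hν y hγ hrss,
    lintegral_marginalKernel_eq_mul (by fun_prop) (hX.residualSq_pos (by omega) hrss),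
    radialMoment_gaussian hs]
  rw [radialMoment_gaussian hs]
  exact ENNReal.ofReal_ne_top

/-- For every spherical error density with a finite radial moment, the Bayes factors under the
proper priors converge to the Gaussian Bayes factor with `k = 0`. -/
theorem StandardizedDesign.tendsto_bfProper (hX : StandardizedDesign X) (hn : 3 ≤ n)
    {f : ℝ → ℝ} (hf : Measurable f) {ν : ℝ} (hν : 0 < ν) (hν1 : ν < 1)
    (hM : radialMoment f (((n : ℝ) + ν) / 2) ≠ ∞) (hM0 : radialMoment f (((n : ℝ) + ν) / 2) ≠ 0)
    (y : Fin n → ℝ) (hrss : 0 < rss X Finset.univ (centered y)) {γ : Finset (Fin p)}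
    (hγ : γ.Nonempty) :
    Tendsto (bfProper f ν X y γ) atTop (𝓝 (ENNReal.ofReal (bfGaussian ν 0 X y γ))) := by
  have hTSS : 0 < sqNorm (centered y) := hrss.trans_le (hX.rss_le_sqNorm _ _)
  have hN0 : (0 : ℝ) < ((n : ℝ) - 1) / 2 := by
    have : (3 : ℝ) ≤ n := by exact_mod_cast hn
    linarith
  have hC : 0 < gaussianConst y := by
    have := Real.Gamma_pos_of_pos hN0
    unfold gaussianConst
    positivity
  have hG : 0 < (1 / (1 / 2)) ^ (((n : ℝ) + ν) / 2) * Real.Gamma (((n : ℝ) + ν) / 2) := by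
    have := Real.Gamma_pos_of_pos (show 0 < ((n : ℝ) + ν) / 2 by positivity)
    positivity
  set G := (1 / (1 / 2)) ^ (((n : ℝ) + ν) / 2) * Real.Gamma (((n : ℝ) + ν) / 2) with hGdef
  set M := radialMoment f (((n : ℝ) + ν) / 2) with hMdef
  -- the limits of the marginal densities without the normalising constants of the priors
  have key : ∀ γ : Finset (Fin p), γ.Nonempty →
      0 < gIntegral n γ.card ν 0 (rSquared X y γ) ∧
      ∫⁻ x, marginalKernel f ν X y γ x ∂paramMeasure γ =
        M * ENNReal.ofReal (gaussianConst y / G * gIntegral n γ.card ν 0 (rSquared X y γ)) := by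
    intro γ hγ
    have hcard : ν < γ.card := hν1.trans_le (by exact_mod_cast hγ.card_pos)
    have hrγ : 0 < rss X γ (centered y) :=
      hrss.trans_le (hX.rss_anti (Finset.subset_univ γ) _)
    have hr := one_sub_rSquared (X := X) y γ
    have hr0 : 0 < rss X γ (centered y) / sqNorm (centered y) := by positivity
    have hr1 : rss X γ (centered y) / sqNorm (centered y) ≤ 1 :=
      (div_le_one hTSS).2 (hX.rss_le_sqNorm γ _)
    refine ⟨gIntegral_pos hn (by linarith) hcard (by linarith) (by linarith), ?_⟩
    rw [lintegral_marginalKernel_eq_mul hf (hX.residualSq_pos (by omega) hrγ) hM]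
    congr 1
    have h := hX.marginalFactor_eq (by omega) hν y hcard hrγ
    rw [← hGdef] at h
    rw [show gaussianConst y / G * gIntegral n γ.card ν 0 (rSquared X y γ) =
      G⁻¹ * (gaussianConst y * gIntegral n γ.card ν 0 (rSquared X y γ)) by ring,
      ENNReal.ofReal_mul (inv_pos.2 hG).le, ← h, ← mul_assoc,
      ← ENNReal.ofReal_mul (inv_pos.2 hG).le, inv_mul_cancel₀ hG.ne', ENNReal.ofReal_one, one_mul]
  obtain ⟨hI, hJ⟩ := key γ hγ
  have hune : (Finset.univ : Finset (Fin p)).Nonempty := hγ.mono (Finset.subset_univ γ)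
  obtain ⟨hIF, hJF⟩ := key Finset.univ hune
  have hne0 : M * ENNReal.ofReal (gaussianConst y / G *
      gIntegral n (Finset.univ : Finset (Fin p)).card ν 0 (rSquared X y Finset.univ)) ≠ 0 := by
    refine mul_ne_zero hM0 ?_
    rw [Ne, ENNReal.ofReal_eq_zero, not_le]
    positivity
  have hlim := ENNReal.Tendsto.div (tendsto_setLIntegral_truncation (X := X) f ν y γ)
    (Or.inr (by rw [hJF]; exact hne0))
    (tendsto_setLIntegral_truncation (X := X) f ν y Finset.univ)
    (Or.inr (by rw [hJ]; finiteness))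
  have hval : (∫⁻ x, marginalKernel f ν X y γ x ∂paramMeasure γ) /
      (∫⁻ x, marginalKernel f ν X y Finset.univ x ∂paramMeasure Finset.univ) =
      ENNReal.ofReal (bfGaussian ν 0 X y γ) := by
    rw [hJ, hJF, ENNReal.mul_div_mul_left _ _ hM0 hM, ← ENNReal.ofReal_div_of_pos (by positivity),
      mul_div_mul_left _ _ (by positivity), bfGaussian]
    simp
  rw [hval] at hlim
  refine hlim.congr' ?_
  filter_upwards [eventually_ge_atTop ((1, 2, 1) : ℝ × ℝ × ℝ)] with h hh
  obtain ⟨h1, h2, h3⟩ : 1 ≤ h.1 ∧ 2 ≤ h.2.1 ∧ 1 ≤ h.2.2 := ⟨hh.1, hh.2.1, hh.2.2⟩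
  have hlog : 0 < Real.log h.2.1 := Real.log_pos (by linarith)
  rw [bfProper, hX.marginal_eq hf hν y γ (by linarith) (by linarith) (by linarith),
    hX.marginal_eq hf hν y Finset.univ (by linarith) (by linarith) (by linarith),
    ENNReal.mul_div_mul_left _ _ _ ENNReal.ofReal_ne_top]
  rw [Ne, ENNReal.ofReal_eq_zero, not_le]
  have : 0 < h.1 := by linarith
  have : 0 < h.2.2 := by linarith
  positivity

end Robust

/-! ### Spherically symmetric errors -/

section Spherical

variable {n : ℕ} {Ω : Type*} [MeasurableSpace Ω] {P : Measure Ω} {ε : Ω → Fin n → ℝ} {f : ℝ → ℝ}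

lemma lintegral_rpow_sqNorm_mul (hn : 0 < n) (hf : Measurable f) (a : ℝ) :
    ∫⁻ x : Fin n → ℝ, ENNReal.ofReal (sqNorm x ^ a * f (sqNorm x)) =
      sphereArea n * (ENNReal.ofReal (1 / 2) * radialMoment f ((n : ℝ) / 2 + a)) := by
  rw [lintegral_fun_sqNorm (g := fun u => ENNReal.ofReal (u ^ a * f u)) hn (by fun_prop),
    radialMoment, ← lintegral_add_sq 0 (fun u =>
      ENNReal.ofReal (u ^ ((n : ℝ) / 2 + a - 1) * f u)),
    ← lintegral_const_mul' _ _ ENNReal.ofReal_ne_top]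
  congr 1
  refine setLIntegral_congr_fun measurableSet_Ioi fun r (hr : 0 < r) => ?_
  simp only [zero_add]
  rw [← ENNReal.ofReal_mul (by positivity), ← ENNReal.ofReal_mul (by positivity),
    ← ENNReal.ofReal_mul (by positivity)]
  congr 1
  have h1 : (r ^ 2) ^ ((n : ℝ) / 2 + a - 1) = r ^ ((n : ℝ) - 1) * r⁻¹ * (r ^ 2) ^ a := by
    rw [show (n : ℝ) / 2 + a - 1 = ((n : ℝ) / 2 - 1) + a by ring, Real.rpow_add (by positivity),
      ← Real.rpow_natCast r 2, ← Real.rpow_mul hr.le, ← Real.rpow_neg_one r,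
      ← Real.rpow_add hr]
    congr 2
    push_cast
    ring
  have h2 : r ^ (n - 1) = r ^ ((n : ℝ) - 1) := by
    rw [← Real.rpow_natCast, Nat.cast_pred hn]
  rw [h1, h2]
  field_simp

lemma SphericalError.lintegral_eq (hε : SphericalError P ε f) {k : (Fin n → ℝ) → ℝ≥0∞}
    (hk : Measurable k) :
    ∫⁻ ω, k (ε ω) ∂P = ∫⁻ x, ENNReal.ofReal (f (sqNorm x)) * k x := by
  have hfm := hε.measurable_density
  rw [← lintegral_map hk hε.measurable, hε.law, lintegral_withDensity_eq_lintegral_mul _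
    (by fun_prop) hk]
  rfl

lemma SphericalError.integrable_sq (hε : SphericalError P ε f) (i : Fin n) :
    Integrable (fun ω => ε ω i ^ 2) P := by
  have h := hε.cov i i
  rw [covariance, hε.mean] at h
  by_contra hcon
  rw [integral_undef (by simpa [sq] using hcon)] at h
  simp at h

lemma SphericalError.memLp (hε : SphericalError P ε f) (i : Fin n) :
    MemLp (fun ω => ε ω i) 2 P := by
  have := hε.measurable
  exact (memLp_two_iff_integrable_sq (by fun_prop)).2 (hε.integrable_sq i)

lemma SphericalError.integral_mul (hε : SphericalError P ε f) (i j : Fin n) :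
    ∫ ω, ε ω i * ε ω j ∂P = if i = j then 1 else 0 := by
  rw [← hε.cov i j, covariance, hε.mean, hε.mean]
  simp

lemma SphericalError.memLp_dotProduct (hε : SphericalError P ε f) (v : Fin n → ℝ) :
    MemLp (fun ω => v ⬝ᵥ ε ω) 2 P := by
  simp only [dotProduct]
  exact memLp_finsetSum _ fun i _ => (hε.memLp i).const_mul (v i)

lemma SphericalError.integral_dotProduct_sq (hε : SphericalError P ε f) (v : Fin n → ℝ) :
    ∫ ω, (v ⬝ᵥ ε ω) ^ 2 ∂P = sqNorm v := by
  have h : ∀ ω, (v ⬝ᵥ ε ω) ^ 2 = ∑ i, ∑ j, v i * v j * (ε ω i * ε ω j) := by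
    intro ω
    rw [dotProduct, sq, Finset.sum_mul_sum]
    exact Finset.sum_congr rfl fun i _ => Finset.sum_congr rfl fun j _ => by ring
  have hint : ∀ i j, Integrable (fun ω => v i * v j * (ε ω i * ε ω j)) P := fun i j =>
    ((hε.memLp i).integrable_mul (hε.memLp j)).const_mul _
  simp_rw [h]
  rw [integral_finsetSum _ fun i _ => integrable_finsetSum _ fun j _ => hint i j]
  simp_rw [integral_finsetSum _ fun j _ => hint _ j, integral_const_mul, hε.integral_mul]
  simp [sqNorm, sq]

/-- Chebyshev's inequality for a linear functional of the error. -/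
lemma SphericalError.measure_dotProduct_sq_ge (hε : SphericalError P ε f) (v : Fin n → ℝ)
    {K : ℝ} (hK : 0 < K) :
    P {ω | K ≤ (v ⬝ᵥ ε ω) ^ 2} ≤ ENNReal.ofReal (sqNorm v / K) := by
  have hint := (hε.memLp_dotProduct v).integrable_sq
  have h := mul_meas_ge_le_lintegral₀ (μ := P)
    (f := fun ω => ENNReal.ofReal ((v ⬝ᵥ ε ω) ^ 2)) hint.1.aemeasurable.ennreal_ofReal
    (ENNReal.ofReal K)
  rw [← ofReal_integral_eq_lintegral_ofReal hint (ae_of_all _ fun _ => sq_nonneg _),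
    hε.integral_dotProduct_sq] at h
  rw [ENNReal.ofReal_div_of_pos hK, ENNReal.le_div_iff_mul_le (by simp [hK]) (by simp), mul_comm]
  refine le_trans ?_ h
  gcongr
  exact fun hω => ENNReal.ofReal_le_ofReal hω

lemma SphericalError.radialMoment_eq [IsProbabilityMeasure P] (hε : SphericalError P ε f)
    (hn : 0 < n) :
    sphereArea n * (ENNReal.ofReal (1 / 2) * radialMoment f ((n : ℝ) / 2)) = 1 := by
  have h := lintegral_rpow_sqNorm_mul hn hε.measurable_density 0
  have h1 := hε.lintegral_eq (k := fun _ => 1) measurable_const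
  simp only [lintegral_one, measure_univ, mul_one] at h1
  simp only [Real.rpow_zero, one_mul, add_zero] at h
  rw [← h, ← h1]

/-- The second moment of the error makes the radial moments of order up to `n / 2 + 1` finite. -/
lemma SphericalError.radialMoment_ne_top [IsProbabilityMeasure P] (hε : SphericalError P ε f)
    (hn : 0 < n) {ν : ℝ} (hν : 0 < ν) (hν1 : ν < 1) :
    radialMoment f (((n : ℝ) + ν) / 2) ≠ ∞ := by
  have hfm := hε.measurable_density
  have hA : sphereArea n ≠ 0 := sphereArea_ne_zero hn
  have h2 : radialMoment f ((n : ℝ) / 2 + 1) ≠ ∞ := by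
    have h := lintegral_rpow_sqNorm_mul hn hfm 1
    have h1 := hε.lintegral_eq (k := fun x => ENNReal.ofReal (sqNorm x)) (by fun_prop)
    have h3 : ∫⁻ ω, ENNReal.ofReal (sqNorm (ε ω)) ∂P ≠ ∞ := by
      have hint : Integrable (fun ω => sqNorm (ε ω)) P :=
        integrable_finsetSum _ fun i _ => hε.integrable_sq i
      exact hint.lintegral_lt_top.ne
    rw [h1] at h3
    have h4 : ∀ x : Fin n → ℝ, ENNReal.ofReal (f (sqNorm x)) * ENNReal.ofReal (sqNorm x) =
        ENNReal.ofReal (sqNorm x ^ (1 : ℝ) * f (sqNorm x)) := fun x => by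
      rw [← ENNReal.ofReal_mul (hε.density_nonneg _), Real.rpow_one, mul_comm]
    simp_rw [h4] at h3
    rw [h] at h3
    intro hc
    rw [hc, ENNReal.mul_top (by simp), ENNReal.mul_top hA] at h3
    exact h3 rfl
  have h0 : radialMoment f ((n : ℝ) / 2) ≠ ∞ := by
    intro hc
    have h := hε.radialMoment_eq hn
    rw [hc, ENNReal.mul_top (by simp), ENNReal.mul_top hA] at h
    simp at h
  refine ne_top_of_le_ne_top (ENNReal.add_ne_top.2 ⟨h0, h2⟩) ?_
  rw [radialMoment, radialMoment, radialMoment, ← lintegral_add_left (by fun_prop)]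
  refine setLIntegral_mono' measurableSet_Ioi fun u (hu : 0 < u) => ?_
  have hfu := hε.density_nonneg u
  rw [← ENNReal.ofReal_add (by positivity) (by positivity), ← add_mul]
  refine ENNReal.ofReal_le_ofReal (mul_le_mul_of_nonneg_right ?_ hfu)
  rcases le_total u 1 with h | h
  · have h5 := Real.rpow_le_rpow_of_exponent_ge hu h
      (show (n : ℝ) / 2 - 1 ≤ ((n : ℝ) + ν) / 2 - 1 by linarith)
    have : 0 ≤ u ^ ((n : ℝ) / 2 + 1 - 1) := by positivity
    linarith
  · have h5 := Real.rpow_le_rpow_of_exponent_le h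
      (show ((n : ℝ) + ν) / 2 - 1 ≤ (n : ℝ) / 2 + 1 - 1 by linarith)
    have : 0 ≤ u ^ ((n : ℝ) / 2 - 1) := by positivity
    linarith

lemma SphericalError.radialMoment_ne_zero [IsProbabilityMeasure P] (hε : SphericalError P ε f)
    (hn : 0 < n) (s : ℝ) : radialMoment f s ≠ 0 := by
  have hfm := hε.measurable_density
  intro hc
  have h := hε.radialMoment_eq hn
  have h0 : radialMoment f ((n : ℝ) / 2) = 0 := by
    rw [radialMoment, lintegral_eq_zero_iff (by fun_prop)] at hc ⊢
    rw [EventuallyEq, ae_restrict_iff' measurableSet_Ioi] at hc ⊢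
    filter_upwards [hc] with u hu hu0
    have hu0' : 0 < u := hu0
    have hfu := hε.density_nonneg u
    have h1 := hu hu0
    simp only [Pi.zero_apply, ENNReal.ofReal_eq_zero] at h1 ⊢
    have h2 : 0 < u ^ (s - 1) := by positivity
    have h3 : f u ≤ 0 := by
      by_contra h4
      push Not at h4
      have : 0 < u ^ (s - 1) * f u := by positivity
      linarith
    exact mul_nonpos_of_nonneg_of_nonpos (by positivity) h3
  rw [h0] at h
  simp at h

/-- The density of one coordinate, restricted to the errors of norm at least `R`. -/
lemma lintegral_density_section_le {m : ℕ} (hm : 2 ≤ m) (hf : Measurable f) (hf0 : ∀ t, 0 ≤ f t)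
    {R : ℝ} (hR : 0 < R) (a : ℝ) :
    ∫⁻ z : Fin m → ℝ, (Set.Ici (R ^ 2)).indicator (fun u => ENNReal.ofReal (f u))
      (a ^ 2 + sqNorm z) ≤
      sphereArea m * (ENNReal.ofReal (1 / 2 * R⁻¹) * radialMoment f (((m : ℝ) + 1) / 2)) := by
  have hmeas : Measurable ((Set.Ici (R ^ 2)).indicator fun u => ENNReal.ofReal (f u)) :=
    Measurable.indicator (by fun_prop) measurableSet_Ici
  rw [lintegral_fun_sqNorm (g := fun s => (Set.Ici (R ^ 2)).indicator
    (fun u => ENNReal.ofReal (f u)) (a ^ 2 + s)) (by omega) (by fun_prop)]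
  gcongr
  calc _ ≤ ∫⁻ r in Set.Ioi (0 : ℝ), ENNReal.ofReal (2 * r) * (ENNReal.ofReal (1 / 2 * R⁻¹) *
        ENNReal.ofReal ((a ^ 2 + r ^ 2) ^ (((m : ℝ) + 1) / 2 - 1) * f (a ^ 2 + r ^ 2))) := ?_
    _ = ENNReal.ofReal (1 / 2 * R⁻¹) * ∫⁻ u in Set.Ioi (a ^ 2),
        ENNReal.ofReal (u ^ (((m : ℝ) + 1) / 2 - 1) * f u) := by
      rw [lintegral_add_sq (a ^ 2) (fun u => ENNReal.ofReal (1 / 2 * R⁻¹) *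
        ENNReal.ofReal (u ^ (((m : ℝ) + 1) / 2 - 1) * f u)),
        lintegral_const_mul' _ _ ENNReal.ofReal_ne_top]
    _ ≤ _ := by
      gcongr
      exact lintegral_mono_set (Set.Ioi_subset_Ioi (sq_nonneg a))
  refine setLIntegral_mono' measurableSet_Ioi fun r (hr : 0 < r) => ?_
  by_cases hu : R ^ 2 ≤ a ^ 2 + r ^ 2
  swap
  · rw [Set.indicator_of_notMem (by exact hu)]
    simp
  rw [Set.indicator_of_mem (by exact hu), ← ENNReal.ofReal_mul (by positivity),
    ← ENNReal.ofReal_mul (by positivity), ← ENNReal.ofReal_mul (by positivity)]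
  refine ENNReal.ofReal_le_ofReal ?_
  set u := a ^ 2 + r ^ 2 with hudef
  have hu0 : 0 < u := by positivity
  have h1 : r ^ (m - 1) = r * r ^ (m - 2) := by
    rw [← pow_succ']
    congr 1
    omega
  have hru : r ≤ √u := Real.le_sqrt_of_sq_le (by rw [hudef]; nlinarith [sq_nonneg a])
  have hRu : R ≤ √u := Real.le_sqrt_of_sq_le hu
  have h2 : u ^ (((m : ℝ) + 1) / 2 - 1) = √u ^ (m - 2) * √u := by
    rw [← pow_succ, Real.sqrt_eq_rpow, ← Real.rpow_natCast, ← Real.rpow_mul hu0.le]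
    congr 1
    push_cast [Nat.cast_sub hm]
    ring
  have h3 : r ^ (m - 2) ≤ √u ^ (m - 2) := pow_le_pow_left₀ hr.le hru _
  have h4 : 1 ≤ R⁻¹ * √u := by rwa [← div_eq_inv_mul, one_le_div hR]
  rw [h1, h2]
  calc r * r ^ (m - 2) * f u ≤ r * √u ^ (m - 2) * f u := by
        have := hf0 u
        gcongr
    _ ≤ (r * √u ^ (m - 2) * f u) * (R⁻¹ * √u) := by
        refine le_mul_of_one_le_right ?_ h4
        have := hf0 u
        positivity
    _ = _ := by ring

lemma sphereArea_eq (m : ℕ) (hm : 0 < m) :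
    sphereArea m = ENNReal.ofReal (m * (√Real.pi ^ m / Real.Gamma ((m : ℝ) / 2 + 1))) := by
  have : Nonempty (Fin m) := ⟨⟨0, hm⟩⟩
  rw [sphereArea, Measure.toSphere_apply_univ, finrank_euclideanSpace_fin,
    EuclideanSpace.volume_ball, ENNReal.ofReal_mul (by positivity)]
  simp

/-- The areas of the unit spheres of consecutive dimensions differ by at most a polynomial factor; the
rate is immaterial. -/
lemma sphereArea_le (m : ℕ) (hm : 0 < m) :
    sphereArea m ≤ ENNReal.ofReal (m + 1) * sphereArea (m + 1) := by
  rw [sphereArea_eq m hm, sphereArea_eq (m + 1) m.succ_pos, ← ENNReal.ofReal_mul (by positivity)]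
  refine ENNReal.ofReal_le_ofReal ?_
  have hm1 : (1 : ℝ) ≤ m := by exact_mod_cast hm
  have hg1 : 0 < Real.Gamma ((m : ℝ) / 2 + 1) := Real.Gamma_pos_of_pos (by positivity)
  have hg2 : 0 < Real.Gamma (((m + 1 : ℕ) : ℝ) / 2 + 1) := Real.Gamma_pos_of_pos (by positivity)
  have hg : Real.Gamma (((m + 1 : ℕ) : ℝ) / 2 + 1) ≤
      ((m : ℝ) + 1) * Real.Gamma ((m : ℝ) / 2 + 1) := by
    calc Real.Gamma (((m + 1 : ℕ) : ℝ) / 2 + 1) ≤ Real.Gamma ((m : ℝ) / 2 + 1 + 1) := by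
          refine Real.Gamma_strictMonoOn_Ici.monotoneOn (Set.mem_Ici.2 ?_) (Set.mem_Ici.2 ?_) ?_ <;>
          · push_cast
            linarith
      _ = ((m : ℝ) / 2 + 1) * Real.Gamma ((m : ℝ) / 2 + 1) :=
          Real.Gamma_add_one (by positivity)
      _ ≤ _ := by
          gcongr
          linarith
  have hpi : 1 ≤ √Real.pi := Real.one_le_sqrt.2 (by linarith [Real.pi_gt_three])
  have h1 : (Real.Gamma ((m : ℝ) / 2 + 1))⁻¹ ≤
      ((m : ℝ) + 1) * (Real.Gamma (((m + 1 : ℕ) : ℝ) / 2 + 1))⁻¹ := by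
    rw [← div_eq_mul_inv, le_div_iff₀ hg2, inv_mul_le_iff₀ hg1, mul_comm]
    exact hg
  calc (m : ℝ) * (√Real.pi ^ m / Real.Gamma ((m : ℝ) / 2 + 1)) =
        m * (√Real.pi ^ m * (Real.Gamma ((m : ℝ) / 2 + 1))⁻¹) := by rw [div_eq_mul_inv]
    _ ≤ ((m + 1 : ℕ) : ℝ) * (√Real.pi ^ (m + 1) *
          (((m : ℝ) + 1) * (Real.Gamma (((m + 1 : ℕ) : ℝ) / 2 + 1))⁻¹)) := by
        gcongr
        · omega
        · omega
    _ = _ := by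
        rw [div_eq_mul_inv]
        ring

/-- A rotation of `ℝⁿ` that turns the functional `v ⬝ᵥ ·` into the first coordinate. -/
lemma exists_rotation {m : ℕ} {v : Fin (m + 1) → ℝ} (hv : sqNorm v = 1) :
    ∃ φ : (Fin (m + 1) → ℝ) → Fin (m + 1) → ℝ, MeasurePreserving φ volume volume ∧
      (∀ x, sqNorm (φ x) = sqNorm x) ∧ ∀ x, φ x 0 = v ⬝ᵥ x := by
  set V : EuclideanSpace ℝ (Fin (m + 1)) := WithLp.toLp 2 v with hV
  set E0 : EuclideanSpace ℝ (Fin (m + 1)) := EuclideanSpace.single 0 1 with hE0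
  have hVn : ‖V‖ = 1 := by
    have h := hv
    rw [sqNorm_eq_norm_sq] at h
    have := norm_nonneg V
    rw [hV] at this ⊢
    nlinarith
  have hEn : ‖E0‖ = 1 := by simp [hE0]
  set ρ := (ℝ ∙ (V - E0))ᗮ.reflection with hρ
  have hρV : ρ V = E0 := Submodule.reflection_sub (by rw [hVn, hEn])
  refine ⟨fun x => WithLp.ofLp (ρ (WithLp.toLp 2 x)), ?_, fun x => ?_, fun x => ?_⟩
  · exact (PiLp.volume_preserving_ofLp _).comp
      (ρ.measurePreserving.comp (PiLp.volume_preserving_toLp _))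
  · rw [sqNorm_eq_norm_sq, sqNorm_eq_norm_sq]
    simp
  · have h1 : inner ℝ V (WithLp.toLp 2 x) = inner ℝ E0 (ρ (WithLp.toLp 2 x)) := by
      rw [← hρV, LinearIsometryEquiv.inner_map_map]
    rw [hE0, EuclideanSpace.inner_single_left] at h1
    simp only [map_one, one_mul] at h1
    refine h1.symm.trans ?_
    rw [hV, EuclideanSpace.inner_toLp_toLp, dotProduct_comm]
    simp

/-- Anti-concentration: away from the origin, the law of a linear functional of a spherical error
has a bounded density. -/
lemma SphericalError.measure_abs_dotProduct_add_le [IsProbabilityMeasure P]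
    (hε : SphericalError P ε f) (hn : 3 ≤ n) {v : Fin n → ℝ} (hv : sqNorm v = 1) {R : ℝ}
    (hR : 0 < R) (a : ℝ) {t : ℝ} (ht : 0 ≤ t) :
    P {ω | |v ⬝ᵥ ε ω + a| ≤ t ∧ R ^ 2 ≤ sqNorm (ε ω)} ≤ ENNReal.ofReal (2 * t * n / R) := by
  -- rotate `v` into the first coordinate axis and integrate over the other coordinates first
  obtain ⟨m, rfl⟩ : ∃ m, n = m + 1 := ⟨n - 1, by omega⟩
  have hfm := hε.measurable_density
  obtain ⟨φ, hφ, hφn, hφv⟩ := exists_rotation hv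
  set G : (Fin (m + 1) → ℝ) → ℝ≥0∞ := fun x =>
    (Set.Icc (-t - a) (t - a)).indicator (fun _ => 1) (x 0) *
      (Set.Ici (R ^ 2)).indicator (fun u => ENNReal.ofReal (f u)) (sqNorm x) with hG
  have hind1 : Measurable ((Set.Icc (-t - a) (t - a)).indicator fun _ : ℝ => (1 : ℝ≥0∞)) :=
    Measurable.indicator (by fun_prop) measurableSet_Icc
  have hind2 : Measurable ((Set.Ici (R ^ 2)).indicator fun u => ENNReal.ofReal (f u)) :=
    Measurable.indicator (by fun_prop) measurableSet_Ici
  have hGm : Measurable G := by fun_prop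
  have hset : MeasurableSet {x : Fin (m + 1) → ℝ | |v ⬝ᵥ x + a| ≤ t ∧ R ^ 2 ≤ sqNorm x} := by
    have hlin : Measurable fun x : Fin (m + 1) → ℝ => |v ⬝ᵥ x + a| := by
      simp only [dotProduct]
      fun_prop
    exact (measurableSet_le hlin measurable_const).inter
      (measurableSet_le measurable_const measurable_sqNorm)
  have h1 : P {ω | |v ⬝ᵥ ε ω + a| ≤ t ∧ R ^ 2 ≤ sqNorm (ε ω)} = ∫⁻ x, G x := by
    have h := hε.lintegral_eq (k := Set.indicator
      {x : Fin (m + 1) → ℝ | |v ⬝ᵥ x + a| ≤ t ∧ R ^ 2 ≤ sqNorm x} fun _ => 1)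
      (measurable_const.indicator hset)
    rw [← hφ.lintegral_comp hGm]
    calc _ = ∫⁻ ω, Set.indicator
          {x : Fin (m + 1) → ℝ | |v ⬝ᵥ x + a| ≤ t ∧ R ^ 2 ≤ sqNorm x} (fun _ => 1) (ε ω) ∂P :=
          (lintegral_indicator_one (hε.measurable hset)).symm
      _ = _ := by
          rw [h]
          refine lintegral_congr fun x => ?_
          simp only [hG, hφn, hφv, Set.indicator_apply, Set.mem_Icc, Set.mem_Ici,
            Set.mem_ofPred_eq]
          have hiff : |v ⬝ᵥ x + a| ≤ t ↔ -t - a ≤ v ⬝ᵥ x ∧ v ⬝ᵥ x ≤ t - a := by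
            rw [abs_le]
            constructor <;> rintro ⟨h1, h2⟩ <;> constructor <;> linarith
          simp only [hiff]
          by_cases hA : -t - a ≤ v ⬝ᵥ x ∧ v ⬝ᵥ x ≤ t - a <;>
            by_cases hB : R ^ 2 ≤ sqNorm x <;> simp [hA, hB]
  have hm2 : 2 ≤ m := by omega
  have h2 : ∫⁻ x, G x = ∫⁻ s : ℝ, (Set.Icc (-t - a) (t - a)).indicator (fun _ => 1) s *
      ∫⁻ z : Fin m → ℝ, (Set.Ici (R ^ 2)).indicator (fun u => ENNReal.ofReal (f u))
        (s ^ 2 + sqNorm z) := by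
    have hmp := (volume_preserving_piFinSuccAbove (fun _ : Fin (m + 1) => ℝ) 0).symm
    rw [← hmp.lintegral_comp hGm, Measure.volume_eq_prod, lintegral_prod _ (by fun_prop)]
    refine lintegral_congr fun s => ?_
    rw [← lintegral_const_mul _ (by fun_prop)]
    refine lintegral_congr fun z => ?_
    simp [hG, sqNorm, Fin.sum_univ_succ, MeasurableEquiv.piFinSuccAbove]
  have hmass := hε.radialMoment_eq (by omega)
  rw [h1, h2]
  calc _ ≤ ∫⁻ s : ℝ, (Set.Icc (-t - a) (t - a)).indicator (fun _ => 1) s *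
        ENNReal.ofReal ((m + 1) / R) := by
        refine lintegral_mono fun s => ?_
        gcongr
        refine (lintegral_density_section_le hm2 hfm hε.density_nonneg hR s).trans ?_
        rw [ENNReal.ofReal_mul (by norm_num), mul_comm (ENNReal.ofReal (1 / 2)), mul_assoc,
          ← mul_assoc, mul_comm (sphereArea m), mul_assoc]
        calc _ ≤ ENNReal.ofReal R⁻¹ * (ENNReal.ofReal (m + 1) * sphereArea (m + 1) *
              (ENNReal.ofReal (1 / 2) * radialMoment f (((m : ℝ) + 1) / 2))) := by
              gcongr
              exact sphereArea_le m (by omega)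
          _ = ENNReal.ofReal R⁻¹ * ENNReal.ofReal (m + 1) := by
              rw [mul_assoc (ENNReal.ofReal (m + 1))]
              push_cast at hmass
              rw [hmass, mul_one]
          _ = _ := by
              rw [← ENNReal.ofReal_mul (by positivity), div_eq_inv_mul]
    _ = _ := by
        rw [lintegral_mul_const _ hind1, lintegral_indicator_const measurableSet_Icc,
          Real.volume_Icc, one_mul, ← ENNReal.ofReal_mul (by linarith)]
        congr 1
        push_cast
        ring

end Spherical

/-! ### Residual sums of squares under the true model -/

section TrueModel

variable {n p : ℕ} {X : Matrix (Fin n) (Fin p) ℝ}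

lemma sqNorm_mulVec_le {ι κ : Type*} [Fintype ι] [Fintype κ] (A : Matrix ι κ ℝ) (w : κ → ℝ) :
    sqNorm (A *ᵥ w) ≤ (∑ i, ∑ j, A i j ^ 2) * sqNorm w := by
  rw [sqNorm, Finset.sum_mul]
  exact Finset.sum_le_sum fun i _ => dotProduct_sq_le (A i) w

lemma exists_le_dotProduct_mulVec {ι : Type*} [Fintype ι] [DecidableEq ι] {C : Matrix ι ι ℝ}
    (hC : C.PosDef) : ∃ l : ℝ, 0 < l ∧ ∀ d, l * sqNorm d ≤ d ⬝ᵥ (C *ᵥ d) := by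
  obtain ⟨B, rfl⟩ := exists_transpose_mul_self_of_posDef hC
  have hdet := hC.det_pos
  rw [Matrix.det_mul, Matrix.det_transpose] at hdet
  have hB : IsUnit B.det := isUnit_iff_ne_zero.2 fun h => by simp [h] at hdet
  set F := ∑ i, ∑ j, B⁻¹ i j ^ 2 with hF
  have hF0 : 0 ≤ F := by positivity
  refine ⟨(F + 1)⁻¹, by positivity, fun d => ?_⟩
  rw [← sqNorm_mulVec, inv_mul_le_iff₀ (by positivity)]
  have h := sqNorm_mulVec_le B⁻¹ (B *ᵥ d)
  rw [Matrix.mulVec_mulVec, Matrix.nonsing_inv_mul _ hB, Matrix.one_mulVec] at h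
  nlinarith [sqNorm_nonneg (B *ᵥ d)]

/-- Convergence of the correlation matrices to a positive definite limit bounds the Gram matrices
from below, uniformly in `n`. -/
lemma exists_le_sqNorm_mulVec {X : ∀ n, Matrix (Fin n) (Fin p) ℝ} {C : Matrix (Fin p) (Fin p) ℝ}
    (hC : C.PosDef)
    (h : Tendsto (fun n : ℕ => (n : ℝ)⁻¹ • ((X n)ᵀ * X n)) atTop (𝓝 C)) :
    ∃ l : ℝ, 0 < l ∧ ∀ᶠ n : ℕ in atTop, ∀ d, l * n * sqNorm d ≤ sqNorm (X n *ᵥ d) := by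
  obtain ⟨l, hl, hlC⟩ := exists_le_dotProduct_mulVec hC
  refine ⟨l / 2, by positivity, ?_⟩
  have hF : Tendsto (fun n : ℕ => ∑ i, ∑ j, (((n : ℝ)⁻¹ • ((X n)ᵀ * X n)) i j - C i j) ^ 2)
      atTop (𝓝 (∑ i, ∑ j, (C i j - C i j) ^ 2)) := by
    refine tendsto_finsetSum _ fun i _ => tendsto_finsetSum _ fun j _ => ?_
    exact (((tendsto_pi_nhds.1 (tendsto_pi_nhds.1 h i) j)).sub_const _).pow 2
  simp only [sub_self, ne_eq, OfNat.ofNat_ne_zero, not_false_eq_true, zero_pow,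
    Finset.sum_const_zero] at hF
  filter_upwards [hF.eventually_lt_const (show 0 < (l / 2) ^ 2 by positivity),
    eventually_gt_atTop 0] with n hn hn0 d
  have hn0' : (0 : ℝ) < n := by exact_mod_cast hn0
  set G := (n : ℝ)⁻¹ • ((X n)ᵀ * X n) with hG
  have h1 : sqNorm (X n *ᵥ d) = n * (d ⬝ᵥ (G *ᵥ d)) := by
    rw [sqNorm_mulVec, hG, Matrix.smul_mulVec, dotProduct_smul, smul_eq_mul,
      mul_inv_cancel_left₀ hn0'.ne']
  have h2 : (d ⬝ᵥ ((G - C) *ᵥ d)) ^ 2 ≤ ((l / 2) * sqNorm d) ^ 2 := by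
    refine (dotProduct_sq_le _ _).trans ?_
    have h3 := sqNorm_mulVec_le (G - C) d
    have h4 := sqNorm_nonneg d
    calc sqNorm d * sqNorm ((G - C) *ᵥ d) ≤ sqNorm d * ((l / 2) ^ 2 * sqNorm d) := by
          gcongr
          refine h3.trans ?_
          gcongr
          exact hn.le
      _ = _ := by ring
  have h5 := (abs_le_of_sq_le_sq' h2 (by have := sqNorm_nonneg d; positivity)).1
  have h6 := hlC d
  rw [Matrix.sub_mulVec, dotProduct_sub] at h5
  rw [h1, mul_comm (l / 2), mul_assoc]
  gcongr
  linarith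

lemma centered_response (hX : StandardizedDesign X) (hn : 0 < n) (T : Finset (Fin p))
    (α σ : ℝ) (β : T → ℝ) (e : Fin n → ℝ) :
    centered (response X T α σ β e) = X *ᵥ extendCoef β + σ • centered e := by
  have hn' : (n : ℝ) ≠ 0 := by positivity
  have hsum : ∑ i, response X T α σ β e i = n * α + σ * ∑ i, e i := by
    simp only [response, Finset.sum_add_distrib, subDesign_mulVec, hX.sum_mulVec,
      ← Finset.mul_sum]
    simp
  ext i
  simp only [centered, hsum, Pi.add_apply, Pi.smul_apply, smul_eq_mul]
  simp only [response, subDesign_mulVec]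
  field_simp
  ring

/-- The residuals of the full model almost surely do not vanish. -/
lemma SphericalError.ae_rss_pos {Ω : Type*} [MeasurableSpace Ω] {P : Measure Ω}
    {ε : Ω → Fin n → ℝ} {f : ℝ → ℝ} (hε : SphericalError P ε f)
    (hX : StandardizedDesign X) (hn : p + 1 < n) (T : Finset (Fin p)) (α : ℝ) {σ : ℝ}
    (hσ : 0 < σ) (β : T → ℝ) :
    ∀ᵐ ω ∂P, 0 < rss X Finset.univ (centered (response X T α σ β (ε ω))) := by
  -- vanishing residuals put the error into the span of the columns and the constant vector
  let L : ((Fin p → ℝ) × ℝ) →ₗ[ℝ] (Fin n → ℝ) :=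
    (Matrix.toLin' X).coprod (LinearMap.toSpanSingleton ℝ (Fin n → ℝ) fun _ => 1)
  have hL : LinearMap.range L ≠ ⊤ := by
    intro hc
    have h1 := LinearMap.finrank_range_le L
    rw [hc, finrank_top] at h1
    simp at h1
    omega
  have hvol : ∀ᵐ x : Fin n → ℝ, x ∉ (LinearMap.range L : Set (Fin n → ℝ)) :=
    measure_eq_zero_iff_ae_notMem.1 (Measure.addHaar_submodule volume _ hL)
  have hmap : ∀ᵐ x ∂(P.map ε), x ∉ (LinearMap.range L : Set (Fin n → ℝ)) := by
    rw [hε.law]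
    exact (withDensity_absolutelyContinuous _ _).ae_le hvol
  filter_upwards [ae_of_ae_map hε.measurable.aemeasurable hmap] with ω hω
  refine lt_of_le_of_ne (rss_nonneg _ _) fun h0 => hω ?_
  obtain ⟨d, -, hd⟩ := exists_rss_eq (X := X) Finset.univ
    (centered (response X T α σ β (ε ω)))
  rw [← h0, centered_response hX (by omega)] at hd
  have hd' := sqNorm_eq_zero.1 hd.symm
  refine ⟨(σ⁻¹ • (d - extendCoef β), (∑ j, ε ω j) / n), ?_⟩
  ext i
  have hi := congrFun hd' i
  simp only [Pi.sub_apply, Pi.add_apply, Pi.smul_apply, smul_eq_mul, centered,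
    Pi.zero_apply] at hi
  simp only [L, LinearMap.coprod_apply, Matrix.toLin'_apply, Matrix.mulVec_smul,
    Matrix.mulVec_sub, LinearMap.toSpanSingleton_apply, Pi.add_apply, Pi.smul_apply,
    Pi.sub_apply, smul_eq_mul, mul_one]
  linear_combination (-σ⁻¹) * hi + (ε ω i - (∑ j, ε ω j) / n) * (inv_mul_cancel₀ hσ.ne')

lemma StandardizedDesign.sum_sq (hX : StandardizedDesign X) (hn : 0 < n) (j : Fin p) :
    ∑ i, X i j ^ 2 = n := by
  have := hX.sum_sq_eq j
  rwa [div_eq_one_iff_eq (by positivity)] at this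

lemma StandardizedDesign.sqNorm_mulVec_le (hX : StandardizedDesign X) (hn : 0 < n)
    (d : Fin p → ℝ) : sqNorm (X *ᵥ d) ≤ n * p * sqNorm d := by
  have h := SSRegression.sqNorm_mulVec_le X d
  rw [Finset.sum_comm] at h
  simpa [hX.sum_sq hn, mul_comm] using h

lemma sqNorm_centered (hn : 0 < n) (e : Fin n → ℝ) :
    sqNorm (centered e) = sqNorm e - (∑ i, e i) ^ 2 / n := by
  have hn' : (n : ℝ) ≠ 0 := by positivity
  set s := ∑ i, e i with hs
  have : ∀ i, centered e i ^ 2 = e i ^ 2 - 2 * (s / n) * e i + (s / n) ^ 2 := fun i => by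
    simp only [centered, ← hs]
    ring
  simp only [sqNorm, this, Finset.sum_add_distrib, Finset.sum_sub_distrib, ← Finset.mul_sum, ← hs]
  simp
  field_simp
  ring

lemma StandardizedDesign.transpose_mulVec_centered (hX : StandardizedDesign X) (e : Fin n → ℝ) :
    Xᵀ *ᵥ centered e = Xᵀ *ᵥ e := by
  ext j
  simp only [Matrix.mulVec, dotProduct, Matrix.transpose_apply, centered, mul_sub,
    Finset.sum_sub_distrib, ← Finset.sum_mul, hX.sum_eq_zero, zero_mul, sub_zero]

/-- The signal `X d` and the noise `σ (e - ē 1)` are nearly orthogonal as soon as the projection of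
the noise on the columns of `X` is bounded. -/
lemma StandardizedDesign.le_sqNorm_signal_add_noise (hX : StandardizedDesign X) (hn : 0 < n)
    {l K σ : ℝ} (hl : 0 < l) (hlX : ∀ d, l * n * sqNorm d ≤ sqNorm (X *ᵥ d))
    {e : Fin n → ℝ} (hK : sqNorm (Xᵀ *ᵥ e) ≤ n * K) (d : Fin p → ℝ) :
    σ ^ 2 * sqNorm (centered e) + l * n / 2 * sqNorm d - 2 * σ ^ 2 * K / l ≤
      sqNorm (X *ᵥ d + σ • centered e) := by
  have hn' : (0 : ℝ) < n := by exact_mod_cast hn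
  set w := Xᵀ *ᵥ e with hw
  have h1 : (X *ᵥ d) ⬝ᵥ centered e = d ⬝ᵥ w := by
    rw [dotProduct_comm, Matrix.dotProduct_mulVec, ← Matrix.mulVec_transpose,
      hX.transpose_mulVec_centered, dotProduct_comm]
  have h2 := sqNorm_nonneg (d + (2 * σ / (l * n)) • w)
  rw [sqNorm_add, sqNorm_smul, dotProduct_smul, smul_eq_mul] at h2
  have h3 : 0 ≤ l * n / 2 * (sqNorm d + 2 * (2 * σ / (l * n) * (d ⬝ᵥ w)) +
      (2 * σ / (l * n)) ^ 2 * sqNorm w) := by positivity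
  have h4 : l * n / 2 * (sqNorm d + 2 * (2 * σ / (l * n) * (d ⬝ᵥ w)) +
      (2 * σ / (l * n)) ^ 2 * sqNorm w) =
      l * n / 2 * sqNorm d + 2 * σ * (d ⬝ᵥ w) + 2 * σ ^ 2 / (l * n) * sqNorm w := by
    field_simp
  have h5 : 2 * σ ^ 2 / (l * n) * sqNorm w ≤ 2 * σ ^ 2 / (l * n) * (n * K) := by gcongr
  have h6 : 2 * σ ^ 2 / (l * n) * (n * K) = 2 * σ ^ 2 * K / l := by field_simp
  rw [sqNorm_add, sqNorm_smul, dotProduct_smul, smul_eq_mul, h1]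
  have := hlX d
  linarith

/-- The explained sum of squares of a model is at least that of each of its predictors. -/
lemma StandardizedDesign.rss_le_sub_dotProduct_sq (hX : StandardizedDesign X) (hn : 0 < n)
    {γ : Finset (Fin p)} {j : Fin p} (hj : j ∈ γ) (v : Fin n → ℝ) :
    rss X γ v ≤ sqNorm v - ((fun i => X i j) ⬝ᵥ v) ^ 2 / n := by
  have hn' : (0 : ℝ) < n := by exact_mod_cast hn
  set t := ((fun i => X i j) ⬝ᵥ v) / n with ht
  have h := hX.rss_le_of_support v (d := Pi.single j t) (γ := γ) fun k hk => by
    have : k ≠ j := fun h => hk (h ▸ hj)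
    simp [this]
  refine h.trans (le_of_eq ?_)
  have h1 : v - X *ᵥ Pi.single j t = v + (-t) • fun i => X i j := by
    ext i
    simp [Matrix.mulVec_single]
    ring
  have h2 : sqNorm (fun i => X i j) = n := hX.sum_sq hn j
  rw [h1, sqNorm_add, sqNorm_smul, h2, dotProduct_smul, smul_eq_mul, dotProduct_comm v,
    show (fun i => X i j) ⬝ᵥ v = n * t by rw [ht]; field_simp]
  field_simp
  ring

/-- The behaviour of the ratios `r γ = 1 - R²_γ` that makes the true model `T` win: they stay away
from `0`, and for the models containing `T` also from `1`; they approach `1` at most polynomially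
fast; adding predictors to `T` decreases them only by a factor `1 + O(1/n)`, while omitting a
predictor of `T` increases them by a factor `1 + δ`. -/
structure Separated (n : ℕ) (r : Finset (Fin p) → ℝ) (T : Finset (Fin p)) (a B δ : ℝ) :
    Prop where
  le : ∀ γ, a ≤ r γ
  le_one : ∀ γ, r γ ≤ 1
  one_sub : ∀ γ : Finset (Fin p), γ.Nonempty → a * ((n : ℝ) ^ 5)⁻¹ ≤ 1 - r γ
  one_sub_of_subset : ∀ γ, T ⊆ γ → a ≤ 1 - r γ
  le_mul_of_subset : ∀ γ, T ⊆ γ → r T ≤ r γ * (1 + B / n)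
  mul_le_of_not_subset : ∀ γ, ¬ T ⊆ γ → r T * (1 + δ) ≤ r γ

/-- Deterministic bounds on the error under which the models are separated. The constants come from
`σ² n / (2 M) ≤ RSS_γ`, from `TSS ≤ n (2 p ‖β‖² + 2 σ² M)`, and from the signal `l n b / 4` of a single
predictor of `T`. -/
lemma StandardizedDesign.separated (hX : StandardizedDesign X) (hn : 0 < n)
    {T : Finset (Fin p)} (hT : T.Nonempty) (α : ℝ) {σ : ℝ} (hσ : 0 < σ) (β : T → ℝ)
    {b : ℝ} (hb0 : 0 < b) (hb : ∀ i, b ≤ β i ^ 2)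
    {l K M : ℝ} (hl : 0 < l) (hM : 0 < M) (hK0 : 0 ≤ K)
    (hlX : ∀ d, l * n * sqNorm d ≤ sqNorm (X *ᵥ d))
    (hn1 : 2 * σ ^ 2 * K / l ≤ l * n * b / 4) (hn2 : K + 2 * K / l ≤ n / (2 * M))
    {e : Fin n → ℝ} (he1 : n / M ≤ sqNorm e) (he2 : sqNorm e ≤ n * M)
    (hXe : sqNorm (Xᵀ *ᵥ e) ≤ n * K) (hse : (∑ i, e i) ^ 2 ≤ n * K)
    (hanti : ∀ j, ((n : ℝ) ^ 2)⁻¹ ≤ |((√n)⁻¹ • fun i => X i j) ⬝ᵥ e +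
      ((√n)⁻¹ • fun i => X i j) ⬝ᵥ (X *ᵥ extendCoef β) / σ|) :
    Separated n (fun γ => 1 - rSquared X (response X T α σ β e) γ) T
      (min (min (σ ^ 2 / (2 * M * (2 * p * sqNorm (extendCoef β) + 2 * σ ^ 2 * M)))
        (l * b / (4 * (2 * p * sqNorm (extendCoef β) + 2 * σ ^ 2 * M))))
        (σ ^ 2 / (2 * p * sqNorm (extendCoef β) + 2 * σ ^ 2 * M)))
      (4 * K * M / l) (l * b / (4 * σ ^ 2 * M)) := by
  have hn' : (0 : ℝ) < n := by exact_mod_cast hn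
  set βx := extendCoef β with hβx
  set D := 2 * p * sqNorm βx + 2 * σ ^ 2 * M with hD
  have hβn := sqNorm_nonneg βx
  have hD0 : 0 < D := by positivity
  set z := centered e with hz
  set S := sqNorm z with hS
  set v := X *ᵥ βx + σ • z with hv
  have hcen : centered (response X T α σ β e) = v := centered_response hX hn T α σ β e
  have hSe : S = sqNorm e - (∑ i, e i) ^ 2 / n := sqNorm_centered hn e
  have hsK : (∑ i, e i) ^ 2 / n ≤ K := by
    rw [div_le_iff₀ hn']
    linarith
  have hS1 : n / (2 * M) + 2 * K / l ≤ S := by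
    have : (n : ℝ) / M = n / (2 * M) + n / (2 * M) := by
      field_simp
      ring
    linarith
  have hS2 : S ≤ n * M := by
    have : 0 ≤ (∑ i, e i) ^ 2 / (n : ℝ) := by positivity
    linarith
  have hmain : ∀ d, σ ^ 2 * S + l * n / 2 * sqNorm d - 2 * σ ^ 2 * K / l ≤
      sqNorm (X *ᵥ d + σ • z) := hX.le_sqNorm_signal_add_noise hn hl hlX hXe
  have hKl : 2 * σ ^ 2 * K / l = σ ^ 2 * (2 * K / l) := by ring
  -- the total sum of squares
  have hTSS1 : sqNorm v ≤ n * D := by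
    have h1 := sqNorm_nonneg (X *ᵥ βx + (-1 : ℝ) • σ • z)
    have h2 := hX.sqNorm_mulVec_le hn βx
    rw [sqNorm_add, dotProduct_smul, sqNorm_smul, sqNorm_smul] at h1
    rw [hv, sqNorm_add, sqNorm_smul]
    simp only [smul_eq_mul] at h1
    have h3 : σ ^ 2 * S ≤ σ ^ 2 * (n * M) := by gcongr
    rw [hD]
    linarith
  have hcoef : ∀ d : Fin p → ℝ, (∃ j ∈ T, d j = 0) → b ≤ sqNorm (βx - d) := by
    rintro d ⟨j, hj, hdj⟩
    refine (hb ⟨j, hj⟩).trans ?_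
    have h1 : (βx - d) j = β ⟨j, hj⟩ := by
      rw [Pi.sub_apply, hdj, sub_zero]
      exact extendCoef_of_mem β ⟨j, hj⟩
    rw [← h1]
    exact Finset.single_le_sum (f := fun i => (βx - d) i ^ 2) (fun i _ => sq_nonneg _)
      (Finset.mem_univ j)
  have hTSS0 : σ ^ 2 * S + l * n * b / 4 ≤ sqNorm v := by
    obtain ⟨j, hj⟩ := hT
    have h1 := hcoef 0 ⟨j, hj, rfl⟩
    rw [sub_zero] at h1
    have h2 := hmain βx
    have h3 : l * n / 2 * b ≤ l * n / 2 * sqNorm βx := by gcongr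
    linarith
  have hS0 : 0 < S := by
    have : 0 < n / (2 * M) + 2 * K / l := by positivity
    linarith
  have hTSSpos : 0 < sqNorm v := by
    have : 0 < σ ^ 2 * S + l * n * b / 4 := by positivity
    linarith
  -- the residual sums of squares
  have hrss : ∀ γ, ∃ d : Fin p → ℝ, (∀ j, j ∉ γ → d j = 0) ∧
      σ ^ 2 * S + l * n / 2 * sqNorm (βx - d) - 2 * σ ^ 2 * K / l ≤ rss X γ v := by
    intro γ
    obtain ⟨d, hd, he⟩ := exists_rss_eq (X := X) γ v
    refine ⟨d, hd, ?_⟩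
    rw [he, show v - X *ᵥ d = X *ᵥ (βx - d) + σ • z by rw [hv, Matrix.mulVec_sub]; abel]
    exact hmain _
  have hrss0 : ∀ γ, σ ^ 2 * S - 2 * σ ^ 2 * K / l ≤ rss X γ v := by
    intro γ
    obtain ⟨d, -, hd⟩ := hrss γ
    have : 0 ≤ l * n / 2 * sqNorm (βx - d) := by
      have := sqNorm_nonneg (βx - d)
      positivity
    linarith
  have hrss1 : ∀ γ, σ ^ 2 * (n / (2 * M)) ≤ rss X γ v := by
    intro γ
    have h1 := hrss0 γ
    have h2 : σ ^ 2 * (n / (2 * M) + 2 * K / l) ≤ σ ^ 2 * S := by gcongr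
    linarith
  have hrssT : rss X T v ≤ σ ^ 2 * S := by
    have h := hX.rss_le_of_support (γ := T) v (d := βx) fun j hj => extendCoef_of_notMem β hj
    rw [show v - X *ᵥ βx = σ • z by rw [hv]; abel, sqNorm_smul] at h
    exact h
  have hr : ∀ γ, 1 - rSquared X (response X T α σ β e) γ = rss X γ v / sqNorm v := by
    intro γ
    rw [one_sub_rSquared, hcen]
  have hone : ∀ γ, 1 - rss X γ v / sqNorm v = (sqNorm v - rss X γ v) / sqNorm v := by
    intro γ
    field_simp
  have hmono : ∀ γ c, 0 ≤ c → c * n ≤ sqNorm v - rss X γ v →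
      c / D ≤ (sqNorm v - rss X γ v) / sqNorm v := by
    intro γ c hc h
    calc c / D = c * n / (n * D) := by field_simp
      _ ≤ c * n / sqNorm v := by gcongr
      _ ≤ _ := by gcongr
  constructor
  · intro γ
    rw [hr]
    refine (min_le_left _ _).trans ((min_le_left _ _).trans ?_)
    calc σ ^ 2 / (2 * M * D) = σ ^ 2 * (n / (2 * M)) / (n * D) := by field_simp
      _ ≤ σ ^ 2 * (n / (2 * M)) / sqNorm v := by gcongr
      _ ≤ _ := by
        gcongr
        exact hrss1 γ
  · intro γ
    rw [hr]
    exact (div_le_one hTSSpos).2 (hX.rss_le_sqNorm γ v)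
  · intro γ hγ
    obtain ⟨j, hj⟩ := hγ
    rw [hr, hone]
    have h1 := hX.rss_le_sub_dotProduct_sq hn hj v
    set x : Fin n → ℝ := fun i => X i j with hx
    have h2 : x ⬝ᵥ v = σ * √n * (((√n)⁻¹ • x) ⬝ᵥ e + ((√n)⁻¹ • x) ⬝ᵥ (X *ᵥ βx) / σ) := by
      have h3 : x ⬝ᵥ z = x ⬝ᵥ e := congrFun (hX.transpose_mulVec_centered e) j
      have h4 : √(n : ℝ) ≠ 0 := (Real.sqrt_pos.2 hn').ne'
      rw [hv, dotProduct_add, dotProduct_smul, h3, smul_dotProduct, smul_dotProduct]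
      simp only [smul_eq_mul]
      field_simp
      ring
    have h3 : (((n : ℝ) ^ 2)⁻¹) ^ 2 ≤ (((√n)⁻¹ • x) ⬝ᵥ e +
        ((√n)⁻¹ • x) ⬝ᵥ (X *ᵥ βx) / σ) ^ 2 := by
      rw [← sq_abs (_ + _)]
      exact pow_le_pow_left₀ (by positivity) (hanti j) 2
    have h5 : (x ⬝ᵥ v) ^ 2 / n = σ ^ 2 * (((√n)⁻¹ • x) ⬝ᵥ e +
        ((√n)⁻¹ • x) ⬝ᵥ (X *ᵥ βx) / σ) ^ 2 := by
      rw [h2, mul_pow, mul_pow, Real.sq_sqrt hn'.le]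
      field_simp
    have h6 := hmono γ (σ ^ 2 * ((n : ℝ) ^ 5)⁻¹) (by positivity) (by
      have h7 : σ ^ 2 * ((n : ℝ) ^ 5)⁻¹ * n = σ ^ 2 * (((n : ℝ) ^ 2)⁻¹) ^ 2 := by field_simp
      have h8 : σ ^ 2 * (((n : ℝ) ^ 2)⁻¹) ^ 2 ≤ (x ⬝ᵥ v) ^ 2 / n := by
        rw [h5]
        gcongr
      linarith)
    refine le_trans ?_ h6
    rw [mul_div_right_comm (σ ^ 2)]
    gcongr
    exact min_le_right _ _
  · intro γ hγ
    rw [hr, hone]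
    refine (min_le_left _ _).trans ((min_le_right _ _).trans ?_)
    have h1 := hX.rss_anti hγ v
    have h2 := hmono γ (l * b / 4) (by positivity) (by linarith)
    rwa [div_div] at h2
  · intro γ hγ
    rw [hr, hr, div_mul_eq_mul_div]
    gcongr
    have h1 := hrss0 γ
    have h2 : 2 * σ ^ 2 * K / l = σ ^ 2 * (n / (2 * M)) * (4 * K * M / l / n) := by
      field_simp
      ring
    have h3 : σ ^ 2 * (n / (2 * M)) * (4 * K * M / l / n) ≤
        rss X γ v * (4 * K * M / l / n) := by
      gcongr
      exact hrss1 γ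
    linarith
  · intro γ hγ
    rw [hr, hr, div_mul_eq_mul_div]
    gcongr
    obtain ⟨j, hjT, hjγ⟩ := Finset.not_subset.1 hγ
    obtain ⟨d, hd, hdr⟩ := hrss γ
    have h1 := hcoef d ⟨j, hjT, hd j hjγ⟩
    have h2 : l * n / 2 * b ≤ l * n / 2 * sqNorm (βx - d) := by gcongr
    have h3 : rss X T v * (l * b / (4 * σ ^ 2 * M)) ≤
        (σ ^ 2 * (n * M)) * (l * b / (4 * σ ^ 2 * M)) := by
      gcongr
      refine hrssT.trans ?_
      gcongr
    have h4 : (σ ^ 2 * (n * M)) * (l * b / (4 * σ ^ 2 * M)) = l * n * b / 4 := by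
      field_simp
    linarith

end TrueModel

/-! ### Separation in probability -/

section Probability

variable {p : ℕ} {Ω : ℕ → Type*} [∀ n, MeasurableSpace (Ω n)] {P : ∀ n, Measure (Ω n)}

lemma SphericalError.measurableSet_sqNorm_mem {n : ℕ} {Ω : Type*} [MeasurableSpace Ω]
    {P : Measure Ω} {ε : Ω → Fin n → ℝ} {f : ℝ → ℝ} (hε : SphericalError P ε f) (M : ℝ) :
    MeasurableSet {ω | M⁻¹ < sqNorm (ε ω) / n ∧ sqNorm (ε ω) / n < M} := by
  have hm : Measurable fun ω => sqNorm (ε ω) / n :=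
    (measurable_sqNorm.comp hε.measurable).div_const _
  exact (measurableSet_lt measurable_const hm).inter (measurableSet_lt hm measurable_const)

/-- The hypotheses on the errors and on the design hold with high probability in the form in which
they separate the models. -/
lemma eventually_separated [∀ n, IsProbabilityMeasure (P n)]
    {X : ∀ n, Matrix (Fin n) (Fin p) ℝ} (hX : ∀ n, p + 1 < n → StandardizedDesign (X n))
    {ε : ∀ n, Ω n → Fin n → ℝ} {f : ℕ → ℝ → ℝ}
    (hε : ∀ n, p + 1 < n → SphericalError (P n) (ε n) (f n))
    {T : Finset (Fin p)} (hT : T.Nonempty) (α : ℝ) {σ : ℝ} (hσ : 0 < σ) {β : T → ℝ}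
    (hβ : ∀ i, β i ≠ 0)
    (hbdd : ∀ c : ℝ, 0 < c → ∃ M : ℝ, 0 < M ∧ ∀ n : ℕ, p + 1 < n →
      1 - c < (P n).real {ω | M⁻¹ < sqNorm (ε n ω) / n ∧ sqNorm (ε n ω) / n < M})
    (hcorr : ∃ C : Matrix (Fin p) (Fin p) ℝ, C.PosDef ∧
      Tendsto (fun n : ℕ => (n : ℝ)⁻¹ • ((X n)ᵀ * X n)) atTop (𝓝 C))
    {c : ℝ} (hc : 0 < c) :
    ∃ a B δ : ℝ, 0 < a ∧ 0 ≤ B ∧ 0 < δ ∧ ∀ᶠ n in atTop,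
      P n {ω | ¬ Separated n (fun γ => 1 - rSquared (X n) (response (X n) T α σ β (ε n ω)) γ)
        T a B δ} ≤ ENNReal.ofReal c := by
  obtain ⟨M, hM, hMP⟩ := hbdd (c / 4) (by positivity)
  obtain ⟨C, hC, hCX⟩ := hcorr
  obtain ⟨l, hl, hlX⟩ := exists_le_sqNorm_mulVec hC hCX
  obtain ⟨b, hb0, hb⟩ : ∃ b : ℝ, 0 < b ∧ ∀ i, b ≤ β i ^ 2 := by
    have : Nonempty T := hT.to_subtype
    obtain ⟨i, hi⟩ := Finite.exists_min fun i => β i ^ 2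
    exact ⟨β i ^ 2, by have := hβ i; positivity, hi⟩
  -- each of the `p + 1` linear functionals exceeds `√(n K')` with probability at most `1 / K'`
  set K' : ℝ := 4 * (p + 1) / c with hK'
  have hK'0 : 0 < K' := by positivity
  set K : ℝ := (p + 1) * K' with hK
  have hK0 : 0 < K := by positivity
  have hKK : K' ≤ K := by
    rw [hK]
    have : (0 : ℝ) ≤ p := by positivity
    nlinarith
  set D := 2 * p * sqNorm (extendCoef β) + 2 * σ ^ 2 * M with hD
  have hD0 : 0 < D := by
    have := sqNorm_nonneg (extendCoef β)
    positivity
  refine ⟨min (min (σ ^ 2 / (2 * M * D)) (l * b / (4 * D))) (σ ^ 2 / D), 4 * K * M / l,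
    l * b / (4 * σ ^ 2 * M), by positivity, by positivity, by positivity, ?_⟩
  have hlim1 : ∀ᶠ n : ℕ in atTop, 2 * σ ^ 2 * K / l ≤ l * n * b / 4 := by
    have : Tendsto (fun n : ℕ => (l * b / 4) * (n : ℝ)) atTop atTop :=
      tendsto_natCast_atTop_atTop.const_mul_atTop (by positivity)
    filter_upwards [this.eventually_ge_atTop (2 * σ ^ 2 * K / l)] with n hn
    linarith
  have hlim2 : ∀ᶠ n : ℕ in atTop, K + 2 * K / l ≤ n / (2 * M) :=
    (tendsto_natCast_atTop_atTop.atTop_div_const (by positivity)).eventually_ge_atTop _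
  have hlim3 : ∀ᶠ n : ℕ in atTop, (p : ℝ) * (2 / √(n / M)) ≤ c / 4 := by
    have h1 : Tendsto (fun n : ℕ => √((n : ℝ) / M)) atTop atTop :=
      Real.tendsto_sqrt_atTop.comp (tendsto_natCast_atTop_atTop.atTop_div_const hM)
    have h2 : Tendsto (fun n : ℕ => (p : ℝ) * (2 / √((n : ℝ) / M))) atTop (𝓝 ((p : ℝ) * 0)) :=
      (h1.const_div_atTop 2).const_mul _
    rw [mul_zero] at h2
    exact h2.eventually_le_const (by positivity)
  filter_upwards [hlX, hlim1, hlim2, hlim3, eventually_gt_atTop (p + 2)]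
    with n hlXn hn1 hn2 hn3 hnp
  have hn0 : 0 < n := by omega
  have hn' : (0 : ℝ) < n := by exact_mod_cast hn0
  have hXn := hX n (by omega)
  have hεn := hε n (by omega)
  -- the norm of the error is of order `√n`
  set Good : Set (Ω n) := {ω | M⁻¹ < sqNorm (ε n ω) / n ∧ sqNorm (ε n ω) / n < M} with hGood
  -- the component along a predictor, or along the constant vector, is large
  set Lin : Option (Fin p) → Set (Ω n) := fun j =>
    {ω | n * K' ≤ ((j.elim (fun _ => 1) fun j i => X n i j : Fin n → ℝ) ⬝ᵥ ε n ω) ^ 2} with hLin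
  -- the component of the response along a predictor nearly vanishes
  set Small : Fin p → Set (Ω n) := fun j =>
    {ω | |((√n)⁻¹ • fun i => X n i j) ⬝ᵥ ε n ω +
      ((√n)⁻¹ • fun i => X n i j) ⬝ᵥ (X n *ᵥ extendCoef β) / σ| ≤ ((n : ℝ) ^ 2)⁻¹ ∧
      √((n : ℝ) / M) ^ 2 ≤ sqNorm (ε n ω)} with hSmall
  have hsub : {ω | ¬ Separated n
      (fun γ => 1 - rSquared (X n) (response (X n) T α σ β (ε n ω)) γ) T
      (min (min (σ ^ 2 / (2 * M * D)) (l * b / (4 * D))) (σ ^ 2 / D)) (4 * K * M / l)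
      (l * b / (4 * σ ^ 2 * M))} ⊆ Goodᶜ ∪ ((⋃ j, Lin j) ∪ ⋃ j, Small j) := by
    intro ω hω
    by_contra hcon
    simp only [Set.mem_union, Set.mem_compl_iff, Set.mem_iUnion, not_or, not_not, not_exists]
      at hcon
    obtain ⟨⟨h1, h1'⟩, h2, h3⟩ := hcon
    have he1 : n / M ≤ sqNorm (ε n ω) := by
      rw [lt_div_iff₀ hn', inv_mul_eq_div] at h1
      exact h1.le
    have he2 : sqNorm (ε n ω) ≤ n * M := by
      rw [div_lt_iff₀ hn'] at h1'
      linarith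
    have h2' : ∀ j : Option (Fin p),
        ((j.elim (fun _ => 1) fun j i => X n i j : Fin n → ℝ) ⬝ᵥ ε n ω) ^ 2 ≤ n * K' :=
      fun j => (not_le.1 (h2 j)).le
    refine hω (hXn.separated hn0 hT α hσ β hb0 hb hl hM hK0.le hlXn hn1 hn2 he1 he2 ?_ ?_ ?_)
    · calc sqNorm ((X n)ᵀ *ᵥ ε n ω) ≤ ∑ _j : Fin p, n * K' :=
            Finset.sum_le_sum fun j _ => h2' (some j)
        _ = n * (p * K') := by
            simp
            ring
        _ ≤ n * K := by
            rw [hK]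
            gcongr
            linarith
    · have h := h2' none
      simp only [Option.elim_none, dotProduct, one_mul] at h
      refine h.trans ?_
      gcongr
    · intro j
      by_contra hj
      refine h3 j ⟨(not_le.1 hj).le, ?_⟩
      rwa [Real.sq_sqrt (by positivity)]
  have hm1 : P n Goodᶜ ≤ ENNReal.ofReal (c / 4) := by
    have h := hMP n (by omega)
    have h1 := probReal_compl_eq_one_sub (μ := P n) (hεn.measurableSet_sqNorm_mem M)
    rw [← ofReal_measureReal]
    refine ENNReal.ofReal_le_ofReal ?_
    rw [hGood, h1]
    linarith
  have hm2 : P n (⋃ j, Lin j) ≤ ENNReal.ofReal (c / 2) := by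
    refine (measure_iUnion_fintype_le _ _).trans ?_
    calc ∑ j, P n (Lin j) ≤ ∑ _j : Option (Fin p), ENNReal.ofReal (1 / K') := by
          refine Finset.sum_le_sum fun j _ => ?_
          refine (hεn.measure_dotProduct_sq_ge _ (by positivity)).trans ?_
          refine ENNReal.ofReal_le_ofReal (le_of_eq ?_)
          have hcol : sqNorm (j.elim (fun _ => 1) fun j i => X n i j : Fin n → ℝ) = n := by
            cases j with
            | none => simp [sqNorm]
            | some j => exact hXn.sum_sq hn0 j
          rw [hcol]
          field_simp
      _ = ENNReal.ofReal ((p + 1) * (1 / K')) := by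
          rw [Finset.sum_const, Finset.card_univ, Fintype.card_option, Fintype.card_fin,
            nsmul_eq_mul, ENNReal.ofReal_mul (by positivity)]
          congr 1
          rw [← ENNReal.ofReal_natCast]
          push_cast
          rfl
      _ ≤ _ := by
          refine ENNReal.ofReal_le_ofReal ?_
          rw [hK']
          field_simp
          norm_num
  have hm3 : P n (⋃ j, Small j) ≤ ENNReal.ofReal (c / 4) := by
    refine (measure_iUnion_fintype_le _ _).trans ?_
    calc ∑ j, P n (Small j) ≤ ∑ _j : Fin p, ENNReal.ofReal (2 / √((n : ℝ) / M)) := by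
          refine Finset.sum_le_sum fun j _ => ?_
          have hunit : sqNorm ((√(n : ℝ))⁻¹ • fun i => X n i j) = 1 := by
            have h2 : sqNorm (fun i => X n i j) = n := hXn.sum_sq hn0 j
            rw [sqNorm_smul, h2, inv_pow, Real.sq_sqrt hn'.le, inv_mul_cancel₀ hn'.ne']
          refine (hεn.measure_abs_dotProduct_add_le (by omega) hunit
            (Real.sqrt_pos.2 (by positivity)) _ (by positivity)).trans ?_
          refine ENNReal.ofReal_le_ofReal ?_
          gcongr
          have h1 : (1 : ℝ) ≤ n := by exact_mod_cast hn0
          calc 2 * ((n : ℝ) ^ 2)⁻¹ * n = 2 * (n : ℝ)⁻¹ := by field_simp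
            _ ≤ 2 * 1 := by
                gcongr
                exact inv_le_one_of_one_le₀ h1
            _ = 2 := by norm_num
      _ = ENNReal.ofReal (p * (2 / √((n : ℝ) / M))) := by
          rw [Finset.sum_const, Finset.card_univ, Fintype.card_fin, nsmul_eq_mul,
            ENNReal.ofReal_mul (by positivity), ENNReal.ofReal_natCast]
      _ ≤ _ := ENNReal.ofReal_le_ofReal hn3
  calc _ ≤ P n (Goodᶜ ∪ ((⋃ j, Lin j) ∪ ⋃ j, Small j)) := measure_mono hsub
    _ ≤ P n Goodᶜ + (P n (⋃ j, Lin j) + P n (⋃ j, Small j)) :=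
        (measure_union_le _ _).trans (add_le_add_right (measure_union_le _ _) _)
    _ ≤ ENNReal.ofReal (c / 4) + (ENNReal.ofReal (c / 2) + ENNReal.ofReal (c / 4)) := by
        gcongr
    _ = ENNReal.ofReal c := by
        rw [← ENNReal.ofReal_add (by positivity) (by positivity),
          ← ENNReal.ofReal_add (by positivity) (by positivity)]
        congr 1
        ring

/-- Bayes factors that make the true model dominate each of the other models are model selection
consistent. -/
lemma consistent_of_ratio {T : Finset (Fin p)} {BF : ∀ n, Ω n → Finset (Fin p) → ℝ}
    (h : ∀ τ : ℝ, 0 < τ → ∀ c : ℝ, 0 < c → ∀ᶠ n in atTop,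
      P n {ω | ¬ (0 < BF n ω T ∧ ∀ γ : Finset (Fin p), γ.Nonempty → γ ≠ T →
        0 ≤ BF n ω γ ∧ BF n ω γ ≤ τ * BF n ω T)} ≤ ENNReal.ofReal c) :
    Consistent P T BF := by
  intro w hw hw1 hw0 hwT δ hδ
  rw [ENNReal.tendsto_nhds_zero]
  intro c hc
  obtain ⟨c', hc'0, hc'⟩ : ∃ c' : ℝ, 0 < c' ∧ ENNReal.ofReal c' ≤ c := by
    rcases eq_or_ne c ∞ with rfl | hcT
    · exact ⟨1, one_pos, le_top⟩
    · exact ⟨c.toReal, ENNReal.toReal_pos hc.ne' hcT, ENNReal.ofReal_toReal_le⟩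
  filter_upwards [h (δ * w T / 2) (by positivity) c' hc'0] with n hn
  refine (measure_mono fun ω hω => ?_).trans (hn.trans hc')
  rintro ⟨hT, hγ⟩
  refine absurd (show δ ≤ |posterior w (BF n ω) T - 1| from hω) (not_le.2 ?_)
  have hsum : ∑ γ, w γ * BF n ω γ =
      w T * BF n ω T + ∑ γ ∈ Finset.univ.erase T, w γ * BF n ω γ :=
    (Finset.add_sum_erase _ _ (Finset.mem_univ T)).symm
  have hterm : ∀ γ ∈ Finset.univ.erase T, 0 ≤ w γ * BF n ω γ ∧
      w γ * BF n ω γ ≤ w γ * (δ * w T / 2 * BF n ω T) := by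
    intro γ hγT
    rcases γ.eq_empty_or_nonempty with rfl | hne
    · simp [hw0]
    · obtain ⟨h1, h2⟩ := hγ γ hne (Finset.ne_of_mem_erase hγT)
      exact ⟨mul_nonneg (hw γ) h1, mul_le_mul_of_nonneg_left h2 (hw γ)⟩
  set S := ∑ γ ∈ Finset.univ.erase T, w γ * BF n ω γ with hS
  have hS0 : 0 ≤ S := Finset.sum_nonneg fun γ hγ => (hterm γ hγ).1
  have hS1 : S ≤ δ * w T / 2 * BF n ω T := by
    calc S ≤ ∑ γ ∈ Finset.univ.erase T, w γ * (δ * w T / 2 * BF n ω T) :=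
          Finset.sum_le_sum fun γ hγ => (hterm γ hγ).2
      _ ≤ ∑ γ, w γ * (δ * w T / 2 * BF n ω T) :=
          Finset.sum_le_sum_of_subset_of_nonneg (Finset.erase_subset _ _)
            fun γ _ _ => mul_nonneg (hw γ) (by positivity)
      _ = _ := by rw [← Finset.sum_mul, hw1, one_mul]
  have hpos : 0 < w T * BF n ω T := by positivity
  rw [posterior, hsum, show w T * BF n ω T / (w T * BF n ω T + S) - 1 =
    -(S / (w T * BF n ω T + S)) by field_simp; ring, abs_neg, abs_of_nonneg (by positivity),
    div_lt_iff₀ (by positivity)]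
  nlinarith

end Probability

/-! ### Domination of the true model -/

section Domination

variable {p : ℕ}

lemma tendsto_rpow_mul_one_add_rpow_neg (s : ℝ) {δ : ℝ} (hδ : 0 < δ) :
    Tendsto (fun x : ℝ => x ^ s * (1 + δ) ^ (-x)) atTop (𝓝 0) := by
  have h := tendsto_rpow_mul_exp_neg_mul_atTop_nhds_zero s (Real.log (1 + δ))
    (Real.log_pos (by linarith))
  refine h.congr fun x => ?_
  rw [Real.rpow_def_of_pos (show 0 < 1 + δ by linarith)]
  congr 2
  ring

lemma Separated.pos {n : ℕ} {r : Finset (Fin p) → ℝ} {T : Finset (Fin p)} {a B δ : ℝ}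
    (h : Separated n r T a B δ) (ha : 0 < a) (γ : Finset (Fin p)) : 0 < r γ :=
  ha.trans_le (h.le γ)

/-- Adding predictors to the true model gains at most a bounded factor in the likelihood. -/
lemma Separated.rpow_neg_le_of_subset {n : ℕ} {r : Finset (Fin p) → ℝ} {T γ : Finset (Fin p)}
    {a B δ N : ℝ} (h : Separated n r T a B δ) (ha : 0 < a) (hB : 0 ≤ B) (hn : 0 < n)
    (hN : 0 ≤ N) (hNn : N ≤ n) (hγ : T ⊆ γ) :
    r γ ^ (-N) ≤ Real.exp B * r T ^ (-N) := by
  have h1 := h.pos ha γ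
  have h2 := h.pos ha T
  have hn' : (0 : ℝ) < n := by exact_mod_cast hn
  have h3 : r T ^ N ≤ r γ ^ N * Real.exp B := by
    calc r T ^ N ≤ (r γ * Real.exp (B / n)) ^ N := by
          refine Real.rpow_le_rpow h2.le ((h.le_mul_of_subset γ hγ).trans ?_) hN
          gcongr
          linarith [Real.add_one_le_exp (B / n)]
      _ = r γ ^ N * Real.exp (B / n * N) := by
          rw [Real.mul_rpow h1.le (Real.exp_pos _).le, ← Real.exp_mul]
      _ ≤ _ := by
          gcongr
          rw [div_mul_eq_mul_div, div_le_iff₀ hn']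
          gcongr
  rw [Real.rpow_neg h1.le, Real.rpow_neg h2.le, ← div_eq_mul_inv, le_div_iff₀ (by positivity),
    inv_mul_le_iff₀ (by positivity)]
  exact h3

/-- Omitting a predictor of the true model loses an exponential factor in the likelihood. -/
lemma Separated.rpow_neg_le_of_not_subset {n : ℕ} {r : Finset (Fin p) → ℝ}
    {T γ : Finset (Fin p)} {a B δ N : ℝ} (h : Separated n r T a B δ) (ha : 0 < a) (hδ : 0 < δ)
    (hN : 0 ≤ N) (hγ : ¬ T ⊆ γ) :
    r γ ^ (-N) ≤ (1 + δ) ^ (-N) * r T ^ (-N) := by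
  have h2 := h.pos ha T
  rw [← Real.mul_rpow (by positivity) h2.le, mul_comm]
  exact Real.rpow_le_rpow_of_nonpos (by positivity) (h.mul_le_of_not_subset γ hγ) (by linarith)

/-- The integral over `g` of the true model dominates that of each of the other models. -/
lemma eventually_gIntegral_le {T : Finset (Fin p)} (hT : T.Nonempty) {ν k : ℝ} (hνk : 0 < ν + k)
    (hν : ν < 1) {a B δ : ℝ} (ha : 0 < a) (hB : 0 ≤ B) (hδ : 0 < δ) {τ : ℝ} (hτ : 0 < τ)
    {γ : Finset (Fin p)} (hγ : γ.Nonempty) (hγT : γ ≠ T) :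
    ∀ᶠ n : ℕ in atTop, ∀ R : Finset (Fin p) → ℝ,
      Separated n (fun γ => 1 - R γ) T a B δ →
      gIntegral n γ.card ν k (R γ) ≤ τ * gIntegral n T.card ν k (R T) := by
  have hqT : ν < T.card := hν.trans_le (by exact_mod_cast hT.card_pos)
  have hqγ : ν < γ.card := hν.trans_le (by exact_mod_cast hγ.card_pos)
  have hNlim : Tendsto (fun n : ℕ => ((n : ℝ) - 1) / 2) atTop atTop :=
    (tendsto_atTop_add_const_right _ (-1) tendsto_natCast_atTop_atTop).atTop_div_const two_pos
  set L : ℝ := Real.exp (-a⁻¹) *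
    (2⁻¹ * (3 : ℝ) ^ (-((T.card - ν) / 2)) * (2⁻¹) ^ ((ν + k) / 2)) with hL
  have hL0 : 0 < L := by positivity
  have hlower : ∀ n : ℕ, 3 ≤ n → ∀ R : Finset (Fin p) → ℝ,
      Separated n (fun γ => 1 - R γ) T a B δ →
      (1 - R T) ^ (-(((n : ℝ) - 1) / 2)) * (((n : ℝ) - 1) / 2) ^ (-((T.card - ν) / 2)) * L ≤
        gIntegral n T.card ν k (R T) := by
    intro n hn R hR
    have h1 := hR.pos ha T
    have h2 := hR.le T
    have h3 := hR.le_one T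
    refine le_trans ?_ (le_gIntegral hn hνk hqT (by linarith) (by linarith))
    have hn' : (3 : ℝ) ≤ n := by exact_mod_cast hn
    have : 0 ≤ ((n : ℝ) - 1) / 2 := by linarith
    rw [hL]
    gcongr
  by_cases hsub : T ⊆ γ
  · have hcard : (T.card : ℝ) + 1 ≤ γ.card := by
      exact_mod_cast Finset.card_lt_card (hsub.ssubset_of_ne hγT.symm)
    -- an exponent strictly below the critical `(q_γ - ν) / 2`, but above that of `T`
    set m : ℝ := (γ.card - ν) / 2 - 1 / 4 with hm
    have hm0 : 0 < m := by linarith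
    set U : ℝ := m ^ m * a ^ (-m) * betaPrimeMass ((ν + k) / 2) ((γ.card - ν) / 2 - m) with hU
    have hU0 : 0 ≤ U := by
      have := betaPrimeMass_nonneg ((ν + k) / 2) ((γ.card - ν) / 2 - m)
      positivity
    have hlim : Tendsto (fun n : ℕ => Real.exp B * U * (((n : ℝ) - 1) / 2) ^ (-(1 / 4) : ℝ)) atTop
        (𝓝 (Real.exp B * U * 0)) :=
      ((tendsto_rpow_neg_atTop (by norm_num)).comp hNlim).const_mul _
    rw [mul_zero] at hlim
    filter_upwards [hlim.eventually_le_const (show 0 < τ * L by positivity),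
      eventually_ge_atTop 3] with n hn hn3 R hR
    have hn' : (3 : ℝ) ≤ n := by exact_mod_cast hn3
    set N := ((n : ℝ) - 1) / 2 with hN
    have hN1 : 1 ≤ N := by linarith
    have hγ1 := hR.one_sub_of_subset γ hsub
    have hγ0 := hR.pos ha γ
    have hT0 := hR.pos ha T
    have h1 := gIntegral_le_of_lt (n := n) (q := γ.card) (R2 := R γ) (by omega) hνk hm0
      (by linarith) ha (by linarith) (by linarith)
    have h2 := hR.rpow_neg_le_of_subset (N := N) ha hB (by omega) (by linarith)
      (by linarith) hsub
    have h3 : N ^ (-m) ≤ N ^ (-(1 / 4) : ℝ) * N ^ (-((T.card - ν) / 2)) := by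
      rw [← Real.rpow_add (by linarith)]
      exact Real.rpow_le_rpow_of_exponent_le hN1 (by linarith)
    rw [← hN, ← hU] at h1
    calc _ ≤ (1 - R γ) ^ (-N) * N ^ (-m) * U := h1
      _ ≤ (Real.exp B * (1 - R T) ^ (-N)) *
            (N ^ (-(1 / 4) : ℝ) * N ^ (-((T.card - ν) / 2))) * U := by
          gcongr
      _ = (Real.exp B * U * N ^ (-(1 / 4) : ℝ)) *
            ((1 - R T) ^ (-N) * N ^ (-((T.card - ν) / 2))) := by ring
      _ ≤ (τ * L) * ((1 - R T) ^ (-N) * N ^ (-((T.card - ν) / 2))) := by gcongr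
      _ = τ * ((1 - R T) ^ (-N) * N ^ (-((T.card - ν) / 2)) * L) := by ring
      _ ≤ _ := by
          gcongr
          exact hlower n hn3 R hR
  · set U : ℝ := betaPrimeMass ((ν + k) / 2) ((γ.card - ν) / 2) with hU
    have hU0 : 0 ≤ U := betaPrimeMass_nonneg _ _
    have hlim : Tendsto (fun n : ℕ => U * ((((n : ℝ) - 1) / 2) ^ (((T.card : ℝ) - ν) / 2) *
        (1 + δ) ^ (-(((n : ℝ) - 1) / 2)))) atTop (𝓝 (U * 0)) :=
      ((tendsto_rpow_mul_one_add_rpow_neg _ hδ).comp hNlim).const_mul _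
    rw [mul_zero] at hlim
    filter_upwards [hlim.eventually_le_const (show 0 < τ * L by positivity),
      eventually_ge_atTop 3] with n hn hn3 R hR
    have hn' : (3 : ℝ) ≤ n := by exact_mod_cast hn3
    set N := ((n : ℝ) - 1) / 2 with hN
    have hN1 : 1 ≤ N := by linarith
    have hγ1 := hR.le_one γ
    have hγ0 := hR.pos ha γ
    have hT0 := hR.pos ha T
    have h1 := gIntegral_le (n := n) (q := γ.card) (R2 := R γ) (by omega) hνk hqγ
      (by linarith) (by linarith)
    have h2 := hR.rpow_neg_le_of_not_subset (N := N) ha hδ (by linarith) hsub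
    have h3 : N ^ ((T.card - ν) / 2) * N ^ (-((T.card - ν) / 2)) = 1 := by
      rw [← Real.rpow_add (by linarith), add_neg_cancel, Real.rpow_zero]
    rw [← hN, ← hU] at h1
    calc _ ≤ (1 - R γ) ^ (-N) * U := h1
      _ ≤ ((1 + δ) ^ (-N) * (1 - R T) ^ (-N)) * U := by gcongr
      _ = (U * (N ^ ((T.card - ν) / 2) * (1 + δ) ^ (-N))) *
            ((1 - R T) ^ (-N) * N ^ (-((T.card - ν) / 2))) := by
          linear_combination (-(U * (1 + δ) ^ (-N) * (1 - R T) ^ (-N))) * h3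
      _ ≤ (τ * L) * ((1 - R T) ^ (-N) * N ^ (-((T.card - ν) / 2))) := by gcongr
      _ = τ * ((1 - R T) ^ (-N) * N ^ (-((T.card - ν) / 2)) * L) := by ring
      _ ≤ _ := by
          gcongr
          exact hlower n hn3 R hR

lemma phi_pos {s r : ℝ} (hs : 0 < s) (hr : 0 < r) (hr1 : r < 1) : 0 < phi s r := by
  have h1 : 0 < 1 / r - 1 := by
    rw [sub_pos, lt_div_iff₀ hr]
    linarith
  unfold phi
  positivity

lemma phi_le {s r κ : ℝ} (hs : 0 < s) (hr : 0 < r) (hκ : 0 < κ) (hrκ : κ ≤ 1 - r) :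
    phi s r ≤ s ^ (s - 1) * (κ * Real.exp 1) ^ (-s) := by
  have h1 : κ ≤ 1 / r - 1 := by
    refine hrκ.trans ?_
    rw [show 1 / r - 1 = (1 - r) / r by field_simp, le_div_iff₀ hr]
    nlinarith
  unfold phi
  have h2 : (κ * Real.exp 1) ^ (-s) ≥ ((1 / r - 1) * Real.exp 1) ^ (-s) :=
    Real.rpow_le_rpow_of_nonpos (by positivity) (by gcongr) (by linarith)
  have h3 : r * s ^ (s - 1) ≤ s ^ (s - 1) := mul_le_of_le_one_left (by positivity) (by linarith)
  have h4 : 0 < 1 / r - 1 := by linarith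
  gcongr

lemma le_phi {s r a : ℝ} (hs : 0 < s) (ha : 0 < a) (hra : a ≤ r) (hr1 : r < 1) :
    a * s ^ (s - 1) * (1 / a * Real.exp 1) ^ (-s) ≤ phi s r := by
  have hr : 0 < r := by linarith
  have h0 : 0 < 1 / r - 1 := by
    rw [sub_pos, lt_div_iff₀ hr]
    linarith
  have h1 : 1 / r - 1 ≤ 1 / a := by
    have := one_div_le_one_div_of_le ha hra
    linarith
  unfold phi
  have h2 : ((1 / r - 1) * Real.exp 1) ^ (-s) ≥ (1 / a * Real.exp 1) ^ (-s) :=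
    Real.rpow_le_rpow_of_nonpos (by positivity) (by gcongr) (by linarith)
  gcongr

/-- The square of the approximate Bayes factor of a model with `q` predictors, up to a factor that
does not depend on the model. -/
def approxWeight (ν : ℝ) (n q : ℕ) (r : ℝ) : ℝ :=
  phi (q - ν) r * (r ^ (-(n : ℤ)) * (n : ℝ) ^ (-(q : ℤ)))

lemma approxWeight_pos {ν r : ℝ} {n q : ℕ} (hn : 0 < n) (hq : ν < q) (hr : 0 < r) (hr1 : r < 1) :
    0 < approxWeight ν n q r := by
  have := phi_pos (s := q - ν) (by linarith) hr hr1
  unfold approxWeight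
  positivity

lemma bfApprox_eq {n : ℕ} {ν : ℝ} (hν : ν < p) {X : Matrix (Fin n) (Fin p) ℝ}
    {y : Fin n → ℝ} {γ : Finset (Fin p)} (hγ : ν < γ.card)
    (h0 : ∀ γ, 0 < 1 - rSquared X y γ)
    (h1 : 1 - rSquared X y γ < 1) (h1F : 1 - rSquared X y Finset.univ < 1) :
    bfApprox ν X y γ = √(approxWeight ν n γ.card (1 - rSquared X y γ) /
      approxWeight ν n p (1 - rSquared X y Finset.univ)) := by
  have hφ := phi_pos (s := γ.card - ν) (by linarith) (h0 γ) h1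
  have hφF := phi_pos (s := p - ν) (by linarith) (h0 Finset.univ) h1F
  rw [bfApprox, bfBIC, ← Real.sqrt_mul (by positivity), approxWeight, approxWeight,
    mul_div_mul_comm (phi _ _)]

/-- The approximate Bayes factor of the true model dominates that of each of the other models. -/
lemma eventually_approxWeight_le {T : Finset (Fin p)} (hT : T.Nonempty) {ν : ℝ} (hν : ν < 1)
    {a B δ : ℝ} (ha : 0 < a) (hB : 0 ≤ B) (hδ : 0 < δ) {τ : ℝ} (hτ : 0 < τ)
    {γ : Finset (Fin p)} (hγ : γ.Nonempty) (hγT : γ ≠ T) :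
    ∀ᶠ n : ℕ in atTop, ∀ r : Finset (Fin p) → ℝ, Separated n r T a B δ →
      approxWeight ν n γ.card (r γ) ≤ τ * approxWeight ν n T.card (r T) := by
  have hqT : ν < T.card := hν.trans_le (by exact_mod_cast hT.card_pos)
  have hqγ : ν < γ.card := hν.trans_le (by exact_mod_cast hγ.card_pos)
  set sT : ℝ := T.card - ν with hsT
  set s : ℝ := γ.card - ν with hs
  have hsT0 : 0 < sT := by linarith
  have hs0 : 0 < s := by linarith
  set L : ℝ := a * sT ^ (sT - 1) * (1 / a * Real.exp 1) ^ (-sT) with hL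
  have hL0 : 0 < L := by positivity
  set U : ℝ := s ^ (s - 1) * (a * Real.exp 1) ^ (-s) with hU
  have hU0 : 0 < U := by positivity
  have hcast : ∀ (x : ℝ) (m : ℕ), 0 < x → x ^ (-(m : ℤ)) = x ^ (-(m : ℝ)) := by
    intro x m hx
    rw [← Real.rpow_intCast]
    push_cast
    rfl
  have hlower : ∀ n : ℕ, 0 < n → ∀ r : Finset (Fin p) → ℝ, Separated n r T a B δ →
      L * (r T ^ (-(n : ℝ)) * (n : ℝ) ^ (-(T.card : ℝ))) ≤ approxWeight ν n T.card (r T) := by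
    intro n hn r hr
    have h1 := hr.pos ha T
    have h2 := hr.one_sub_of_subset T subset_rfl
    rw [approxWeight, hcast _ _ h1, hcast _ _ (by exact_mod_cast hn), ← hsT]
    gcongr
    exact le_phi hsT0 ha (hr.le T) (by linarith)
  by_cases hsub : T ⊆ γ
  · have hcard : (T.card : ℝ) + 1 ≤ γ.card := by
      exact_mod_cast Finset.card_lt_card (hsub.ssubset_of_ne hγT.symm)
    have hlim : Tendsto (fun n : ℕ => Real.exp B * U * ((n : ℝ) ^ (-1 : ℝ))) atTop
        (𝓝 (Real.exp B * U * 0)) :=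
      ((tendsto_rpow_neg_atTop one_pos).comp tendsto_natCast_atTop_atTop).const_mul _
    rw [mul_zero] at hlim
    filter_upwards [hlim.eventually_le_const (show 0 < τ * L by positivity),
      eventually_ge_atTop 1] with n hn hn1 r hr
    have hn' : (1 : ℝ) ≤ n := by exact_mod_cast hn1
    have hγ0 := hr.pos ha γ
    have hT0 := hr.pos ha T
    have h1 : phi s (r γ) ≤ U := phi_le hs0 hγ0 ha (hr.one_sub_of_subset γ hsub)
    have h2 := hr.rpow_neg_le_of_subset (N := n) ha hB (by omega) (by linarith) le_rfl hsub
    have h3 : (n : ℝ) ^ (-(γ.card : ℝ)) ≤ (n : ℝ) ^ (-1 : ℝ) * (n : ℝ) ^ (-(T.card : ℝ)) := by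
      rw [← Real.rpow_add (by linarith)]
      exact Real.rpow_le_rpow_of_exponent_le hn' (by linarith)
    calc approxWeight ν n γ.card (r γ) =
          phi s (r γ) * (r γ ^ (-(n : ℝ)) * (n : ℝ) ^ (-(γ.card : ℝ))) := by
          rw [approxWeight, hcast _ _ hγ0, hcast _ _ (by linarith), ← hs]
      _ ≤ U * ((Real.exp B * r T ^ (-(n : ℝ))) *
            ((n : ℝ) ^ (-1 : ℝ) * (n : ℝ) ^ (-(T.card : ℝ)))) := by gcongr
      _ = (Real.exp B * U * ((n : ℝ) ^ (-1 : ℝ))) *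
            (r T ^ (-(n : ℝ)) * (n : ℝ) ^ (-(T.card : ℝ))) := by ring
      _ ≤ (τ * L) * (r T ^ (-(n : ℝ)) * (n : ℝ) ^ (-(T.card : ℝ))) := by gcongr
      _ = τ * (L * (r T ^ (-(n : ℝ)) * (n : ℝ) ^ (-(T.card : ℝ)))) := by ring
      _ ≤ _ := by
          gcongr
          exact hlower n (by omega) r hr
  · have hlim : Tendsto (fun n : ℕ => U * ((n : ℝ) ^ (5 * s + T.card) * (1 + δ) ^ (-(n : ℝ))))
        atTop (𝓝 (U * 0)) :=
      ((tendsto_rpow_mul_one_add_rpow_neg _ hδ).comp tendsto_natCast_atTop_atTop).const_mul _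
    rw [mul_zero] at hlim
    filter_upwards [hlim.eventually_le_const (show 0 < τ * L by positivity),
      eventually_ge_atTop 1] with n hn hn1 r hr
    have hn' : (1 : ℝ) ≤ n := by exact_mod_cast hn1
    have hn0 : (0 : ℝ) < n := by linarith
    have hγ0 := hr.pos ha γ
    have hT0 := hr.pos ha T
    -- `R²_γ` may tend to `0`, which costs a power of `n`
    have h1 : phi s (r γ) ≤ U * (n : ℝ) ^ (5 * s) := by
      refine (phi_le hs0 hγ0 (by positivity) (hr.one_sub γ hγ)).trans (le_of_eq ?_)
      rw [hU, mul_right_comm a, Real.mul_rpow (by positivity) (by positivity),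
        Real.inv_rpow (by positivity), ← Real.rpow_neg (by positivity), neg_neg,
        ← Real.rpow_natCast, ← Real.rpow_mul hn0.le]
      push_cast
      ring
    have h2 := hr.rpow_neg_le_of_not_subset (N := n) ha hδ (by linarith) hsub
    have h3 : (n : ℝ) ^ (-(γ.card : ℝ)) ≤ (n : ℝ) ^ (T.card : ℝ) * (n : ℝ) ^ (-(T.card : ℝ)) := by
      rw [← Real.rpow_add hn0]
      refine Real.rpow_le_rpow_of_exponent_le hn' ?_
      have : (0 : ℝ) ≤ γ.card := by positivity
      linarith
    calc approxWeight ν n γ.card (r γ) =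
          phi s (r γ) * (r γ ^ (-(n : ℝ)) * (n : ℝ) ^ (-(γ.card : ℝ))) := by
          rw [approxWeight, hcast _ _ hγ0, hcast _ _ (by linarith), ← hs]
      _ ≤ (U * (n : ℝ) ^ (5 * s)) * (((1 + δ) ^ (-(n : ℝ)) * r T ^ (-(n : ℝ))) *
            ((n : ℝ) ^ (T.card : ℝ) * (n : ℝ) ^ (-(T.card : ℝ)))) := by gcongr
      _ = (U * ((n : ℝ) ^ (5 * s + T.card) * (1 + δ) ^ (-(n : ℝ)))) *
            (r T ^ (-(n : ℝ)) * (n : ℝ) ^ (-(T.card : ℝ))) := by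
          rw [Real.rpow_add hn0]
          ring
      _ ≤ (τ * L) * (r T ^ (-(n : ℝ)) * (n : ℝ) ^ (-(T.card : ℝ))) := by gcongr
      _ = τ * (L * (r T ^ (-(n : ℝ)) * (n : ℝ) ^ (-(T.card : ℝ)))) := by ring
      _ ≤ _ := by
          gcongr
          exact hlower n (by omega) r hr

end Domination

/-! ### Model selection consistency -/

section Consistency

variable {p : ℕ} {Ω : ℕ → Type*} [∀ n, MeasurableSpace (Ω n)] {P : ∀ n, Measure (Ω n)}

/-- Consistency follows once separation of the models makes the true model dominate. -/
lemma consistent_of_separated {T : Finset (Fin p)} {BF R : ∀ n, Ω n → Finset (Fin p) → ℝ}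
    (hsep : ∀ c : ℝ, 0 < c → ∃ a B δ : ℝ, 0 < a ∧ 0 ≤ B ∧ 0 < δ ∧ ∀ᶠ n in atTop,
      P n {ω | ¬ Separated n (fun γ => 1 - R n ω γ) T a B δ} ≤ ENNReal.ofReal c)
    (hBF : ∀ a B δ : ℝ, 0 < a → 0 ≤ B → 0 < δ → ∀ τ : ℝ, 0 < τ → ∀ᶠ n in atTop,
      ∀ᵐ ω ∂P n, Separated n (fun γ => 1 - R n ω γ) T a B δ →
        0 < BF n ω T ∧ ∀ γ : Finset (Fin p), γ.Nonempty → γ ≠ T →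
          0 ≤ BF n ω γ ∧ BF n ω γ ≤ τ * BF n ω T) :
    Consistent P T BF := by
  refine consistent_of_ratio fun τ hτ c hc => ?_
  obtain ⟨a, B, δ, ha, hB, hδ, hev⟩ := hsep c hc
  filter_upwards [hev, hBF a B δ ha hB hδ τ hτ] with n hn hn'
  refine (measure_mono_ae ?_).trans hn
  filter_upwards [hn'] with ω hω hbad hS
  exact hbad (hω hS)

/-- Separation makes the true model dominate for the Gaussian Bayes factors. -/
lemma eventually_bfGaussian_le {T : Finset (Fin p)} (hT : T.Nonempty) {ν k : ℝ} (hνk : 0 < ν + k)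
    (hν : ν < 1) {a B δ : ℝ} (ha : 0 < a) (hB : 0 ≤ B) (hδ : 0 < δ) {τ : ℝ} (hτ : 0 < τ) :
    ∀ᶠ n : ℕ in atTop, ∀ (X : Matrix (Fin n) (Fin p) ℝ) (y : Fin n → ℝ),
      Separated n (fun γ => 1 - rSquared X y γ) T a B δ →
        0 < bfGaussian ν k X y T ∧ ∀ γ : Finset (Fin p), γ.Nonempty → γ ≠ T →
          0 ≤ bfGaussian ν k X y γ ∧ bfGaussian ν k X y γ ≤ τ * bfGaussian ν k X y T := by
  have hall : ∀ γ : Finset (Fin p), ∀ᶠ n : ℕ in atTop, γ.Nonempty → γ ≠ T →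
      ∀ R : Finset (Fin p) → ℝ, Separated n (fun γ => 1 - R γ) T a B δ →
      gIntegral n γ.card ν k (R γ) ≤ τ * gIntegral n T.card ν k (R T) := by
    intro γ
    by_cases hγ : γ.Nonempty ∧ γ ≠ T
    · filter_upwards [eventually_gIntegral_le hT hνk hν ha hB hδ hτ hγ.1 hγ.2] with n hn _ _
      exact hn
    · exact Eventually.of_forall fun n h1 h2 => absurd ⟨h1, h2⟩ hγ
  filter_upwards [eventually_all.2 hall, eventually_ge_atTop 3] with n hn hn3 X y hS
  have hpos : ∀ γ : Finset (Fin p), γ.Nonempty → 0 < gIntegral n γ.card ν k (rSquared X y γ) := by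
    intro γ hγ
    have h1 := hS.pos ha γ
    have h2 := hS.le_one γ
    exact gIntegral_pos hn3 hνk (hν.trans_le (by exact_mod_cast hγ.card_pos)) (by linarith)
      (by linarith)
  have hF := hpos Finset.univ (hT.mono (Finset.subset_univ T))
  rw [Finset.card_univ, Fintype.card_fin] at hF
  refine ⟨div_pos (hpos T hT) hF, fun γ hγ hγT => ⟨(div_pos (hpos γ hγ) hF).le, ?_⟩⟩
  rw [bfGaussian, bfGaussian, ← mul_div_assoc]
  gcongr
  exact hn γ hγ hγT _ hS

/-- Separation makes the true model dominate for the approximate Bayes factors. -/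
lemma eventually_bfApprox_le {T : Finset (Fin p)} (hT : T.Nonempty) {ν : ℝ}
    (hν : ν < 1) {a B δ : ℝ} (ha : 0 < a) (hB : 0 ≤ B) (hδ : 0 < δ) {τ : ℝ} (hτ : 0 < τ) :
    ∀ᶠ n : ℕ in atTop, ∀ (X : Matrix (Fin n) (Fin p) ℝ) (y : Fin n → ℝ),
      Separated n (fun γ => 1 - rSquared X y γ) T a B δ →
        0 < bfApprox ν X y T ∧ ∀ γ : Finset (Fin p), γ.Nonempty → γ ≠ T →
          0 ≤ bfApprox ν X y γ ∧ bfApprox ν X y γ ≤ τ * bfApprox ν X y T := by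
  have hall : ∀ γ : Finset (Fin p), ∀ᶠ n : ℕ in atTop, γ.Nonempty → γ ≠ T →
      ∀ r : Finset (Fin p) → ℝ, Separated n r T a B δ →
      approxWeight ν n γ.card (r γ) ≤ τ ^ 2 * approxWeight ν n T.card (r T) := by
    intro γ
    by_cases hγ : γ.Nonempty ∧ γ ≠ T
    · filter_upwards [eventually_approxWeight_le hT hν ha hB hδ (show 0 < τ ^ 2 by positivity)
        hγ.1 hγ.2] with n hn _ _
      exact hn
    · exact Eventually.of_forall fun n h1 h2 => absurd ⟨h1, h2⟩ hγ
  filter_upwards [eventually_all.2 hall, eventually_gt_atTop 0] with n hn hn0 X y hS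
  have hn' : (0 : ℝ) < n := by exact_mod_cast hn0
  have h0 : ∀ γ, 0 < 1 - rSquared X y γ := hS.pos ha
  have hlt : ∀ γ : Finset (Fin p), γ.Nonempty → 1 - rSquared X y γ < 1 := by
    intro γ hγ
    have h1 := hS.one_sub γ hγ
    have h2 : 0 < a * ((n : ℝ) ^ 5)⁻¹ := by positivity
    linarith
  have hF : (Finset.univ : Finset (Fin p)).Nonempty := hT.mono (Finset.subset_univ T)
  have hνc : ∀ γ : Finset (Fin p), γ.Nonempty → ν < γ.card := fun γ hγ =>
    hν.trans_le (by exact_mod_cast hγ.card_pos)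
  have hp : ν < p := by simpa using hνc _ hF
  have hwF := approxWeight_pos hn0 hp (h0 Finset.univ) (hlt _ hF)
  have hwT := approxWeight_pos hn0 (hνc T hT) (h0 T) (hlt T hT)
  have heq : ∀ γ : Finset (Fin p), γ.Nonempty → bfApprox ν X y γ =
      √(approxWeight ν n γ.card (1 - rSquared X y γ) /
        approxWeight ν n p (1 - rSquared X y Finset.univ)) := fun γ hγ =>
    bfApprox_eq hp (hνc γ hγ) h0 (hlt γ hγ) (hlt _ hF)
  refine ⟨by rw [heq T hT]; positivity, fun γ hγ hγT => ?_⟩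
  rw [heq γ hγ, heq T hT]
  refine ⟨Real.sqrt_nonneg _, ?_⟩
  rw [← Real.sqrt_sq hτ.le, ← Real.sqrt_mul (by positivity), ← mul_div_assoc]
  refine Real.sqrt_le_sqrt ?_
  gcongr
  exact hn γ hγ hγT _ hS

/-- Whatever the spherical error density, the limit that defines the robust Bayes factor almost
surely exists and is the Gaussian Bayes factor with `k = 0`. -/
lemma SphericalError.ae_tendsto_bfProper {n : ℕ} {Ω : Type*} [MeasurableSpace Ω]
    {P : Measure Ω} [IsProbabilityMeasure P] {X : Matrix (Fin n) (Fin p) ℝ}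
    {ε : Ω → Fin n → ℝ} {f : ℝ → ℝ} (hε : SphericalError P ε f)
    (hX : StandardizedDesign X) (hn : p + 1 < n) {T : Finset (Fin p)} (hT : T.Nonempty)
    (α : ℝ) {σ : ℝ} (hσ : 0 < σ) (β : T → ℝ) {ν : ℝ} (hν : 0 < ν) (hν1 : ν < 1) :
    ∀ᵐ ω ∂P, ∀ γ : Finset (Fin p), γ.Nonempty →
      Tendsto (bfProper f ν X (response X T α σ β (ε ω)) γ) atTop
        (𝓝 (ENNReal.ofReal (bfGaussian ν 0 X (response X T α σ β (ε ω)) γ))) := by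
  have hp : 0 < p := (T.card_pos.2 hT).trans_le (by simpa using T.card_le_univ)
  filter_upwards [hε.ae_rss_pos hX hn T α hσ β] with ω hω γ hγ
  exact hX.tendsto_bfProper (by omega) hε.measurable_density hν hν1
    (hε.radialMoment_ne_top (by omega) hν hν1) (hε.radialMoment_ne_zero (by omega) _) _ hω hγ

lemma bfRobust_eq {n : ℕ} {X : Matrix (Fin n) (Fin p) ℝ} {f : ℝ → ℝ} {ν : ℝ} {y : Fin n → ℝ}
    {γ : Finset (Fin p)} (h0 : 0 ≤ bfGaussian ν 0 X y γ)
    (h : Tendsto (bfProper f ν X y γ) atTop (𝓝 (ENNReal.ofReal (bfGaussian ν 0 X y γ)))) :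
    bfRobust f ν X y γ = bfGaussian ν 0 X y γ := by
  rw [bfRobust, h.limUnder_eq, ENNReal.toReal_ofReal h0]

end Consistency

end SSRegression

end

theorem mainTheorem6 {p : ℕ} {Ω : ℕ → Type*} [∀ n, MeasurableSpace (Ω n)]
    (P : ∀ n, Measure (Ω n)) [∀ n, IsProbabilityMeasure (P n)]
    (X : ∀ n, Matrix (Fin n) (Fin p) ℝ)
    (hX : ∀ n, p + 1 < n → SSRegression.StandardizedDesign (X n))
    (ε : ∀ n, Ω n → Fin n → ℝ) (f : ℕ → ℝ → ℝ)
    (hε : ∀ n, p + 1 < n → SSRegression.SphericalError (P n) (ε n) (f n))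
    (T : Finset (Fin p)) (hT : T.Nonempty)
    (α σ : ℝ) (hσ : 0 < σ) (β : T → ℝ) (hβ : ∀ i, β i ≠ 0)
    (y : ∀ n, Ω n → Fin n → ℝ)
    (hy : ∀ n ω, y n ω = SSRegression.response (X n) T α σ β (ε n ω))
    -- A1: `‖ε‖² / n` is bounded in probability from below and from above
    (hA1 : ∀ c : ℝ, 0 < c → ∃ M : ℝ, 0 < M ∧ ∀ n : ℕ, p + 1 < n →
      1 - c < (P n).real
        {ω | M⁻¹ < SSRegression.sqNorm (ε n ω) / n ∧ SSRegression.sqNorm (ε n ω) / n < M})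
    -- A2: the correlation matrix of the predictors has a positive definite limit
    (hA2 : ∃ C : Matrix (Fin p) (Fin p) ℝ, C.PosDef ∧
      Tendsto (fun n : ℕ => (n : ℝ)⁻¹ • ((X n)ᵀ * X n)) atTop (𝓝 C)) :
    (∀ ν : ℝ, ν < 1 →
      SSRegression.Consistent P T fun n ω => SSRegression.bfApprox ν (X n) (y n ω)) ∧
    (∀ ν k : ℝ, 0 ≤ k → -k < ν → ν < 1 →
      SSRegression.Consistent P T fun n ω => SSRegression.bfGaussian ν k (X n) (y n ω)) ∧
    (∀ ν : ℝ, 0 < ν → ν < 1 →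
      (∀ n : ℕ, p + 1 < n → ∀ᵐ ω ∂(P n), ∀ γ : Finset (Fin p), γ.Nonempty →
        Tendsto (SSRegression.bfProper (f n) ν (X n) (y n ω) γ) atTop
          (𝓝 (ENNReal.ofReal (SSRegression.bfRobust (f n) ν (X n) (y n ω) γ)))) ∧
      SSRegression.Consistent P T
        fun n ω => SSRegression.bfRobust (f n) ν (X n) (y n ω)) := by
  obtain rfl : y = fun n ω => SSRegression.response (X n) T α σ β (ε n ω) :=
    funext fun n => funext (hy n)
  have hsep := fun (c : ℝ) (hc : 0 < c) =>
    SSRegression.eventually_separated hX hε hT α hσ hβ hA1 hA2 hc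
  have hlim := fun (ν : ℝ) (hν : 0 < ν) (hν1 : ν < 1) (n : ℕ) (hn : p + 1 < n) =>
    (hε n hn).ae_tendsto_bfProper (hX n hn) hn hT α hσ β hν hν1
  refine ⟨fun ν hν => ?_, fun ν k _ hνk hν => ?_, fun ν hν hν1 => ⟨fun n hn => ?_, ?_⟩⟩
  · refine SSRegression.consistent_of_separated hsep fun a B δ ha hB hδ τ hτ => ?_
    filter_upwards [SSRegression.eventually_bfApprox_le hT hν ha hB hδ hτ] with n hn
    exact ae_of_all _ fun ω => hn _ _
  · refine SSRegression.consistent_of_separated hsep fun a B δ ha hB hδ τ hτ => ?_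
    filter_upwards [SSRegression.eventually_bfGaussian_le (k := k) hT (by linarith) hν ha hB hδ hτ]
      with n hn
    exact ae_of_all _ fun ω => hn _ _
  · filter_upwards [hlim ν hν hν1 n hn] with ω hω γ hγ
    -- `toReal` and `ofReal` cancel because the limit is finite
    have h := hω γ hγ
    rwa [SSRegression.bfRobust, h.limUnder_eq, ENNReal.ofReal_toReal ENNReal.ofReal_ne_top]
  · refine SSRegression.consistent_of_separated hsep fun a B δ ha hB hδ τ hτ => ?_
    filter_upwards [SSRegression.eventually_bfGaussian_le (k := 0) hT (by linarith) hν1 ha hB hδ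
      hτ, eventually_gt_atTop (p + 1)] with n hn hpn
    filter_upwards [hlim ν hν hν1 n hpn] with ω hω hS
    obtain ⟨h1, h2⟩ := hn _ _ hS
    rw [SSRegression.bfRobust_eq h1.le (hω T hT)]
    refine ⟨h1, fun γ hγ hγT => ?_⟩
    rw [SSRegression.bfRobust_eq (h2 γ hγ hγT).1 (hω γ hγ)]
    exact h2 γ hγ hγT
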